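/- Let $\mathbf H_4\subset \mathrm{SL}_2(\mathbb R)$ be the Hecke group generated by $\begin{pmatrix}0&-1\\1&0\end{pmatrix}$ and $\begin{pmatrix}1&\sqrt2\\0&1\end{pmatrix}$ (where $\sqrt 2=2\cos\frac{\pi}{4}$). For a real binary quadratic form $f(x,y)=ax^2+bxy+cy^2$ put $\delta(f)=b^2-4ac$, and for $M\in\mathbf H_4$ put $f(M)=f\!\left(M\begin{pmatrix}1\\0\end{pmatrix}\right)$. The Markoff and Lagrange spectra of $\mathbf H_4$ are the sets of (finite) real numbers $$\mathscr M(\mathbf H_4)=\Big\{\frac{\sqrt{\delta(f)}}{\inf_{M\in\mathbf H_4}|f(M)|}\ \Big|\ \delta(f)>0\Big\},\qquad \mathscr L(\mathbf H_4)=\Big\{\limsup_{M\in\mathbf H_4}\frac{\sqrt{\delta(f)}}{|f(M)|}\ \Big|\ \delta(f)>0\Big\},$$ where the limit superior is taken over the distinct vectors $M\begin{pmatrix}1\\0\end{pmatrix}$, $M\in\mathbf H_4$, as they leave every finite set, and a quotient with denominator $0$ counts as $\infty$; infinite values are discarded. An interval $(a,b)$ with $a<b$ is called a maximal gap in a set $X\subset\mathbb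 R$ if $(a,b)\cap X=\emptyset$ and $a,b\in X$. Romik sequences. Let $\mathcal Q=\{(x,y)\in\mathbb R^2: x^2+y^2=1,\ x,y\ge0\}$ and let $$R(x,y)=\Big(\frac{|2-x-2y|}{3-2x-2y},\frac{|2-2x-y|}{3-2x-2y}\Big),\qquad R:\mathcal Q\to\mathcal Q.$$ A point $(x,y)\in\mathcal Q$ has digit $1$ if $\frac45\le x\le1$, digit $2$ if $\frac35\le x\le\frac45$, and digit $3$ if $0\le x\le\frac35$. Every sequence $P=(d_1,d_2,\dots)\in\{1,2,3\}^{\mathbb N}$ is the digit expansion of exactly one point $(\alpha,\beta)\in\mathcal Q$, in the sense that $R^{j-1}(\alpha,\beta)$ has digit $d_j$ for all $j\ge1$; put $[P]=\frac1{\sqrt2}\big(\frac{\alpha}{1-\beta}-1\big)\in[0,\infty]$, with $[P]=\infty$ if $(\alpha,\beta)=(0,1)$. Let $P^\vee$ be obtained from $P$ by exchanging the digits $1$ and $3$. Write $P^*|Q$ for the doubly infinite sequence $\dots p_2p_1|q_1q_2\dots$ with a marked cut, where $P=(p_1,p_2,\dots)$ and $Q=(q_1,q_2,\dots)$. For a doubly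 infinite sequence $T\in\{1,2,3\}^{\mathbb Z}$ put $$\mathcal M(T)=\sup_{P^*|Q}\max\big\{[P]+[Q],\ [P^\vee]+[Q^\vee]\big\}\in[0,\infty],$$ where $P^*|Q$ runs over all ways to cut $T$ between two consecutive places. For a finite word $W$, $W^\infty$ and ${}^\infty W^\infty$ denote the one-sided and the two-sided infinite periodic sequences with period $W$, and $P^*WQ$ denotes the word $W$ followed by $Q$ and preceded by $P$ written from right to left. Theorem. The intervals $$\Big(\frac{\sqrt{238}}5,\ \sqrt{10}\Big)\qquad\text{and}\qquad\Big(\sqrt{10},\ \frac{2124\sqrt2+48\sqrt{238}}{1177}\Big)$$ are maximal gaps in both $\mathscr M(\mathbf H_4)$ and $\mathscr L(\mathbf H_4)$; in particular $\sqrt{10}$ is an isolated point of both spectra. Moreover $$\mathcal M\big({}^\infty(31321312)^\infty\big)=\frac{\sqrt{238}}5,\qquad \mathcal M\big({}^\infty(32)^\infty\big)=\sqrt{10},\qquad \mathcal M\big(S^*23232\,S\big)=\frac{2124\sqrt2+48\sqrt{238}}{1177},$$ where $S=(31321312)^\infty$, and $\frac{2124\sqrt2+48\sqrt{238}}{1177}$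 is an accumulation point of $\mathscr M(\mathbf H_4)$. -/

import Mathlib

open scoped MatrixGroups

/-! ### Hecke groups and their Markoff and Lagrange spectra -/

/-- The inversion `S = (0, -1; 1, 0)`. -/
def heckeS : SL(2, ℝ) := ⟨!![0, -1; 1, 0], by simp [Matrix.det_fin_two]⟩

/-- The translation `T = (1, l; 0, 1)`. -/
def heckeT (l : ℝ) : SL(2, ℝ) := ⟨!![1, l; 0, 1], by simp [Matrix.det_fin_two]⟩

/-- The Hecke group `H_q`, generated by `S` and by `T` with translation length `2 cos (π / q)`. -/
noncomputable def heckeGroup (q : ℕ) : Subgroup SL(2, ℝ) :=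
  Subgroup.closure {heckeS, heckeT (2 * Real.cos (Real.pi / q))}

/-- The binary quadratic form `a x² + b x y + c y²`. -/
def binForm (a b c : ℝ) (v : Fin 2 → ℝ) : ℝ :=
  a * v 0 ^ 2 + b * (v 0 * v 1) + c * v 1 ^ 2

/-- The image `M (1, 0)ᵗ` of the first basis vector. -/
def firstColumn (M : SL(2, ℝ)) : Fin 2 → ℝ :=
  M.1.mulVec ![1, 0]

/-- The Markoff spectrum of `G`: the finite values `√δ(f) / inf_{M ∈ G} |f(M (1, 0)ᵗ)|`, where `f`
runs over the real binary quadratic forms of positive discriminant. -/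
def markoffSpectrum (G : Subgroup SL(2, ℝ)) : Set ℝ :=
  {m | ∃ a b c : ℝ, 0 < b ^ 2 - 4 * a * c ∧
    0 < ⨅ M : G, |binForm a b c (firstColumn M)| ∧
    m = √(b ^ 2 - 4 * a * c) / ⨅ M : G, |binForm a b c (firstColumn M)|}

/-- The orbit of `(1, 0)ᵗ` under `G`. -/
def cuspOrbit (G : Subgroup SL(2, ℝ)) : Set (Fin 2 → ℝ) :=
  {v | ∃ M ∈ G, v = firstColumn M}

/-- The Lagrange spectrum of `G`: the finite values of the limit superior of `√δ(f) / |f(M (1, 0)ᵗ)|`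
as the vector `M (1, 0)ᵗ`, `M ∈ G`, leaves every finite set, where `f` runs over the real binary
quadratic forms of positive discriminant. (A quotient `√δ(f) / 0` is `∞`.) -/
def lagrangeSpectrum (G : Subgroup SL(2, ℝ)) : Set ℝ :=
  {m | 0 ≤ m ∧ ∃ a b c : ℝ, 0 < b ^ 2 - 4 * a * c ∧
    Filter.limsup
      (fun v : cuspOrbit G =>
        ENNReal.ofReal √(b ^ 2 - 4 * a * c) / ENNReal.ofReal |binForm a b c v|)
      Filter.cofinite = ENNReal.ofReal m}

/-- `(a, b)` is a maximal gap of `X`: it misses `X` and both of its endpoints lie in `X`. -/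
def IsMaximalGap (X : Set ℝ) (a b : ℝ) : Prop :=
  a < b ∧ Set.Ioo a b ∩ X = ∅ ∧ a ∈ X ∧ b ∈ X

/-- `x` is an isolated point of `X`. -/
def IsIsolatedPoint (X : Set ℝ) (x : ℝ) : Prop :=
  x ∈ X ∧ ∃ ε > 0, Set.Ioo (x - ε) (x + ε) ∩ X = {x}

/-! ### Romik digits -/

/-- The three Romik digits `1, 2, 3`. -/
inductive RomikDigit
  | one
  | two
  | three

namespace RomikDigit

/-- The involution on digits that exchanges `1` and `3` and fixes `2`. -/
def vee : RomikDigit → RomikDigit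
  | one => three
  | two => two
  | three => one

/-- The closed set of abscissae of the points of the quarter circle that have a given digit. -/
def cell : RomikDigit → Set ℝ
  | one => Set.Icc (4 / 5) 1
  | two => Set.Icc (3 / 5) (4 / 5)
  | three => Set.Icc 0 (3 / 5)

end RomikDigit

/-- The quarter circle `x² + y² = 1`, `x, y ≥ 0`. -/
def quarterCircle : Set (ℝ × ℝ) :=
  {p | p.1 ^ 2 + p.2 ^ 2 = 1 ∧ 0 ≤ p.1 ∧ 0 ≤ p.2}

/-- The Romik map of the quarter circle. -/
noncomputable def romikMap (p : ℝ × ℝ) : ℝ × ℝ :=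
  (|2 - p.1 - 2 * p.2| / (3 - 2 * p.1 - 2 * p.2),
    |2 - 2 * p.1 - p.2| / (3 - 2 * p.1 - 2 * p.2))

/-- `p` is a point of the quarter circle with Romik digit expansion `d 0, d 1, d 2, …`. -/
def HasRomikExpansion (p : ℝ × ℝ) (d : ℕ → RomikDigit) : Prop :=
  p ∈ quarterCircle ∧ ∀ j : ℕ, (romikMap^[j] p).1 ∈ (d j).cell

/-- The point `[d 0, d 1, …]` of the quarter circle with a given Romik expansion
(every digit sequence is the expansion of exactly one point). -/
noncomputable def romikPoint (d : ℕ → RomikDigit) : ℝ × ℝ :=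
  Classical.epsilon fun p => HasRomikExpansion p d

/-- The modified stereographic projection `(α, β) ↦ (α / (1 - β) - 1) / √2` of the quarter circle
onto `[0, ∞]`; it sends `(0, 1)` to `∞`. -/
noncomputable def stereo (p : ℝ × ℝ) : ENNReal :=
  open Classical in
  if p.2 = 1 then ⊤ else ENNReal.ofReal ((p.1 / (1 - p.2) - 1) / √2)

/-- The value `[P] ∈ [0, ∞]` of an infinite Romik sequence `P`. -/
noncomputable def romikValue (P : ℕ → RomikDigit) : ENNReal :=
  stereo (romikPoint P)

/-- The section quantity `L(P* | Q) = [P] + [Q]` of a doubly infinite sequence `t`, cut between the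
places `n` and `n + 1`: here `P = (t n, t (n - 1), …)` and `Q = (t (n + 1), t (n + 2), …)`. -/
noncomputable def sectionValue (t : ℤ → RomikDigit) (n : ℤ) : ENNReal :=
  romikValue (fun k => t (n - k)) + romikValue (fun k => t (n + 1 + k))

/-- The Markoff number of a doubly infinite Romik sequence: the supremum over all sections of
`max (L(P* | Q)) (L((P^∨)* | Q^∨))`. -/
noncomputable def markoffNumber (t : ℤ → RomikDigit) : ENNReal :=
  ⨆ n : ℤ, max (sectionValue t n) (sectionValue (fun i => (t i).vee) n)

/-- The one-sided infinite periodic sequence `w^∞`. -/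
def periodicSeq {k : ℕ} [NeZero k] (w : Fin k → RomikDigit) (n : ℕ) : RomikDigit :=
  w (Fin.ofNat k n)

/-- The doubly infinite periodic sequence `^∞w^∞`. -/
def biPeriodicSeq {k : ℕ} [NeZero k] (w : Fin k → RomikDigit) (n : ℤ) : RomikDigit :=
  w (Fin.ofNat k (n % k).toNat)

/-- The doubly infinite sequence `P* w Q`: the finite word `w` occupies the places `0, …, k - 1`, is
followed by `Q`, and is preceded by `P` written from right to left. -/
def joinSeq {k : ℕ} (P : ℕ → RomikDigit) (w : Fin k → RomikDigit) (Q : ℕ → RomikDigit) (n : ℤ) :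
    RomikDigit :=
  if n < 0 then P (-1 - n).toNat
  else if h : n.toNat < k then w ⟨n.toNat, h⟩
  else Q (n.toNat - k)

/-- The word `32`. -/
def word32 : Fin 2 → RomikDigit := ![.three, .two]

/-- The word `23232`. -/
def word23232 : Fin 5 → RomikDigit := ![.two, .three, .two, .three, .two]

/-- The word `31321312`. -/
def word31321312 : Fin 8 → RomikDigit :=
  ![.three, .one, .three, .two, .one, .three, .one, .two]

/-! In the coordinate `[P] / √2` the inverse branches of the Romik map are `x / (2x + 1)`, `(x + 1)
/ (2x + 1)` and `x + 1`, and exchanging the digits `1` and `3` is `x ↦ 1 / (2x)`. A form with roots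
`√2 Q` and `-√2 P`, `P, Q > 0`, has a geodesic crossing the edge `0, ∞`. Expanding `Q` and pushing
its digits onto `P`, and the same in the other direction, gives a doubly infinite sequence with tail
coordinates `p n`, `q n` at each cut. The quotients `√δ / |f|` at the two ends of the `n`-th crossed
edge are `√2 (p n + q n)` and `√2 (1 / (2 p n) + 1 / (2 q n))`. A cusp with quotient above `√2` is
an end of a crossed edge (`exists_crossing`), so both spectra can be read off from sequences.

The gaps. Suppose all sections, divided by `√2`, stay below `upperBound`. Crude estimates exclude
`11` and `33` and force every `232` to sit inside `32323`, and dually every `212`. Such a sequence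
is tame, and a self-bounding argument shows that none of its tails exceeds `κ = periodicBound`, the
coordinate of `(32131231)^∞`. Hence a section away from the centre of every `232` is at most `√119 /
5`. Now let a run of overlapping `232` end. If it has exactly two centres, their sections are `1 + F
x + G y` and `1 + F y + G x`, where `F = branch231` decreases, `G = branch23231` increases more
slowly, and `x, y ≤ κ`. The larger of them is at least `1 + F κ + G κ = upperBound`; the other ways
of ending also reach `upperBound`. So a run never ends, the sequence is `(32)^∞`, and its sections
are all `√5`. This dichotomy is `IsBoundedGeodesic.gap`.

The transfer. For the Markoff spectrum the dichotomy applies to each large quotient of the form. For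
the Lagrange spectrum the crossings of cusps whose quotients tend to the limit superior are compact
up to the group action; a limit crossing belongs to a form whose Markoff value is the given Lagrange
value.

The end points. Conversely, a descent through the tessellation (`IsExpansion.edge_descent`) shows
that the form of a given sequence has no large quotients other than those at its cuts. The values
are attained by `(32)^∞` and by concatenations of the blocks `31321312` and `31323232`. One
exceptional block gives `upperBound`, two distant ones give values that accumulate there from above,
and exceptional blocks at the squares put it into the Lagrange spectrum. -/

namespace RomikDigit

/-! ### The inverse branches of the Romik map -/

@[simp] lemma vee_one : vee one = three := rfl
@[simp] lemma vee_two : vee two = two := rfl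
@[simp] lemma vee_three : vee three = one := rfl

@[simp] lemma vee_eq_one {d : RomikDigit} : d.vee = one ↔ d = three := by cases d <;> simp
@[simp] lemma vee_eq_two {d : RomikDigit} : d.vee = two ↔ d = two := by cases d <;> simp
@[simp] lemma vee_eq_three {d : RomikDigit} : d.vee = three ↔ d = one := by cases d <;> simp

/-- The inverse branches of the Romik map in the coordinate `[P] / √2`. -/
noncomputable def branch : RomikDigit → ℝ → ℝ
  | one, x => x / (2 * x + 1)
  | two, x => (x + 1) / (2 * x + 1)
  | three, x => x + 1

lemma branch_pos (d : RomikDigit) {x : ℝ} (hx : 0 < x) : 0 < d.branch x := by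
  cases d <;> simp only [branch] <;> positivity

lemma branch_one_lt {x : ℝ} (hx : 0 < x) : one.branch x < 1 / 2 := by
  simp only [branch]; rw [div_lt_div_iff₀ (by positivity) (by norm_num)]; linarith

lemma branch_two_lt {x : ℝ} (hx : 0 < x) : two.branch x < 1 := by
  simp only [branch]; rw [div_lt_one (by positivity)]; linarith

lemma lt_branch_two {x : ℝ} (hx : 0 < x) : 1 / 2 < two.branch x := by
  simp only [branch]; rw [div_lt_div_iff₀ (by norm_num) (by positivity)]; linarith

lemma lt_branch_three {x : ℝ} (hx : 0 < x) : 1 < three.branch x := by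
  simp only [branch]; linarith

lemma branch_one_le {x y : ℝ} (hx : 0 < x) (h : x ≤ y) : one.branch x ≤ one.branch y := by
  simp only [branch]
  rw [div_le_div_iff₀ (by positivity) (by linarith)]; nlinarith

lemma branch_two_le {x y : ℝ} (hx : 0 < x) (h : x ≤ y) : two.branch y ≤ two.branch x := by
  simp only [branch]
  rw [div_le_div_iff₀ (by linarith) (by positivity)]; nlinarith

/-- The inversion `x ↦ 1 / (2x)` conjugates each branch to that of the exchanged digit. Every
estimate on tails thus has a dual obtained without further work. -/
lemma branch_vee (d : RomikDigit) {x : ℝ} (hx : 0 < x) :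
    d.vee.branch (1 / (2 * x)) = 1 / (2 * d.branch x) := by
  cases d <;> simp only [branch, vee] <;> field_simp <;> ring

/-- The three branches map the positive axis injectively onto the disjoint intervals `(0, 1/2)`,
`(1/2, 1)` and `(1, ∞)`. -/
lemma branch_inj {d d' : RomikDigit} {x x' : ℝ} (hx : 0 < x) (hx' : 0 < x')
    (h : d.branch x = d'.branch x') : d = d' ∧ x = x' := by
  have a1 := branch_one_lt hx
  have a2 := branch_two_lt hx
  have a3 := lt_branch_two hx
  have a4 := lt_branch_three hx
  have b1 := branch_one_lt hx'
  have b2 := branch_two_lt hx'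
  have b3 := lt_branch_two hx'
  have b4 := lt_branch_three hx'
  cases d <;> cases d' <;> first | (exfalso; linarith) | refine ⟨rfl, ?_⟩
  · simp only [branch] at h; field_simp at h; linarith
  · simp only [branch] at h; field_simp at h; linarith
  · simp only [branch] at h; linarith

/-- All branches are nonexpanding. -/
lemma abs_branch_sub_le (d : RomikDigit) {x y : ℝ} (hx : 0 < x) (hy : 0 < y) :
    |d.branch x - d.branch y| ≤ |x - y| := by
  have hxy : 1 ≤ (2 * x + 1) * (2 * y + 1) := by nlinarith [mul_pos hx hy]
  cases d with
  | one =>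
    have : one.branch x - one.branch y = (x - y) / ((2 * x + 1) * (2 * y + 1)) := by
      simp only [branch]; field_simp; ring
    rw [this, abs_div, abs_of_pos (by positivity : 0 < (2 * x + 1) * (2 * y + 1))]
    exact div_le_self (abs_nonneg _) hxy
  | two =>
    have : two.branch x - two.branch y = -(x - y) / ((2 * x + 1) * (2 * y + 1)) := by
      simp only [branch]; field_simp; ring
    rw [this, abs_div, abs_neg, abs_of_pos (by positivity : 0 < (2 * x + 1) * (2 * y + 1))]
    exact div_le_self (abs_nonneg _) hxy
  | three => simp [branch]

/-- The branches of the digits `1` and `2` contract away from `0`. -/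
lemma abs_branch_sub_le_half {d : RomikDigit} (hd : d ≠ three) {x y : ℝ} (hx : 1 / 4 ≤ x)
    (hy : 1 / 4 ≤ y) : |d.branch x - d.branch y| ≤ |x - y| / 2 := by
  have hx0 : 0 < x := by linarith
  have hy0 : 0 < y := by linarith
  have hxy : 2 ≤ (2 * x + 1) * (2 * y + 1) := by nlinarith
  cases d with
  | one =>
    have : one.branch x - one.branch y = (x - y) / ((2 * x + 1) * (2 * y + 1)) := by
      simp only [branch]; field_simp; ring
    rw [this, abs_div, abs_of_pos (by positivity : 0 < (2 * x + 1) * (2 * y + 1))]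
    exact div_le_div_of_nonneg_left (abs_nonneg _) (by norm_num) hxy
  | two =>
    have : two.branch x - two.branch y = -(x - y) / ((2 * x + 1) * (2 * y + 1)) := by
      simp only [branch]; field_simp; ring
    rw [this, abs_div, abs_neg, abs_of_pos (by positivity : 0 < (2 * x + 1) * (2 * y + 1))]
    exact div_le_div_of_nonneg_left (abs_nonneg _) (by norm_num) hxy
  | three => exact absurd rfl hd

end RomikDigit

/-! ### Expansions of tails and their uniqueness -/

open RomikDigit

/-- `x n` is the coordinate `[d n, d (n + 1), …] / √2` of the tails of a digit sequence `d`. -/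
structure IsExpansion (d : ℕ → RomikDigit) (x : ℕ → ℝ) : Prop where
  pos : ∀ n, 0 < x n
  eq : ∀ n, x n = (d n).branch (x (n + 1))

/-- The digit sequence has no factors `11` and `33`. -/
def NoRepeat (d : ℕ → RomikDigit) : Prop :=
  ∀ n, ¬(d n = one ∧ d (n + 1) = one) ∧ ¬(d n = three ∧ d (n + 1) = three)

lemma NoRepeat.shift {d : ℕ → RomikDigit} (h : NoRepeat d) (k : ℕ) :
    NoRepeat fun n => d (n + k) := by
  intro n
  have := h (n + k)
  simpa only [add_right_comm n k 1] using this

lemma NoRepeat.vee {d : ℕ → RomikDigit} (h : NoRepeat d) : NoRepeat fun n => (d n).vee := by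
  intro n
  simpa [and_comm] using h n

namespace IsExpansion

variable {d d' : ℕ → RomikDigit} {x x' : ℕ → ℝ}

lemma shift (h : IsExpansion d x) (k : ℕ) :
    IsExpansion (fun n => d (n + k)) (fun n => x (n + k)) :=
  ⟨fun n => h.pos _, fun n => by
    have := h.eq (n + k)
    simpa only [add_right_comm n k 1] using this⟩

lemma vee (h : IsExpansion d x) : IsExpansion (fun n => (d n).vee) (fun n => 1 / (2 * x n)) :=
  ⟨fun n => by have := h.pos n; positivity, fun n => by
    rw [branch_vee _ (h.pos _), ← h.eq n]⟩

lemma lt_half (h : IsExpansion d x) {n : ℕ} (hn : d n = one) : x n < 1 / 2 := by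
  rw [h.eq, hn]; exact branch_one_lt (h.pos _)

lemma half_lt (h : IsExpansion d x) {n : ℕ} (hn : d n ≠ one) : 1 / 2 < x n := by
  rw [h.eq]
  cases hd : d n with
  | one => exact absurd hd hn
  | two => exact lt_branch_two (h.pos _)
  | three => linarith [lt_branch_three (h.pos (n + 1))]

lemma lt_one (h : IsExpansion d x) {n : ℕ} (hn : d n ≠ three) : x n < 1 := by
  rw [h.eq]
  cases hd : d n with
  | three => exact absurd hd hn
  | two => exact branch_two_lt (h.pos _)
  | one => linarith [branch_one_lt (h.pos (n + 1))]

lemma one_lt (h : IsExpansion d x) {n : ℕ} (hn : d n = three) : 1 < x n := by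
  rw [h.eq, hn]; exact lt_branch_three (h.pos _)

lemma lt_two (h : IsExpansion d x) (hd : NoRepeat d) (n : ℕ) : x n < 2 := by
  by_cases hn : d n = three
  · have h1 : d (n + 1) ≠ three := fun h1 => (hd n).2 ⟨hn, h1⟩
    have := h.lt_one h1
    rw [h.eq, hn]; simp only [branch]; linarith
  · linarith [h.lt_one hn]

lemma quarter_lt (h : IsExpansion d x) (hd : NoRepeat d) (n : ℕ) : 1 / 4 < x n := by
  have := h.vee.lt_two hd.vee n
  have hx := h.pos n
  rw [div_lt_iff₀ (by positivity)] at this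
  linarith

/-- The branch of `3` is a translation and contracts nothing, but two `3`s are never adjacent, so
one of any two consecutive branches halves distances. -/
lemma abs_sub_le_two_step (h : IsExpansion d x) (h' : IsExpansion d' x') (hd : NoRepeat d)
    (hd' : NoRepeat d') {n : ℕ} (h0 : d n = d' n) (h1 : d (n + 1) = d' (n + 1)) :
    |x n - x' n| ≤ |x (n + 2) - x' (n + 2)| / 2 := by
  rw [h.eq n, h'.eq n, ← h0]
  have e : |x (n + 1) - x' (n + 1)| ≤ |x (n + 2) - x' (n + 2)| := by
    rw [h.eq (n + 1), h'.eq (n + 1), ← h1]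
    exact abs_branch_sub_le _ (h.pos _) (h'.pos _)
  by_cases hn : d n = three
  · have hn1 : d (n + 1) ≠ three := fun hn1 => (hd n).2 ⟨hn, hn1⟩
    refine (abs_branch_sub_le _ (h.pos _) (h'.pos _)).trans ?_
    rw [h.eq (n + 1), h'.eq (n + 1), ← h1]
    exact abs_branch_sub_le_half hn1 (h.quarter_lt hd _).le (h'.quarter_lt hd' _).le
  · refine (abs_branch_sub_le_half hn (h.quarter_lt hd _).le (h'.quarter_lt hd' _).le).trans ?_
    linarith

lemma abs_sub_le_of_agree (h : IsExpansion d x) (h' : IsExpansion d' x') (hd : NoRepeat d)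
    (hd' : NoRepeat d') (k : ℕ) (hdd : ∀ n < 2 * k, d n = d' n) :
    |x 0 - x' 0| ≤ 2 / 2 ^ k := by
  have key : ∀ j ≤ k, |x 0 - x' 0| ≤ |x (2 * j) - x' (2 * j)| / 2 ^ j := by
    intro j
    induction j with
    | zero => intro _; simp
    | succ j ih =>
      intro hj
      refine (ih (by omega)).trans ?_
      have := abs_sub_le_two_step h h' hd hd' (hdd (2 * j) (by omega)) (hdd (2 * j + 1) (by omega))
      rw [pow_succ', ← div_div]
      gcongr
      exact this
  refine (key k le_rfl).trans ?_
  gcongr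
  rw [abs_le]
  have a := h.lt_two hd (2 * k)
  have b := h'.lt_two hd' (2 * k)
  have a' := h.pos (2 * k)
  have b' := h'.pos (2 * k)
  constructor <;> linarith

lemma unique_zero (h : IsExpansion d x) (h' : IsExpansion d x') (hd : NoRepeat d) :
    x 0 = x' 0 := by
  have hlim : Filter.Tendsto (fun k : ℕ => (2 : ℝ) / 2 ^ k) Filter.atTop (nhds 0) := by
    have := (tendsto_pow_atTop_nhds_zero_of_lt_one (r := (1 / 2 : ℝ)) (by norm_num)
      (by norm_num)).const_mul 2
    simpa [div_eq_mul_inv] using this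
  have := ge_of_tendsto' hlim fun k =>
    h.abs_sub_le_of_agree h' hd hd k fun n _ => rfl
  have := abs_nonneg (x 0 - x' 0)
  have : |x 0 - x' 0| = 0 := by linarith
  rw [abs_eq_zero] at this
  linarith

/-- The digits are determined by the coordinate. -/
lemma digits_eq (h : IsExpansion d x) (h' : IsExpansion d' x') (h0 : x 0 = x' 0) (n : ℕ) :
    d n = d' n := by
  have key : ∀ n, x n = x' n := by
    intro n
    induction n with
    | zero => exact h0
    | succ n ih =>
      rw [h.eq n, h'.eq n] at ih
      exact (branch_inj (h.pos _) (h'.pos _) ih).2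
  have := key n
  rw [h.eq n, h'.eq n] at this
  exact (branch_inj (h.pos _) (h'.pos _) this).1

end IsExpansion

/-! ### Existence of expansions by compactness -/

namespace RomikDigit

/-- A compact set of coordinates compatible with a leading digit. -/
def box : RomikDigit → Set ℝ
  | one => Set.Icc (1 / 4) (1 / 2)
  | two => Set.Icc (1 / 2) 1
  | three => Set.Icc 1 2

lemma pos_of_mem_box {d : RomikDigit} {x : ℝ} (h : x ∈ d.box) : 0 < x := by
  cases d <;> simp only [box, Set.mem_Icc] at h <;> linarith

lemma branch_mem_box {d d' : RomikDigit} {x : ℝ} (h1 : ¬(d = one ∧ d' = one))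
    (h3 : ¬(d = three ∧ d' = three)) (h : x ∈ d'.box) : d.branch x ∈ d.box := by
  have hx := pos_of_mem_box h
  cases d with
  | one =>
    have hx : 1 / 2 ≤ x := by
      cases d' <;> simp [box] at h h1 ⊢ <;> linarith
    simp only [box, branch, Set.mem_Icc]
    rw [div_le_div_iff₀ (by norm_num) (by positivity), div_le_div_iff₀ (by positivity) (by norm_num)]
    constructor <;> linarith
  | two => exact ⟨(lt_branch_two hx).le, (branch_two_lt hx).le⟩
  | three =>
    have hx1 : x ≤ 1 := by
      cases d' <;> simp [box] at h h3 ⊢ <;> linarith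
    simp only [box, branch, Set.mem_Icc]
    constructor <;> linarith

lemma continuousOn_branch (d : RomikDigit) : ContinuousOn d.branch (Set.Ioi 0) := by
  cases d with
  | one =>
    refine ContinuousOn.div (by fun_prop) (by fun_prop) fun x hx => ?_
    have : (0 : ℝ) < x := hx
    positivity
  | two =>
    refine ContinuousOn.div (by fun_prop) (by fun_prop) fun x hx => ?_
    have : (0 : ℝ) < x := hx
    positivity
  | three => exact (continuous_id.add continuous_const).continuousOn

end RomikDigit

lemma exists_partial_expansion (k : ℕ) : ∀ d : ℕ → RomikDigit, NoRepeat d →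
    ∃ x : ℕ → ℝ, (∀ n, x n ∈ (d n).box) ∧ ∀ n < k, x n = (d n).branch (x (n + 1)) := by
  induction k with
  | zero =>
    intro d _
    refine ⟨fun n => match d n with | one => 1 / 2 | two => 1 | three => 1, fun n => ?_, by simp⟩
    dsimp only
    cases d n <;> simp [box] <;> norm_num
  | succ k ih =>
    intro d hd
    obtain ⟨x, hx, hx'⟩ := ih (fun n => d (n + 1)) (hd.shift 1)
    refine ⟨fun n => Nat.casesOn n ((d 0).branch (x 0)) x, fun n => ?_, fun n hn => ?_⟩
    · cases n with
      | zero => exact branch_mem_box (hd 0).1 (hd 0).2 (hx 0)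
      | succ n => exact hx n
    · cases n with
      | zero => rfl
      | succ n => exact hx' n (by omega)

/-- The points of the product of boxes that satisfy the first `k` relations form a decreasing
sequence of nonempty compact sets. -/
lemma exists_expansion {d : ℕ → RomikDigit} (hd : NoRepeat d) : ∃ x, IsExpansion d x := by
  let K : Set (ℕ → ℝ) := Set.univ.pi fun n => (d n).box
  have hK : IsCompact K := isCompact_univ_pi fun n => by
    cases d n <;> exact isCompact_Icc
  let C : ℕ → Set (ℕ → ℝ) := fun k => K ∩ {x | ∀ n < k, x n = (d n).branch (x (n + 1))}
  have hclosed : ∀ k, IsClosed (C k) := by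
    intro k
    -- The branches are continuous only on the positive axis, so each relation is shown to be closed
    -- inside `K`.
    have hC : C k = K ∩ ⋂ n ∈ Set.Iio k, K ∩ {x | x n = (d n).branch (x (n + 1))} := by
      ext x
      simp only [C, Set.mem_inter_iff, Set.mem_ofPred_eq, Set.mem_iInter, Set.mem_Iio]
      exact ⟨fun h => ⟨h.1, fun n hn => ⟨h.1, h.2 n hn⟩⟩, fun h => ⟨h.1, fun n hn => (h.2 n hn).2⟩⟩
    rw [hC]
    refine hK.isClosed.inter (isClosed_biInter fun n _ => ?_)
    have hc : ContinuousOn (fun x : ℕ → ℝ => x n - (d n).branch (x (n + 1))) K := by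
      refine (continuous_apply n).continuousOn.sub ?_
      refine (continuousOn_branch (d n)).comp (continuous_apply (n + 1)).continuousOn ?_
      intro x hx
      exact pos_of_mem_box (hx (n + 1) trivial)
    have := hc.preimage_isClosed_of_isClosed hK.isClosed (isClosed_singleton (x := (0 : ℝ)))
    convert this using 2
    ext x
    simp [sub_eq_zero]
  have hne : (⋂ k, C k).Nonempty := by
    refine IsCompact.nonempty_iInter_of_sequence_nonempty_isCompact_isClosed C ?_ ?_ ?_ hclosed
    · exact fun k x hx => ⟨hx.1, fun n hn => hx.2 n (by omega)⟩
    · intro k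
      obtain ⟨x, hx, hx'⟩ := exists_partial_expansion k d hd
      exact ⟨x, fun n _ => hx n, hx'⟩
    · exact hK.of_isClosed_subset (hclosed 0) Set.inter_subset_left
  obtain ⟨x, hx⟩ := hne
  rw [Set.mem_iInter] at hx
  exact ⟨x, fun n => pos_of_mem_box ((hx 0).1 n trivial), fun n => (hx (n + 1)).2 n (by omega)⟩

/-! ### The largest tail of a tame sequence -/

/-- The coordinate of `(32131231)^∞`. -/
noncomputable def periodicBound : ℝ := (7 + √119) / 10

lemma periodicBound_pos : 0 < periodicBound := by unfold periodicBound; positivity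

lemma periodicBound_sq : 10 * periodicBound ^ 2 = 14 * periodicBound + 7 := by
  have : √119 ^ 2 = 119 := Real.sq_sqrt (by norm_num)
  unfold periodicBound
  nlinarith

lemma lt_sqrt_119 : 10.908 < √119 := Real.lt_sqrt_of_sq_lt (by norm_num)

lemma sqrt_119_lt : √119 < 10.909 := by
  rw [Real.sqrt_lt' (by norm_num)]; norm_num

lemma lt_periodicBound : 1.7908 < periodicBound := by
  unfold periodicBound; linarith [lt_sqrt_119]

/-- A digit sequence without the factors `11`, `33`, `3212` and `1232`. -/
structure IsTame (d : ℕ → RomikDigit) : Prop where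
  noRepeat : NoRepeat d
  left : ∀ n, d n = three → d (n + 1) = two → d (n + 2) = one → d (n + 3) ≠ two
  right : ∀ n, d n = one → d (n + 1) = two → d (n + 2) = three → d (n + 3) ≠ two

lemma IsTame.vee {d : ℕ → RomikDigit} (h : IsTame d) : IsTame fun n => (d n).vee :=
  ⟨h.noRepeat.vee, fun n => by simpa using h.right n, fun n => by simpa using h.left n⟩

namespace IsExpansion

variable {d : ℕ → RomikDigit} {x : ℕ → ℝ} {M : ℝ}

/-- After `32` the value is large when the next tail is small. The smallest such tails start with
`1`, tameness then forces `3`, and what follows is at least `1 / (2M)`. The bound is the value of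
`3213` followed by a tail equal to `1 / (2M)`; its fixed point in `M` is `periodicBound`. -/
lemma add_one_le_of_three_two (h : IsExpansion d x) (hd : IsTame d) (hM : 0 < M)
    (hb : ∀ n, 1 / (2 * M) ≤ x n) {n : ℕ} (h0 : d n = three)
    (h1 : d (n + 1) = two) : x (n + 1) + 1 ≤ (7 + 18 * M) / (4 + 10 * M) := by
  set w : ℝ := (1 + 2 * M) / (2 + 6 * M) with hw
  have hwpos : 0 < w := by positivity
  have hw2 : w < 1 / 2 := by
    rw [hw, div_lt_div_iff₀ (by positivity) (by norm_num)]; linarith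
  have key : w ≤ x (n + 2) := by
    by_cases h2 : d (n + 2) = one
    · have h3 : d (n + 3) = three := by
        cases h3 : d (n + 3) with
        | one => exact absurd ⟨h2, h3⟩ (hd.noRepeat (n + 2)).1
        | two => exact absurd h3 (hd.left n h0 h1 h2)
        | three => rfl
      have e3 : x (n + 3) = x (n + 4) + 1 := by rw [h.eq (n + 3), h3]; rfl
      have e4 := hb (n + 4)
      have : w = one.branch (1 / (2 * M) + 1) := by
        simp only [hw, branch]; field_simp; ring
      rw [this, h.eq (n + 2), h2]
      refine branch_one_le (by positivity) ?_
      rw [show n + 2 + 1 = n + 3 from rfl, e3]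
      linarith
    · linarith [h.half_lt h2]
  have e : (7 + 18 * M) / (4 + 10 * M) = two.branch w + 1 := by
    simp only [hw, branch]; field_simp; ring
  rw [e, h.eq (n + 1), h1]
  linarith [branch_two_le hwpos key]

lemma le_of_forall_le (h : IsExpansion d x) (hd : IsTame d) (hM : 0 < M)
    (hb : ∀ n, 1 / (2 * M) ≤ x n) (n : ℕ) : x n ≤ (7 + 18 * M) / (4 + 10 * M) := by
  have h32 : 3 / 2 ≤ (7 + 18 * M) / (4 + 10 * M) := by
    rw [div_le_div_iff₀ (by norm_num) (by positivity)]; linarith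
  by_cases h1 : d n = three
  · have e1 : x n = x (n + 1) + 1 := by rw [h.eq n, h1]; rfl
    rw [e1]
    cases h2 : d (n + 1) with
    | one => linarith [h.lt_half h2]
    | two => exact h.add_one_le_of_three_two hd hM hb h1 h2
    | three => exact absurd ⟨h1, h2⟩ (hd.noRepeat n).2
  · linarith [h.lt_one h1]

/-- The largest tail of a tame sequence is at most `(32131231)^∞`. -/
lemma le_periodicBound (h : IsExpansion d x) (hd : IsTame d) (n : ℕ) : x n ≤ periodicBound := by
  -- Including the inverted tails lets one supremum `M` control the tails from both sides: `1 / (2M)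
  -- ≤ x n ≤ M`.
  let A : Set ℝ := {y | ∃ n, y = x n ∨ y = 1 / (2 * x n)}
  have hA : ∀ y ∈ A, 0 < y ∧ y ≤ 2 := by
    rintro y ⟨n, rfl | rfl⟩
    · exact ⟨h.pos _, (h.lt_two hd.noRepeat _).le⟩
    · exact ⟨h.vee.pos _, (h.vee.lt_two hd.noRepeat.vee _).le⟩
  have hbdd : BddAbove A := ⟨2, fun y hy => (hA y hy).2⟩
  have hmem : x n ∈ A := ⟨n, Or.inl rfl⟩
  set M := sSup A with hMdef
  have hM : 0 < M := (h.pos n).trans_le (le_csSup hbdd hmem)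
  have hb1 : ∀ n, x n ≤ M := fun n => le_csSup hbdd ⟨n, Or.inl rfl⟩
  have hb3 : ∀ n, 1 / (2 * M) ≤ x n := by
    intro n
    have := le_csSup hbdd (show 1 / (2 * x n) ∈ A from ⟨n, Or.inr rfl⟩)
    have hx := h.pos n
    rw [div_le_iff₀ (by positivity)] at this ⊢
    linarith
  have hstep : M ≤ (7 + 18 * M) / (4 + 10 * M) := by
    refine csSup_le ⟨x n, hmem⟩ ?_
    rintro z ⟨n, rfl | rfl⟩
    · exact h.le_of_forall_le hd hM hb3 n
    · refine h.vee.le_of_forall_le hd.vee hM (fun m => ?_) n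
      have := hb1 m
      have hx := h.pos m
      exact one_div_le_one_div_of_le (by positivity) (by linarith)
  rw [le_div_iff₀ (by positivity)] at hstep
  have hsq := periodicBound_sq
  have hlt := lt_periodicBound
  -- The inequality `hstep` reads `10 M² ≤ 14 M + 7`, and the positive root of this quadratic is
  -- `periodicBound`.
  exact (hb1 n).trans (by nlinarith)

lemma periodicBound_le (h : IsExpansion d x) (hd : IsTame d) (n : ℕ) :
    1 / (2 * periodicBound) ≤ x n := by
  have := h.vee.le_periodicBound hd.vee n
  have hx := h.pos n
  have := periodicBound_pos
  rw [div_le_iff₀ (by positivity)] at *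
  linarith

lemma add_one_le_periodicBound (h : IsExpansion d x) (hd : IsTame d) {n : ℕ} (h0 : d n = three)
    (h1 : d (n + 1) = two) : x (n + 1) + 1 ≤ periodicBound := by
  have := h.add_one_le_of_three_two hd periodicBound_pos
    (h.periodicBound_le hd) h0 h1
  have hp := periodicBound_pos
  have e : (7 + 18 * periodicBound) / (4 + 10 * periodicBound) = periodicBound := by
    rw [div_eq_iff (by positivity)]; linarith [periodicBound_sq]
  rwa [e] at this

end IsExpansion

/-! ### Doubly infinite sequences and their cuts -/

/-- A doubly infinite digit sequence with the coordinates of its two halves at each cut: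
`q n` belongs to `t (n + 1), t (n + 2), …` and `p n` to `t n, t (n - 1), …`. -/
structure IsGeodesic (t : ℤ → RomikDigit) (p q : ℤ → ℝ) : Prop where
  p_pos : ∀ n, 0 < p n
  q_pos : ∀ n, 0 < q n
  p_eq : ∀ n, p n = (t n).branch (p (n - 1))
  q_eq : ∀ n, q n = (t (n + 1)).branch (q (n + 1))

/-- No factors `11` and `33`; every `232` extends to `32323`, every `212` to `12121`. -/
structure IsAdmissible (t : ℤ → RomikDigit) : Prop where
  no_one_one : ∀ n, t n = one → t (n + 1) ≠ one
  no_three_three : ∀ n, t n = three → t (n + 1) ≠ three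
  extend_three : ∀ n, t n = three → t (n - 1) = two → t (n + 1) = two →
    t (n - 2) = three ∧ t (n + 2) = three
  extend_one : ∀ n, t n = one → t (n - 1) = two → t (n + 1) = two →
    t (n - 2) = one ∧ t (n + 2) = one

namespace IsAdmissible

variable {t : ℤ → RomikDigit}

lemma vee (h : IsAdmissible t) : IsAdmissible fun n => (t n).vee :=
  ⟨fun n => by simpa using h.no_three_three n, fun n => by simpa using h.no_one_one n,
    fun n => by simpa using h.extend_one n, fun n => by simpa using h.extend_three n⟩

lemma shift (h : IsAdmissible t) (k : ℤ) : IsAdmissible fun n => t (n + k) := by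
  refine ⟨fun n => ?_, fun n => ?_, fun n => ?_, fun n => ?_⟩
  · simpa only [add_right_comm n 1 k] using h.no_one_one (n + k)
  · simpa only [add_right_comm n 1 k] using h.no_three_three (n + k)
  · simpa only [add_right_comm n 1 k, add_right_comm n 2 k, sub_add_eq_add_sub] using
      h.extend_three (n + k)
  · simpa only [add_right_comm n 1 k, add_right_comm n 2 k, sub_add_eq_add_sub] using
      h.extend_one (n + k)

lemma neg (h : IsAdmissible t) : IsAdmissible fun n => t (-n) := by
  refine ⟨fun n h1 h2 => ?_, fun n h1 h2 => ?_, fun n h1 h2 h3 => ?_, fun n h1 h2 h3 => ?_⟩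
  · exact h.no_one_one (-(n + 1)) h2 (by rw [← h1]; congr 1; ring)
  · exact h.no_three_three (-(n + 1)) h2 (by rw [← h1]; congr 1; ring)
  · have := h.extend_three (-n) h1 (by rw [← h3]; congr 1; ring) (by rw [← h2]; congr 1; ring)
    rw [show -n - 2 = -(n + 2) by ring, show -n + 2 = -(n - 2) by ring] at this
    exact this.symm
  · have := h.extend_one (-n) h1 (by rw [← h3]; congr 1; ring) (by rw [← h2]; congr 1; ring)
    rw [show -n - 2 = -(n + 2) by ring, show -n + 2 = -(n - 2) by ring] at this
    exact this.symm

/-- The factor `212` must be preceded by `1`, which rules out `3212`; dually `232` must be preceded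
by `3`, which rules out `1232`. -/
lemma isTame (h : IsAdmissible t) (k : ℤ) : IsTame fun n => t (k + n) := by
  refine ⟨fun n => ⟨fun hn => ?_, fun hn => ?_⟩, fun n h0 h1 h2 h3 => ?_,
    fun n h0 h1 h2 h3 => ?_⟩
  · exact h.no_one_one _ hn.1 (by rw [← hn.2]; congr 1; push_cast; ring)
  · exact h.no_three_three _ hn.1 (by rw [← hn.2]; congr 1; push_cast; ring)
  · have := (h.extend_one _ h2 (by rw [← h1]; congr 1; push_cast; ring)
      (by rw [← h3]; congr 1; push_cast; ring)).1
    rw [show k + ((n + 2 : ℕ) : ℤ) - 2 = k + n by push_cast; ring, h0] at this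
    cases this
  · have := (h.extend_three _ h2 (by rw [← h1]; congr 1; push_cast; ring)
      (by rw [← h3]; congr 1; push_cast; ring)).1
    rw [show k + ((n + 2 : ℕ) : ℤ) - 2 = k + n by push_cast; ring, h0] at this
    cases this

end IsAdmissible

namespace IsGeodesic

variable {t : ℤ → RomikDigit} {p q : ℤ → ℝ}

lemma vee (h : IsGeodesic t p q) :
    IsGeodesic (fun n => (t n).vee) (fun n => 1 / (2 * p n)) (fun n => 1 / (2 * q n)) :=
  ⟨fun n => by have := h.p_pos n; positivity, fun n => by have := h.q_pos n; positivity,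
    fun n => by rw [branch_vee _ (h.p_pos _), ← h.p_eq n],
    fun n => by rw [branch_vee _ (h.q_pos _), ← h.q_eq n]⟩

lemma shift (h : IsGeodesic t p q) (k : ℤ) :
    IsGeodesic (fun n => t (n + k)) (fun n => p (n + k)) (fun n => q (n + k)) :=
  ⟨fun n => h.p_pos _, fun n => h.q_pos _,
    fun n => by rw [h.p_eq (n + k), sub_add_eq_add_sub],
    fun n => by rw [h.q_eq (n + k), add_right_comm n 1 k]⟩

lemma neg (h : IsGeodesic t p q) :
    IsGeodesic (fun n => t (-n)) (fun n => q (-n - 1)) (fun n => p (-n - 1)) :=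
  ⟨fun n => h.q_pos _, fun n => h.p_pos _,
    fun n => by
      rw [h.q_eq (-n - 1), show -n - 1 + 1 = -n by ring, show -(n - 1) - 1 = -n by ring],
    fun n => by
      rw [h.p_eq (-n - 1), show -(n + 1) = -n - 1 by ring]⟩

lemma right (h : IsGeodesic t p q) (k : ℤ) :
    IsExpansion (fun n => t (k + 1 + n)) (fun n => q (k + n)) :=
  ⟨fun n => h.q_pos _, fun n => by
    rw [h.q_eq (k + n)]; push_cast
    rw [show k + (n : ℤ) + 1 = k + 1 + n by ring, show k + 1 + (n : ℤ) = k + (n + 1) by ring]⟩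

lemma left (h : IsGeodesic t p q) (k : ℤ) :
    IsExpansion (fun n => t (k - n)) (fun n => p (k - n)) :=
  ⟨fun n => h.p_pos _, fun n => by
    rw [h.p_eq (k - n)]; push_cast
    rw [show k - (n : ℤ) - 1 = k - (n + 1) by ring]⟩

end IsGeodesic

/-! ### The upper end of the gap and the sections away from `232` -/

/-- The coordinate of the upper end of the gap. -/
noncomputable def upperBound : ℝ := (2124 + 48 * √119) / 1177

lemma upperBound_lt : upperBound < 2.2495 := by
  unfold upperBound; linarith [sqrt_119_lt]

lemma lt_upperBound : 2.249 < upperBound := by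
  unfold upperBound; linarith [lt_sqrt_119]

/-- `[231P]` in terms of `[P]`. -/
noncomputable def branch231 (x : ℝ) : ℝ := (5 * x + 2) / (8 * x + 3)

/-- `[23231P]` in terms of `[P]`. -/
noncomputable def branch23231 (x : ℝ) : ℝ := (21 * x + 8) / (34 * x + 13)

lemma branch231_eq {x : ℝ} (hx : 0 < x) :
    two.branch (three.branch (one.branch x)) = branch231 x := by
  simp only [branch, branch231]; field_simp; ring

lemma branch23231_eq {x : ℝ} (hx : 0 < x) :
    two.branch (three.branch (two.branch (three.branch (one.branch x)))) = branch23231 x := by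
  simp only [branch, branch23231]; field_simp; ring

lemma branch231_sub {x y : ℝ} (hx : 0 < x) (hy : 0 < y) :
    branch231 x - branch231 y = (y - x) / ((8 * x + 3) * (8 * y + 3)) := by
  unfold branch231; field_simp; ring

lemma branch23231_sub {x y : ℝ} (hx : 0 < x) (hy : 0 < y) :
    branch23231 x - branch23231 y = (x - y) / ((34 * x + 13) * (34 * y + 13)) := by
  unfold branch23231; field_simp; ring

lemma branch231_anti {x y : ℝ} (hx : 0 < x) (h : x ≤ y) : branch231 y ≤ branch231 x := by
  have := branch231_sub hx (hx.trans_le h)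
  have h2 : 0 ≤ (y - x) / ((8 * x + 3) * (8 * y + 3)) :=
    div_nonneg (by linarith) (by have := hx.trans_le h; positivity)
  linarith

lemma branch231_strictAnti {x y : ℝ} (hx : 0 < x) (h : x < y) : branch231 y < branch231 x := by
  have := branch231_sub hx (hx.trans h)
  have h2 : 0 < (y - x) / ((8 * x + 3) * (8 * y + 3)) :=
    div_pos (by linarith) (by have := hx.trans h; positivity)
  linarith

/-- Both differences are `± (y - x)` over a product of two linear factors. The factors for
`branch231` are smaller, so its decrease outweighs the increase of `branch23231`. -/
lemma sum_branches_anti {x y : ℝ} (hx : 0 < x) (h : x < y) :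
    branch231 y + branch23231 y < branch231 x + branch23231 x := by
  have hy := hx.trans h
  have e1 := branch231_sub hx hy
  have e2 := branch23231_sub hx hy
  have hlt : (y - x) / ((34 * x + 13) * (34 * y + 13)) < (y - x) / ((8 * x + 3) * (8 * y + 3)) := by
    apply div_lt_div_of_pos_left (by linarith) (by positivity)
    gcongr <;> norm_num
  have : (x - y) / ((34 * x + 13) * (34 * y + 13)) = -((y - x) / ((34 * x + 13) * (34 * y + 13))) := by
    rw [← neg_sub, neg_div]
  linarith

lemma upperBound_eq : 1 + branch231 periodicBound + branch23231 periodicBound = upperBound := by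
  have h : √119 ^ 2 = 119 := Real.sq_sqrt (by norm_num)
  have hr : 0 < √119 := by positivity
  unfold branch231 branch23231 upperBound periodicBound
  rw [add_assoc, div_add_div _ _ (by positivity) (by positivity), ← eq_sub_iff_add_eq',
    div_eq_iff (by positivity)]
  ring_nf
  rw [show √119 ^ 3 = 119 * √119 by rw [pow_succ, h], h]
  ring

/-- The two sums are the sections at the two centres of `132323231`. Put the larger tail into
`branch23231`: lowering the argument of `branch231` to the smaller tail only increases the sum, and
with equal arguments the sum is decreasing and equals `upperBound` at `periodicBound`. -/
lemma upperBound_le_or {x y : ℝ} (hx : 0 < x) (hy : 0 < y) (hx' : x ≤ periodicBound)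
    (hy' : y ≤ periodicBound) :
    upperBound ≤ 1 + branch231 x + branch23231 y ∨ upperBound ≤ 1 + branch231 y + branch23231 x := by
  have key : ∀ x, 0 < x → x ≤ periodicBound → upperBound ≤ 1 + branch231 x + branch23231 x := by
    intro x hx hx'
    rcases hx'.eq_or_lt with rfl | hlt
    · exact upperBound_eq.ge
    · have := sum_branches_anti hx hlt
      have := upperBound_eq
      linarith
  rcases le_total x y with h | h
  · left; linarith [key y hy hy', branch231_anti hx h]
  · right; linarith [key x hx hx', branch231_anti hy h]

lemma upperBound_lt_or {x y : ℝ} (hx : 0 < x) (hy : 0 < y) (hx' : x ≤ periodicBound)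
    (hy' : y ≤ periodicBound) (hne : x ≠ periodicBound) :
    upperBound < 1 + branch231 x + branch23231 y ∨ upperBound < 1 + branch231 y + branch23231 x := by
  have key : ∀ x, 0 < x → x < periodicBound → upperBound < 1 + branch231 x + branch23231 x := by
    intro x hx hlt
    have := sum_branches_anti hx hlt
    have := upperBound_eq
    linarith
  have hlt : x < periodicBound := lt_of_le_of_ne hx' hne
  rcases le_total x y with h | h
  · left
    rcases hy'.eq_or_lt with rfl | hy''
    · have := upperBound_eq
      linarith [branch231_strictAnti hx hlt]
    · linarith [key y hy hy'', branch231_anti hx h]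
  · right; linarith [key x hx hlt, branch231_anti hy h]

/-- The place `n` carries the middle digit of a factor `232`. -/
def IsCenter (t : ℤ → RomikDigit) (n : ℤ) : Prop :=
  t n = three ∧ t (n - 1) = two ∧ t (n + 1) = two

lemma IsCenter.neg {t : ℤ → RomikDigit} {n : ℤ} (h : IsCenter t n) :
    IsCenter (fun m => t (-m)) (-n) :=
  ⟨by simpa using h.1, by rw [← h.2.2]; dsimp only; congr 1; ring,
    by rw [← h.2.1]; dsimp only; congr 1; ring⟩

namespace IsGeodesic

variable {t : ℤ → RomikDigit} {p q : ℤ → ℝ}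

lemma p_eq' (h : IsGeodesic t p q) {n m : ℤ} (hm : m = n - 1) : p n = (t n).branch (p m) := by
  rw [hm]; exact h.p_eq n

lemma q_eq' (h : IsGeodesic t p q) {n m : ℤ} (hm : m = n + 1) : q n = (t m).branch (q m) := by
  rw [hm]; exact h.q_eq n

lemma q_lt_half (h : IsGeodesic t p q) {n : ℤ} (hn : t (n + 1) = one) : q n < 1 / 2 := by
  rw [h.q_eq, hn]; exact branch_one_lt (h.q_pos _)

lemma q_lt_one (h : IsGeodesic t p q) {n : ℤ} (hn : t (n + 1) ≠ three) : q n < 1 := by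
  simpa using (h.right n).lt_one (n := 0) (by simpa using hn)

lemma p_lt_one (h : IsGeodesic t p q) {n : ℤ} (hn : t n ≠ three) : p n < 1 := by
  simpa using (h.left n).lt_one (n := 0) (by simpa using hn)

lemma q_le (h : IsGeodesic t p q) (ht : IsAdmissible t) (n : ℤ) : q n ≤ periodicBound := by
  simpa using (h.right n).le_periodicBound (ht.isTame _) 0

lemma p_le (h : IsGeodesic t p q) (ht : IsAdmissible t) (n : ℤ) : p n ≤ periodicBound := by
  simpa using h.neg.q_le ht.neg (-n - 1)

lemma q_add_one_le (h : IsGeodesic t p q) (ht : IsAdmissible t) {n : ℤ} (h0 : t n = three)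
    (h1 : t (n + 1) = two) : q n + 1 ≤ periodicBound := by
  have := (h.right (n - 1)).add_one_le_periodicBound (ht.isTame _) (n := 0) (by simpa using h0)
    (by simpa using h1)
  simpa using this

/-- Around `132` both sides are governed by the largest tail `κ = periodicBound`: the right side
together with the `3` is at most `κ`, the left side at most `one.branch κ`, and these add up to
`√119 / 5`. -/
lemma p_add_q_le_aux (h : IsGeodesic t p q) (ht : IsAdmissible t) {n : ℤ} (h0 : t n = three)
    (h1 : t (n - 1) = one) (h2 : t (n + 1) = two) : p (n - 1) + 1 + q n ≤ √119 / 5 := by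
  have hq := h.q_add_one_le ht h0 h2
  have hp := h.p_le ht (n - 2)
  have e : p (n - 1) ≤ one.branch periodicBound := by
    rw [h.p_eq' (n := n - 1) (m := n - 2) (by ring), h1]
    exact branch_one_le (h.p_pos _) hp
  have e2 : periodicBound + one.branch periodicBound = √119 / 5 := by
    have h : √119 ^ 2 = 119 := Real.sq_sqrt (by norm_num)
    simp only [branch, periodicBound]
    field_simp
    ring_nf
    rw [h]; ring
  linarith

/-- The section at a digit `3` that is not the middle of `232`. -/
lemma p_add_q_le_of_not_isCenter (h : IsGeodesic t p q) (ht : IsAdmissible t) {n : ℤ}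
    (h0 : t n = three) (hc : ¬IsCenter t n) : p (n - 1) + 1 + q n ≤ √119 / 5 := by
  have h3 : t (n + 1) ≠ three := ht.no_three_three n h0
  have h3' : t (n - 1) ≠ three := fun h' => ht.no_three_three (n - 1) h' (by simpa using h0)
  cases h1 : t (n - 1) with
  | three => exact absurd h1 h3'
  | one =>
    cases h2 : t (n + 1) with
    | three => exact absurd h2 h3
    | two => exact h.p_add_q_le_aux ht h0 h1 h2
    | one =>
      have := h.q_lt_half h2
      have := h.neg.q_lt_half (n := -n) (by rw [← h1]; congr 1; ring)
      rw [neg_neg] at this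
      linarith [lt_sqrt_119]
  | two =>
    cases h2 : t (n + 1) with
    | three => exact absurd h2 h3
    | two => exact absurd ⟨h0, h1, h2⟩ hc
    | one =>
      have := h.neg.p_add_q_le_aux ht.neg (n := -n) (by simpa using h0)
        (by rw [← h2]; congr 1; ring) (by rw [← h1]; congr 1; ring)
      rw [show - -n - 1 = n - 1 by ring, show -(-n - 1) - 1 = n by ring] at this
      linarith

/-- The two cuts next to a digit `3` have the same sum `p (n - 1) + 1 + q n`, so the estimate at a
digit `3` covers both. A cut with no `3` beside it has both tails below `1`. -/
lemma p_add_q_le (h : IsGeodesic t p q) (ht : IsAdmissible t) {n : ℤ}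
    (h0 : ¬IsCenter t n) (h1 : ¬IsCenter t (n + 1)) : p n + q n ≤ √119 / 5 := by
  by_cases h3 : t n = three
  · have := h.p_add_q_le_of_not_isCenter ht h3 h0
    have e : p n = p (n - 1) + 1 := by rw [h.p_eq n, h3]; rfl
    linarith
  · by_cases h3' : t (n + 1) = three
    · have := h.p_add_q_le_of_not_isCenter ht h3' h1
      rw [add_sub_cancel_right] at this
      have e : q n = q (n + 1) + 1 := by rw [h.q_eq n, h3']; rfl
      linarith
    · linarith [h.p_lt_one h3, h.q_lt_one h3', lt_sqrt_119]

end IsGeodesic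

/-! ### Sequences whose sections stay below the upper end -/

/-- A geodesic all of whose sections are bounded by `μ`. -/
structure IsBoundedGeodesic (t : ℤ → RomikDigit) (p q : ℤ → ℝ) (μ : ℝ) : Prop
    extends IsGeodesic t p q where
  add_le : ∀ n, p n + q n ≤ μ
  vee_add_le : ∀ n, 1 / (2 * p n) + 1 / (2 * q n) ≤ μ

namespace IsBoundedGeodesic

variable {t : ℤ → RomikDigit} {p q : ℤ → ℝ} {μ : ℝ}

lemma vee (h : IsBoundedGeodesic t p q μ) :
    IsBoundedGeodesic (fun n => (t n).vee) (fun n => 1 / (2 * p n)) (fun n => 1 / (2 * q n)) μ where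
  toIsGeodesic := h.toIsGeodesic.vee
  add_le := h.vee_add_le
  vee_add_le n := by
    have e : ∀ x : ℝ, 1 / (2 * (1 / (2 * x))) = x := fun x => by
      rw [mul_one_div, one_div_div, mul_div_assoc, mul_div_cancel₀ _ two_ne_zero]
    rw [e, e]; exact h.add_le n

lemma neg (h : IsBoundedGeodesic t p q μ) :
    IsBoundedGeodesic (fun n => t (-n)) (fun n => q (-n - 1)) (fun n => p (-n - 1)) μ where
  toIsGeodesic := h.toIsGeodesic.neg
  add_le n := by rw [add_comm]; exact h.add_le _
  vee_add_le n := by rw [add_comm]; exact h.vee_add_le _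

/-- The two `3`s contribute `2`, and the bound on the dual sections keeps each of the remaining
tails above `0.2`, so the section would exceed `2.4`. -/
lemma no_three_three (h : IsBoundedGeodesic t p q μ) (hμ : μ < upperBound) (n : ℤ)
    (h0 : t n = three) : t (n + 1) ≠ three := by
  intro h1
  have e1 : p n = p (n - 1) + 1 := by rw [h.p_eq n, h0]; rfl
  have e2 : q n = q (n + 1) + 1 := by rw [h.q_eq n, h1]; rfl
  have hu := upperBound_lt
  have key : ∀ x y : ℝ, 0 < x → 0 < y → 1 / (2 * x) + 1 / (2 * y) ≤ μ → 0.2 < x := by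
    intro x y hx hy hxy
    have : 0 < 1 / (2 * y) := by positivity
    have : 1 / (2 * x) < 2.2495 := by linarith
    rw [div_lt_iff₀ (by positivity)] at this
    linarith
  have a := key _ _ (h.p_pos _) (h.q_pos _) (h.vee_add_le (n - 1))
  have b := key _ _ (h.q_pos _) (h.p_pos _) (by rw [add_comm]; exact h.vee_add_le (n + 1))
  linarith [h.add_le n]

lemma noRepeat (h : IsBoundedGeodesic t p q μ) (hμ : μ < upperBound) (k : ℤ) :
    NoRepeat fun n => t (k + n) := by
  refine fun n => ⟨fun hn => ?_, fun hn => ?_⟩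
  · exact h.vee.no_three_three hμ _ (vee_eq_three.2 hn.1)
      (vee_eq_three.2 (by rw [← hn.2]; congr 1; push_cast; ring))
  · exact h.no_three_three hμ _ hn.1 (by rw [← hn.2]; congr 1; push_cast; ring)

lemma center_add_le (h : IsBoundedGeodesic t p q μ) {n : ℤ} (h0 : t n = three) :
    p (n - 1) + 1 + q n ≤ μ := by
  have e : p n = p (n - 1) + 1 := by rw [h.p_eq n, h0]; rfl
  linarith [h.add_le n]

/-- If the digit after `232` is not `3`, the right tail is at least `two.branch 1 = 2/3`. The left
one is at least `two.branch 2 = 3/5` in any case, and `1 + 2/3 + 3/5` is above `upperBound`. -/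
lemma extend_three_right (h : IsBoundedGeodesic t p q μ) (hμ : μ < upperBound) {n : ℤ}
    (hc : IsCenter t n) : t (n + 2) = three := by
  by_contra h2
  have hq1 : q (n + 1) ≤ 1 := (h.q_lt_one (by rwa [add_assoc])).le
  have hp2 : p (n - 2) ≤ 2 := by
    have := ((h.neg.right (-(n - 2) - 1)).lt_two (h.neg.noRepeat hμ _) 0).le
    simpa using this
  have hq : 2 / 3 ≤ q n := by
    rw [h.q_eq n, hc.2.2]
    refine le_trans ?_ (branch_two_le (h.q_pos _) hq1)
    simp only [branch]; norm_num
  have hp : 3 / 5 ≤ p (n - 1) := by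
    rw [h.p_eq' (n := n - 1) (m := n - 2) (by ring), hc.2.1]
    refine le_trans ?_ (branch_two_le (h.p_pos _) hp2)
    simp only [branch]; norm_num
  linarith [h.center_add_le hc.1, upperBound_lt]

lemma extend_three (h : IsBoundedGeodesic t p q μ) (hμ : μ < upperBound) {n : ℤ}
    (hc : IsCenter t n) : t (n - 2) = three ∧ t (n + 2) = three := by
  refine ⟨?_, h.extend_three_right hμ hc⟩
  have := h.neg.extend_three_right hμ hc.neg
  rw [← this]; congr 1; ring

lemma isAdmissible (h : IsBoundedGeodesic t p q μ) (hμ : μ < upperBound) : IsAdmissible t where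
  no_three_three n := h.no_three_three hμ n
  no_one_one n h0 h1 := h.vee.no_three_three hμ n (vee_eq_three.2 h0) (vee_eq_three.2 h1)
  extend_three n h0 h1 h2 := h.extend_three hμ ⟨h0, h1, h2⟩
  extend_one n h0 h1 h2 := by
    simpa using h.vee.extend_three hμ (n := n) ⟨by simpa using h0, by simpa using h1,
      by simpa using h2⟩

/-- A run of centres cannot end on the right. If it did, the digits to the right of the centre would
be `231`, and each possibility on the left makes the section at this centre, or at the one before
it, at least `upperBound`. -/
lemma center_add_two (h : IsBoundedGeodesic t p q μ) (hμ : μ < upperBound) {n : ℤ}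
    (hc : IsCenter t n) : IsCenter t (n + 2) := by
  have ht := h.isAdmissible hμ
  have h2 := (h.extend_three hμ hc).2
  have hm2 := (h.extend_three hμ hc).1
  have hu := upperBound_lt
  refine ⟨h2, by rw [← hc.2.2]; congr 1; ring, ?_⟩
  rw [show n + 2 + 1 = n + 3 by ring]
  have h3 : t (n + 3) ≠ three := by
    have := ht.no_three_three _ h2
    rwa [show n + 2 + 1 = n + 3 by ring] at this
  have hm3 : t (n - 3) ≠ three := fun h' => ht.no_three_three _ h' (by rw [← hm2]; congr 1; ring)
  cases h31 : t (n + 3) with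
  | three => exact absurd h31 h3
  | two => rfl
  | one =>
    exfalso
    have hq : q n = branch231 (q (n + 3)) := by
      rw [h.q_eq n, hc.2.2, h.q_eq' (n := n + 1) (m := n + 2) (by ring), h2,
        h.q_eq' (n := n + 2) (m := n + 3) (by ring), h31, branch231_eq (h.q_pos _)]
    have hp : p (n - 1) = two.branch (three.branch (p (n - 3))) := by
      rw [h.p_eq' (n := n - 1) (m := n - 2) (by ring), hc.2.1,
        h.p_eq' (n := n - 2) (m := n - 3) (by ring), hm2]
    have hadd := h.center_add_le hc.1
    have hX := h.q_pos (n + 3)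
    have hXle := h.q_le ht (n + 3)
    cases hm31 : t (n - 3) with
    | three => exact hm3 hm31
    | one =>
      rw [h.p_eq' (n := n - 3) (m := n - 4) (by ring), hm31, branch231_eq (h.p_pos _)] at hp
      -- A single centre, with `231` on both sides. The number `5/8` is the infimum of `branch231`,
      -- and `1 + 5/8 + 5/8 = 2.25` is above `upperBound`.
      have key : ∀ x : ℝ, 0 < x → 5 / 8 < branch231 x := by
        intro x hx
        unfold branch231
        rw [div_lt_div_iff₀ (by norm_num) (by positivity)]
        linarith
      have := key _ hX
      have := key _ (h.p_pos (n - 4))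
      linarith
    | two =>
      have hc2 : IsCenter t (n - 2) :=
        ⟨hm2, by rw [← hm31]; congr 1; ring, by rw [← hc.2.1]; congr 1; ring⟩
      have hm4 : t (n - 4) = three := by
        have := (h.extend_three hμ hc2).1
        rwa [show n - 2 - 2 = n - 4 by ring] at this
      rw [h.p_eq' (n := n - 3) (m := n - 4) (by ring), hm31,
        h.p_eq' (n := n - 4) (m := n - 5) (by ring), hm4] at hp
      by_cases hm5 : t (n - 5) = one
      -- Exactly two centres, `n - 2` and `n`, with a `1` on either side: their sections are the two
      -- sums of `upperBound_le_or`.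
      · rw [h.p_eq' (n := n - 5) (m := n - 6) (by ring), hm5, branch23231_eq (h.p_pos _)] at hp
        have hadd2 := h.center_add_le hc2.1
        have hq2 : q (n - 2) = branch23231 (q (n + 3)) := by
          rw [h.q_eq' (n := n - 2) (m := n - 1) (by ring), hc.2.1,
            h.q_eq' (n := n - 1) (m := n) (by ring), hc.1,
            h.q_eq n, hc.2.2, h.q_eq' (n := n + 1) (m := n + 2) (by ring), h2,
            h.q_eq' (n := n + 2) (m := n + 3) (by ring), h31, branch23231_eq (h.q_pos _)]
        have hp2 : p (n - 2 - 1) = branch231 (p (n - 6)) := by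
          rw [h.p_eq' (n := n - 2 - 1) (m := n - 4) (by ring), show n - 2 - 1 = n - 3 by ring, hm31,
            h.p_eq' (n := n - 4) (m := n - 5) (by ring), hm4,
            h.p_eq' (n := n - 5) (m := n - 6) (by ring), hm5, branch231_eq (h.p_pos _)]
        rcases upperBound_le_or hX (h.p_pos (n - 6)) hXle (h.p_le ht _) with h' | h' <;> linarith
      -- Here `p (n - 5) > 1/2 > one.branch periodicBound`. Prefixing `2323` preserves the order,
      -- since the decreasing branch of `2` occurs twice, so the left side is at least `branch23231
      -- periodicBound`.
      · have h5 : 1 / 2 < p (n - 5) := by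
          simpa using (h.left (n - 5)).half_lt (n := 0) (by simpa using hm5)
        have hk := periodicBound_pos
        have hb := branch_pos one hk
        have hle : one.branch periodicBound ≤ p (n - 5) := by
          linarith [branch_one_lt hk]
        have : branch23231 periodicBound ≤ p (n - 1) := by
          rw [← branch23231_eq hk, hp]
          refine branch_two_le (branch_pos _ (branch_pos _ (branch_pos _ (h.p_pos _)))) ?_
          have : two.branch (three.branch (p (n - 5))) ≤
              two.branch (three.branch (one.branch periodicBound)) :=
            branch_two_le (branch_pos _ hb) (by simp only [branch] at hle ⊢; linarith)
          simp only [branch] at this ⊢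
          linarith
        linarith [branch231_anti hX hXle, upperBound_eq]

lemma center_sub_two (h : IsBoundedGeodesic t p q μ) (hμ : μ < upperBound) {n : ℤ}
    (hc : IsCenter t n) : IsCenter t (n - 2) := by
  have := (h.neg.center_add_two hμ hc.neg).neg
  simp only [neg_neg] at this
  rwa [show -(-n + 2) = n - 2 by ring] at this

lemma center_add_even (h : IsBoundedGeodesic t p q μ) (hμ : μ < upperBound) {n : ℤ}
    (hc : IsCenter t n) (k : ℤ) : IsCenter t (n + 2 * k) := by
  induction k using Int.induction_on with
  | zero => simpa using hc
  | succ k ih =>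
    have := h.center_add_two hμ ih
    rwa [show n + 2 * (k : ℤ) + 2 = n + 2 * (k + 1) by ring] at this
  | pred k ih =>
    have := h.center_sub_two hμ ih
    rwa [show n + 2 * (-(k : ℤ)) - 2 = n + 2 * (-k - 1) by ring] at this

end IsBoundedGeodesic

/-! ### The sequence `(32)^∞` and the dichotomy -/

/-- The coordinate of `(23)^∞`. -/
noncomputable def coord23 : ℝ := (√5 - 1) / 2

lemma coord23_pos : 0 < coord23 := by
  have : (1 : ℝ) < √5 := Real.lt_sqrt_of_sq_lt (by norm_num)
  unfold coord23; linarith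

lemma coord23_eq : two.branch (coord23 + 1) = coord23 := by
  have h : √5 ^ 2 = 5 := Real.sq_sqrt (by norm_num)
  have hp := coord23_pos
  simp only [branch]
  rw [div_eq_iff (by positivity)]
  unfold coord23
  nlinarith

lemma isExpansion_coord23 : IsExpansion (fun k => if Even k then two else three)
    (fun k => if Even k then coord23 else coord23 + 1) := by
  have hp := coord23_pos
  refine ⟨fun n => ?_, fun n => ?_⟩
  · split_ifs <;> linarith
  · by_cases h : Even n
    · simp [h, Nat.even_add_one, coord23_eq]
    · simp [h, Nat.even_add_one, branch]

lemma noRepeat_coord23 : NoRepeat (fun k => if Even k then two else three) := by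
  intro n
  by_cases h : Even n <;> simp [h, Nat.even_add_one]

lemma IsGeodesic.q_eq_coord23 {t : ℤ → RomikDigit} {p q : ℤ → ℝ} (h : IsGeodesic t p q) {n : ℤ}
    (hc : ∀ k : ℤ, IsCenter t (n + 2 * k)) : q n = coord23 := by
  have hd : (fun k : ℕ => t (n + 1 + k)) = fun k => if Even k then two else three := by
    funext k
    rcases Nat.even_or_odd' k with ⟨j, rfl | rfl⟩
    · have := (hc j).2.2
      simp only [even_two, Even.mul_right, if_true, Nat.cast_mul, Nat.cast_ofNat]
      rw [← this]; congr 1; ring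
    · have := (hc (j + 1)).1
      rw [if_neg (by simp)]
      rw [← this]; congr 1; push_cast; ring
  have h' := h.right n
  rw [hd] at h'
  simpa using h'.unique_zero isExpansion_coord23 noRepeat_coord23

lemma IsGeodesic.center_add_eq {t : ℤ → RomikDigit} {p q : ℤ → ℝ} (h : IsGeodesic t p q) {n : ℤ}
    (hc : ∀ k : ℤ, IsCenter t (n + 2 * k)) : p (n - 1) + 1 + q n = √5 := by
  have h1 := h.q_eq_coord23 hc
  have h2 := h.neg.q_eq_coord23 (n := -n) fun k => by
    have := (hc (-k)).neg
    rwa [show -(n + 2 * -k) = -n + 2 * k by ring] at this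
  rw [neg_neg] at h2
  rw [h1, h2]; unfold coord23; ring

/-- One centre propagates to all places of the same parity, which leaves only `(32)^∞`; the parity
decides on which side of the cut the `3` stands. Without centres the estimate for sections away from
`232` applies. -/
lemma IsBoundedGeodesic.gap {t : ℤ → RomikDigit} {p q : ℤ → ℝ} {μ : ℝ}
    (h : IsBoundedGeodesic t p q μ) (hμ : μ < upperBound) :
    p 0 + q 0 ≤ √119 / 5 ∨ p 0 + q 0 = √5 := by
  by_cases hc : ∃ n, IsCenter t n
  · right
    obtain ⟨n, hc⟩ := hc
    obtain ⟨k, hk | hk⟩ := Int.even_or_odd' n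
    · have := h.center_add_eq (n := 0) fun m => by
        have := h.center_add_even hμ hc (m - k)
        rwa [hk, show 2 * k + 2 * (m - k) = 0 + 2 * m by ring] at this
      have h0 : t 0 = three := by
        have := (h.center_add_even hμ hc (-k)).1
        rwa [hk, show 2 * k + 2 * -k = 0 by ring] at this
      have e : p 0 = p (0 - 1) + 1 := by rw [h.p_eq 0, h0]; rfl
      linarith
    · have := h.center_add_eq (n := 1) fun m => by
        have := h.center_add_even hμ hc (m - k)
        rwa [hk, show 2 * k + 1 + 2 * (m - k) = 1 + 2 * m by ring] at this
      have h0 : t (0 + 1) = three := by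
        have := (h.center_add_even hμ hc (-k)).1
        rwa [hk, show 2 * k + 1 + 2 * -k = 0 + 1 by ring] at this
      have e : q 0 = q 1 + 1 := by rw [h.q_eq 0, h0]; rfl
      rw [sub_self] at this
      linarith
  · left
    push Not at hc
    exact h.p_add_q_le (h.isAdmissible hμ) (hc _) (hc _)

/-! ### The Hecke group and its cusp orbit -/

lemma sqrt_two_mul_self : √2 * √2 = (2 : ℝ) := Real.mul_self_sqrt (by norm_num)

lemma heckeGroup_four : heckeGroup 4 = Subgroup.closure {heckeS, heckeT √2} := by
  unfold heckeGroup
  rw [show (2 : ℝ) * Real.cos (Real.pi / (4 : ℕ)) = √2 by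
    rw [Nat.cast_ofNat, Real.cos_pi_div_four]; ring]

lemma heckeS_mem : heckeS ∈ heckeGroup 4 := by
  rw [heckeGroup_four]; exact Subgroup.subset_closure (by simp)

lemma heckeT_mem : heckeT √2 ∈ heckeGroup 4 := by
  rw [heckeGroup_four]; exact Subgroup.subset_closure (by simp)

lemma firstColumn_apply (M : SL(2, ℝ)) (i : Fin 2) : firstColumn M i = M.1 i 0 := by
  simp [firstColumn, Matrix.mulVec, dotProduct, Fin.sum_univ_two]

lemma heckeS_val : heckeS.1 = !![0, -1; 1, 0] := rfl

lemma heckeT_val (l : ℝ) : (heckeT l).1 = !![1, l; 0, 1] := rfl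

lemma mul_val_apply (M N : SL(2, ℝ)) (i j : Fin 2) :
    (M * N).1 i j = M.1 i 0 * N.1 0 j + M.1 i 1 * N.1 1 j := by
  simp [Matrix.mul_apply, Fin.sum_univ_two]

lemma inv_val (M : SL(2, ℝ)) : (M⁻¹).1 = !![M.1 1 1, -M.1 0 1; -M.1 1 0, M.1 0 0] := by
  rw [Matrix.SpecialLinearGroup.SL2_inv_expl]; rfl

/-- Elements of the Hecke group in terms of integers. -/
lemma heckeGroup_four_entries {M : SL(2, ℝ)} (hM : M ∈ heckeGroup 4) :
    (∃ a b c d : ℤ, a * d - 2 * (b * c) = 1 ∧ M.1 0 0 = a ∧ M.1 0 1 = √2 * b ∧ M.1 1 0 = √2 * c ∧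
      M.1 1 1 = d) ∨
    (∃ a b c d : ℤ, 2 * (a * d) - b * c = 1 ∧ M.1 0 0 = √2 * a ∧ M.1 0 1 = b ∧ M.1 1 0 = c ∧
      M.1 1 1 = √2 * d) := by
  have h2 := sqrt_two_mul_self
  rw [heckeGroup_four] at hM
  induction hM using Subgroup.closure_induction with
  | mem M hM =>
    rcases hM with rfl | rfl
    · exact Or.inr ⟨0, -1, 1, 0, by norm_num, by simp [heckeS]⟩
    · exact Or.inl ⟨1, 1, 0, 1, by norm_num, by simp [heckeT]⟩
  | one => exact Or.inl ⟨1, 0, 0, 1, by norm_num, by simp⟩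
  | mul M N _ _ hM hN =>
    simp only [mul_val_apply]
    rcases hM with ⟨a, b, c, d, hM, h00, h01, h10, h11⟩ | ⟨a, b, c, d, hM, h00, h01, h10, h11⟩ <;>
    rcases hN with ⟨a', b', c', d', hN, h00', h01', h10', h11'⟩ |
      ⟨a', b', c', d', hN, h00', h01', h10', h11'⟩ <;>
    simp only [h00, h01, h10, h11, h00', h01', h10', h11']
    · refine Or.inl ⟨a * a' + 2 * (b * c'), a * b' + b * d', c * a' + d * c',
        2 * (c * b') + d * d', by linear_combination (a' * d' - 2 * (b' * c')) * hM + hN, ?_⟩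
      push_cast
      exact ⟨by linear_combination (b * c' : ℝ) * h2, by ring, by ring,
        by linear_combination (c * b' : ℝ) * h2⟩
    · refine Or.inr ⟨a * a' + b * c', a * b' + 2 * (b * d'), 2 * (c * a') + d * c',
        c * b' + d * d', by linear_combination (2 * (a' * d') - b' * c') * hM + hN, ?_⟩
      push_cast
      exact ⟨by ring, by linear_combination (b * d' : ℝ) * h2,
        by linear_combination (c * a' : ℝ) * h2, by ring⟩
    · refine Or.inr ⟨a * a' + b * c', 2 * (a * b') + b * d', c * a' + 2 * (d * c'),
        c * b' + d * d', by linear_combination (a' * d' - 2 * (b' * c')) * hM + hN, ?_⟩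
      push_cast
      exact ⟨by ring, by linear_combination (a * b' : ℝ) * h2,
        by linear_combination (d * c' : ℝ) * h2, by ring⟩
    · refine Or.inl ⟨2 * (a * a') + b * c', a * b' + b * d', c * a' + d * c',
        c * b' + 2 * (d * d'), by linear_combination (2 * (a' * d') - b' * c') * hM + hN, ?_⟩
      push_cast
      exact ⟨by linear_combination (a * a' : ℝ) * h2, by ring, by ring,
        by linear_combination (d * d' : ℝ) * h2⟩
  | inv M _ hM =>
    simp only [inv_val]
    rcases hM with ⟨a, b, c, d, hM, h00, h01, h10, h11⟩ | ⟨a, b, c, d, hM, h00, h01, h10, h11⟩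
    · exact Or.inl ⟨d, -b, -c, a, by linarith, by simp [*]⟩
    · exact Or.inr ⟨d, -b, -c, a, by linarith, by simp [*]⟩

lemma det_eq_one (M : SL(2, ℝ)) : M.1 0 0 * M.1 1 1 - M.1 0 1 * M.1 1 0 = 1 := by
  rw [← Matrix.det_fin_two]; exact M.2

/-- Conjugation by `(0, 1; 1, 0)`. -/
def swapConj (M : SL(2, ℝ)) : SL(2, ℝ) :=
  ⟨!![M.1 1 1, M.1 1 0; M.1 0 1, M.1 0 0], by
    rw [Matrix.det_fin_two_of]; linarith [det_eq_one M]⟩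

lemma swapConj_val (M : SL(2, ℝ)) : (swapConj M).1 = !![M.1 1 1, M.1 1 0; M.1 0 1, M.1 0 0] := rfl

lemma swapConj_mul (M N : SL(2, ℝ)) : swapConj (M * N) = swapConj M * swapConj N := by
  ext i j
  rw [mul_val_apply]
  fin_cases i <;> fin_cases j <;>
    simp only [swapConj_val, mul_val_apply] <;> simp <;> ring

lemma swapConj_mem {M : SL(2, ℝ)} (hM : M ∈ heckeGroup 4) : swapConj M ∈ heckeGroup 4 := by
  have hM' := hM
  rw [heckeGroup_four] at hM'
  induction hM' using Subgroup.closure_induction with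
  | mem M h =>
    rcases h with rfl | rfl
    · have : swapConj heckeS = heckeS⁻¹ := by
        ext i j; fin_cases i <;> fin_cases j <;> simp only [swapConj_val, inv_val] <;>
          simp [heckeS_val]
      rw [this]; exact inv_mem heckeS_mem
    · have : swapConj (heckeT √2) = heckeS * (heckeT √2)⁻¹ * heckeS⁻¹ := by
        ext i j; fin_cases i <;> fin_cases j <;>
          simp only [swapConj_val, inv_val, mul_val_apply] <;> simp [heckeS_val, heckeT_val]
      rw [this]
      exact mul_mem (mul_mem heckeS_mem (inv_mem heckeT_mem)) (inv_mem heckeS_mem)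
  | one =>
    have : swapConj 1 = 1 := by
      ext i j; fin_cases i <;> fin_cases j <;> simp [swapConj_val]
    rw [this]; exact one_mem _
  | mul M N hM' hN' ihM ihN =>
    rw [← heckeGroup_four] at hM' hN'
    rw [swapConj_mul]; exact mul_mem (ihM hM') (ihN hN')
  | inv M hM' ih =>
    rw [← heckeGroup_four] at hM'
    have : swapConj M⁻¹ = (swapConj M)⁻¹ := by
      rw [eq_inv_iff_mul_eq_one, ← swapConj_mul, inv_mul_cancel]
      ext i j; fin_cases i <;> fin_cases j <;> simp [swapConj_val]
    rw [this]; exact inv_mem (ih hM')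

/-- The orbit of `(1, 0)ᵗ` under the Hecke group `H₄`. -/
abbrev heckeOrbit : Set (Fin 2 → ℝ) := cuspOrbit (heckeGroup 4)

lemma firstColumn_eq (M : SL(2, ℝ)) : firstColumn M = ![M.1 0 0, M.1 1 0] := by
  ext i; fin_cases i <;> simp [firstColumn_apply]

lemma firstColumn_mem {M : SL(2, ℝ)} (hM : M ∈ heckeGroup 4) : firstColumn M ∈ heckeOrbit :=
  ⟨M, hM, rfl⟩

lemma mul_mem_heckeOrbit {N : SL(2, ℝ)} (hN : N ∈ heckeGroup 4) {x y : ℝ}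
    (hv : ![x, y] ∈ heckeOrbit) :
    ![N.1 0 0 * x + N.1 0 1 * y, N.1 1 0 * x + N.1 1 1 * y] ∈ heckeOrbit := by
  obtain ⟨M, hM, e⟩ := hv
  rw [firstColumn_eq] at e
  have hx : x = M.1 0 0 := by simpa using congrFun e 0
  have hy : y = M.1 1 0 := by simpa using congrFun e 1
  exact ⟨N * M, mul_mem hN hM, by rw [firstColumn_eq, mul_val_apply, mul_val_apply, hx, hy]⟩

lemma heckeOrbit_rotate {x y : ℝ} (h : ![x, y] ∈ heckeOrbit) : ![-y, x] ∈ heckeOrbit := by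
  simpa [heckeS_val] using mul_mem_heckeOrbit heckeS_mem h

/-- The swap has determinant `-1` and is not in the group, but it normalises the group: `swapConj M
* heckeS` has the swapped first column. The orbit is therefore symmetric under reflections. -/
lemma heckeOrbit_swap {x y : ℝ} (h : ![x, y] ∈ heckeOrbit) : ![y, x] ∈ heckeOrbit := by
  obtain ⟨M, hM, e⟩ := h
  rw [firstColumn_eq] at e
  have hx : x = M.1 0 0 := by simpa using congrFun e 0
  have hy : y = M.1 1 0 := by simpa using congrFun e 1
  have := mul_mem (swapConj_mem hM) heckeS_mem
  refine ⟨_, this, ?_⟩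
  rw [firstColumn_eq, hx, hy]
  simp [mul_val_apply, swapConj_val, heckeS_val]

lemma heckeOrbit_reflect {x y : ℝ} (h : ![x, y] ∈ heckeOrbit) : ![-x, y] ∈ heckeOrbit :=
  heckeOrbit_rotate (heckeOrbit_swap h)

lemma heckeOrbit_add {x y : ℝ} (h : ![x, y] ∈ heckeOrbit) : ![x + √2 * y, y] ∈ heckeOrbit := by
  simpa [heckeT_val] using mul_mem_heckeOrbit heckeT_mem h

lemma heckeOrbit_add' {x y : ℝ} (h : ![x, y] ∈ heckeOrbit) : ![x, y + √2 * x] ∈ heckeOrbit :=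
  heckeOrbit_swap (heckeOrbit_add (heckeOrbit_swap h))

/-- This is the move of the digit `2`. Its matrix has determinant `-1` and is factored into
translations, swaps and reflections. -/
lemma heckeOrbit_two {x y : ℝ} (h : ![x, y] ∈ heckeOrbit) :
    ![x + √2 * y, √2 * x + y] ∈ heckeOrbit := by
  have h2 := sqrt_two_mul_self
  have := heckeOrbit_swap (heckeOrbit_reflect (heckeOrbit_add' (heckeOrbit_reflect
    (heckeOrbit_add h))))
  rw [show -(-(x + √2 * y)) = x + √2 * y by ring,
    show y + √2 * -(x + √2 * y) = -(√2 * x + y) by linear_combination (-y) * h2] at this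
  have := heckeOrbit_swap (heckeOrbit_reflect this)
  simpa using this

lemma one_zero_mem_heckeOrbit : ![1, 0] ∈ heckeOrbit :=
  ⟨1, one_mem _, by rw [firstColumn_eq]; simp⟩

lemma zero_one_mem_heckeOrbit : ![0, 1] ∈ heckeOrbit :=
  heckeOrbit_swap one_zero_mem_heckeOrbit

/-! ### Unfolding a form into a doubly infinite sequence -/

lemma exists_int_chain {α : Type*} {R : α → α → Prop} (hf : ∀ a, ∃ b, R a b)
    (hb : ∀ b, ∃ a, R a b) (a : α) : ∃ f : ℤ → α, f 0 = a ∧ ∀ n, R (f n) (f (n + 1)) := by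
  choose f hf using hf
  choose g hg using hb
  refine ⟨fun n => if 0 ≤ n then f^[n.toNat] a else g^[(-n).toNat] a, by simp, fun n => ?_⟩
  dsimp only
  rcases lt_trichotomy n (-1) with h | h | h
  · rw [if_neg (by omega), if_neg (by omega),
      show (-n).toNat = (-(n + 1)).toNat + 1 by omega, Function.iterate_succ_apply']
    exact hg _
  · subst h; simpa using hg a
  · rw [if_pos (by omega), if_pos (by omega), show (n + 1).toNat = n.toNat + 1 by omega,
      Function.iterate_succ_apply']
    exact hf _

/-- `P + Q` is at most `μ` times the values on the orbit of the form with roots `√2 Q`, `-√2 P`. -/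
def IsGood (μ P Q : ℝ) : Prop :=
  ∀ x y, ![x, y] ∈ heckeOrbit → P + Q ≤ μ * |(x - √2 * Q * y) * (x + √2 * P * y)|

namespace IsGood

variable {μ P Q : ℝ}

lemma symm (h : IsGood μ P Q) : IsGood μ Q P := by
  intro x y hxy
  have := h (-x) y (heckeOrbit_reflect hxy)
  rw [show (-x - √2 * Q * y) * (-x + √2 * P * y) = (x - √2 * P * y) * (x + √2 * Q * y) by ring]
    at this
  linarith

lemma add_le (h : IsGood μ P Q) : P + Q ≤ μ := by
  simpa using h 1 0 one_zero_mem_heckeOrbit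

lemma vee_add_le (h : IsGood μ P Q) (hP : 0 < P) (hQ : 0 < Q) :
    1 / (2 * P) + 1 / (2 * Q) ≤ μ := by
  have := h 0 1 zero_one_mem_heckeOrbit
  rw [show (0 - √2 * Q * 1) * (0 + √2 * P * 1) = -((√2 * √2) * (P * Q)) by ring,
    sqrt_two_mul_self, abs_neg, abs_of_pos (by positivity)] at this
  rw [div_add_div _ _ (by positivity) (by positivity), div_le_iff₀ (by positivity)]
  linarith

lemma of_scaled {k P' Q' : ℝ} (hk : 0 < k) (hsum : P + Q = k * (P' + Q'))
    (h : ∀ x y, ![x, y] ∈ heckeOrbit →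
      P + Q ≤ μ * (k * |(x - √2 * Q' * y) * (x + √2 * P' * y)|)) : IsGood μ P' Q' := by
  intro x y hxy
  have := h x y hxy
  rw [hsum] at this
  refine le_of_mul_le_mul_left ?_ hk
  linarith

/-- Changing the basis by the move of the first digit of `Q` turns the form into a multiple of one
of the same shape, with that digit transferred from `Q` to `P`. The orbit is invariant, and the
multiple is the factor by which the sum of the coordinates changes. -/
lemma exists_step (h : IsGood μ P Q) (hP : 0 < P) (hQ : 0 < Q) :
    ∃ d : RomikDigit, ∃ Q', 0 < Q' ∧ Q = d.branch Q' ∧ IsGood μ (d.branch P) Q' := by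
  have h2 := sqrt_two_mul_self
  have hPQ : 0 < P + Q := by linarith
  rcases lt_trichotomy Q 1 with h1 | h1 | h1
  · rcases lt_trichotomy Q (1 / 2) with h3 | h3 | h3
    · have hk : 0 < 1 - 2 * Q := by linarith
      have hk' : 0 < 2 * P + 1 := by linarith
      obtain ⟨Q', hQ', e⟩ : ∃ Q', 0 < Q' ∧ Q' * (1 - 2 * Q) = Q :=
        ⟨Q / (1 - 2 * Q), by positivity, div_mul_cancel₀ _ hk.ne'⟩
      have eP : (2 * P + 1) * one.branch P = P := by simp only [branch]; field_simp
      refine ⟨one, Q', hQ', ?_, of_scaled (k := (1 - 2 * Q) * (2 * P + 1)) (P := P) (Q := Q)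
        (by positivity) ?_ fun x y hxy => (h _ _ (heckeOrbit_add' hxy)).trans (le_of_eq ?_)⟩
      · simp only [branch]
        rw [eq_div_iff (by positivity)]; linarith
      · linear_combination (-(1 - 2 * Q)) * eP - (2 * P + 1) * e
      · rw [show x - √2 * Q * (y + √2 * x) = (1 - 2 * Q) * (x - √2 * Q' * y) by
            linear_combination (-Q * x) * h2 + √2 * y * e,
          show x + √2 * P * (y + √2 * x) = (2 * P + 1) * (x + √2 * one.branch P * y) by
            linear_combination (P * x) * h2 - √2 * y * eP,
          mul_mul_mul_comm, abs_mul, abs_of_pos (mul_pos hk hk')]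
    -- For `Q = 1/2` the form would vanish at the cusp `(1, √2)`, which a good pair forbids; `Q = 1`
    -- below is excluded by the cusp `(√2, 1)`.
    · have := h 1 √2 (by simpa using heckeOrbit_add' one_zero_mem_heckeOrbit)
      rw [show (1 : ℝ) - √2 * Q * √2 = 0 by rw [h3]; linear_combination (-1 / 2 : ℝ) * h2] at this
      simp at this; linarith
    · have hk : 0 < 2 * Q - 1 := by linarith
      have hk' : 0 < 2 * P + 1 := by linarith
      obtain ⟨Q', hQ', e⟩ : ∃ Q', 0 < Q' ∧ Q' * (2 * Q - 1) = 1 - Q :=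
        ⟨(1 - Q) / (2 * Q - 1), div_pos (by linarith) hk, div_mul_cancel₀ _ hk.ne'⟩
      have eP : (2 * P + 1) * two.branch P = P + 1 := by simp only [branch]; field_simp
      refine ⟨two, Q', hQ', ?_, of_scaled (k := (2 * Q - 1) * (2 * P + 1)) (P := P) (Q := Q)
        (by positivity) ?_ fun x y hxy => (h _ _ (heckeOrbit_two hxy)).trans (le_of_eq ?_)⟩
      · simp only [branch]
        rw [eq_div_iff (by positivity)]; linarith
      · linear_combination (-(2 * Q - 1)) * eP - (2 * P + 1) * e
      · rw [show x + √2 * y - √2 * Q * (√2 * x + y) = -((2 * Q - 1) * (x - √2 * Q' * y)) by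
            linear_combination (-Q * x) * h2 - √2 * y * e,
          show x + √2 * y + √2 * P * (√2 * x + y) = (2 * P + 1) * (x + √2 * two.branch P * y) by
            linear_combination (P * x) * h2 - √2 * y * eP,
          neg_mul, abs_neg, mul_mul_mul_comm, abs_mul, abs_of_pos (mul_pos hk hk')]
  · have := h √2 1 (by simpa using heckeOrbit_add zero_one_mem_heckeOrbit)
    rw [show √2 - √2 * Q * 1 = 0 by rw [h1]; ring] at this
    simp at this; linarith
  · refine ⟨three, Q - 1, by linarith, by simp [branch], ?_⟩
    intro x y hxy
    have := h _ _ (heckeOrbit_add hxy)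
    rw [show x + √2 * y - √2 * Q * y = x - √2 * (Q - 1) * y by ring,
      show x + √2 * y + √2 * P * y = x + √2 * three.branch P * y by simp only [branch]; ring] at this
    simp only [branch] at this ⊢
    linarith

/-- A good pair unfolds into a bounded geodesic. -/
lemma exists_geodesic (h : IsGood μ P Q) (hP : 0 < P) (hQ : 0 < Q) :
    ∃ t p q, IsBoundedGeodesic t p q μ ∧ p 0 = P ∧ q 0 = Q := by
  let α := {s : ℝ × ℝ // 0 < s.1 ∧ 0 < s.2 ∧ IsGood μ s.1 s.2}
  let R : α → α → Prop := fun s s' =>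
    ∃ d : RomikDigit, s.1.2 = d.branch s'.1.2 ∧ s'.1.1 = d.branch s.1.1
  obtain ⟨f, hf0, hf⟩ := exists_int_chain (R := R)
    (fun ⟨⟨p, q⟩, hp, hq, hg⟩ => by
      obtain ⟨d, q', hq', e, hg'⟩ := hg.exists_step hp hq
      exact ⟨⟨⟨d.branch p, q'⟩, branch_pos d hp, hq', hg'⟩, d, e, rfl⟩)
    (fun ⟨⟨p, q⟩, hp, hq, hg⟩ => by
      obtain ⟨d, p', hp', e, hg'⟩ := hg.symm.exists_step hq hp
      exact ⟨⟨⟨p', d.branch q⟩, hp', branch_pos d hq, hg'.symm⟩, d, rfl, e⟩)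
    (⟨⟨P, Q⟩, hP, hQ, h⟩ : α)
  choose d hq hp using hf
  -- The digit of the step from cut `n` to cut `n + 1` stands at place `n + 1`, hence the shift.
  refine ⟨fun n => d (n - 1), fun n => (f n).1.1, fun n => (f n).1.2, ⟨⟨fun n => (f n).2.1,
    fun n => (f n).2.2.1, fun n => ?_, fun n => ?_⟩, fun n => (f n).2.2.2.add_le,
    fun n => (f n).2.2.2.vee_add_le (f n).2.1 (f n).2.2.1⟩, ?_, ?_⟩
  · have := hp (n - 1)
    rwa [sub_add_cancel] at this
  · rw [add_sub_cancel_right]; exact hq n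
  · simp [hf0]
  · simp [hf0]

lemma gap (h : IsGood μ P Q) (hP : 0 < P) (hQ : 0 < Q) (hμ : μ < upperBound) :
    P + Q ≤ √119 / 5 ∨ P + Q = √5 := by
  obtain ⟨t, p, q, hg, rfl, rfl⟩ := h.exists_geodesic hP hQ
  exact hg.gap hμ

end IsGood

/-! ### Cusps with large quotient, and the gap in the Markoff spectrum -/

lemma heckeT_add (l l' : ℝ) : heckeT (l + l') = heckeT l * heckeT l' := by
  ext i j
  rw [mul_val_apply]
  fin_cases i <;> fin_cases j <;> simp [heckeT_val, add_comm]

lemma heckeT_int_mem (k : ℤ) : heckeT (k * √2) ∈ heckeGroup 4 := by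
  have hneg : heckeT (-√2) ∈ heckeGroup 4 := by
    have : heckeT (-√2) = (heckeT √2)⁻¹ := by
      rw [eq_inv_iff_mul_eq_one, ← heckeT_add, neg_add_cancel]
      ext i j; fin_cases i <;> fin_cases j <;> simp [heckeT_val]
    rw [this]; exact inv_mem heckeT_mem
  induction k using Int.induction_on with
  | zero =>
    have : heckeT (((0 : ℤ) : ℝ) * √2) = 1 := by
      ext i j; fin_cases i <;> fin_cases j <;> simp [heckeT_val]
    rw [this]; exact one_mem _
  | succ k ih =>
    push_cast at ih ⊢
    rw [add_mul, one_mul, heckeT_add]; exact mul_mem ih heckeT_mem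
  | pred k ih =>
    push_cast at ih ⊢
    rw [sub_mul, one_mul, sub_eq_add_neg, heckeT_add]; exact mul_mem ih hneg

/-- The value of a form at `M (x, y)ᵗ`. -/
noncomputable def formAt (a b c : ℝ) (M : SL(2, ℝ)) (x y : ℝ) : ℝ :=
  binForm a b c ![M.1 0 0 * x + M.1 0 1 * y, M.1 1 0 * x + M.1 1 1 * y]

lemma binForm_vec (a b c x y : ℝ) : binForm a b c ![x, y] = a * x ^ 2 + b * (x * y) + c * y ^ 2 := by
  simp [binForm]

lemma formAt_mem (a b c : ℝ) {M : SL(2, ℝ)} (hM : M ∈ heckeGroup 4) {x y : ℝ}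
    (h : ![x, y] ∈ heckeOrbit) :
    ∃ N ∈ heckeGroup 4, formAt a b c M x y = binForm a b c (firstColumn N) ∧
      firstColumn N = ![M.1 0 0 * x + M.1 0 1 * y, M.1 1 0 * x + M.1 1 1 * y] := by
  obtain ⟨N, hN, e⟩ := mul_mem_heckeOrbit hM h
  exact ⟨N, hN, by rw [formAt, e], e.symm⟩

/-- If the value at a cusp exceeds `√2`, then the cusp lies on an edge that the geodesic crosses. -/
lemma exists_crossing {a b c : ℝ} {M : SL(2, ℝ)} (hM : M ∈ heckeGroup 4)
    (hA : binForm a b c (firstColumn M) ≠ 0) (hδ : 0 < b ^ 2 - 4 * a * c)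
    (hlt : √2 * |binForm a b c (firstColumn M)| < √(b ^ 2 - 4 * a * c)) :
    ∃ M' ∈ heckeGroup 4, firstColumn M' = firstColumn M ∧ ∃ P Q, 0 < P ∧ 0 < Q ∧
      √(b ^ 2 - 4 * a * c) = |binForm a b c (firstColumn M)| * (√2 * (P + Q)) ∧
      ∀ x y, formAt a b c M' x y =
        binForm a b c (firstColumn M) * ((x - √2 * Q * y) * (x + √2 * P * y)) := by
  have h2 := sqrt_two_mul_self
  have hs : 0 < √2 := by positivity
  set A := binForm a b c (firstColumn M) with hAdef
  set D := √(b ^ 2 - 4 * a * c) with hD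
  have hDsq : D ^ 2 = b ^ 2 - 4 * a * c := Real.sq_sqrt hδ.le
  have hdet := det_eq_one M
  set m := M.1 0 0
  set n := M.1 0 1
  set o := M.1 1 0
  set r := M.1 1 1
  have hAeq : A = a * m ^ 2 + b * (m * o) + c * o ^ 2 := by
    rw [hAdef, firstColumn_eq, binForm_vec]
  set B := 2 * a * m * n + b * (m * r + n * o) + 2 * c * o * r with hB
  have hpos : 0 < |A| := abs_pos.2 hA
  -- In the basis given by `M` the form is `A (x - ξ y) (x - η y)`.
  set ξ := (-B / A + D / |A|) / 2 with hξ
  set η := (-B / A - D / |A|) / 2 with hη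
  have hdisc : B ^ 2 - 4 * A * (a * n ^ 2 + b * (n * r) + c * r ^ 2) = D ^ 2 := by
    rw [hDsq, hAeq, hB]
    linear_combination (b ^ 2 - 4 * a * c) * (m * r - n * o + 1) * hdet
  have hsub : ξ - η = D / |A| := by rw [hξ, hη]; ring
  have hgap : √2 < ξ - η := by rw [hsub, lt_div_iff₀ hpos]; exact hlt
  -- The roots are more than `√2` apart, so a multiple of `√2` lies strictly between them.
  -- Translating it to `0` fixes the cusp and gives the roots opposite signs.
  set k : ℤ := ⌊η / √2⌋ + 1 with hk
  have hk1 : η < k * √2 := by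
    have := Int.lt_floor_add_one (η / √2)
    rw [div_lt_iff₀ hs] at this
    rw [hk]; push_cast; exact this
  have hk2 : k * √2 < ξ := by
    have := Int.floor_le (η / √2)
    rw [le_div_iff₀ hs] at this
    rw [hk]; push_cast; linarith
  refine ⟨M * heckeT (k * √2), mul_mem hM (heckeT_int_mem k), ?_,
    (k * √2 - η) / √2, (ξ - k * √2) / √2, div_pos (by linarith) hs, div_pos (by linarith) hs,
    ?_, ?_⟩
  · rw [firstColumn_eq, firstColumn_eq, mul_val_apply, mul_val_apply]
    simp [heckeT_val]
  · have : √2 * ((k * √2 - η) / √2 + (ξ - k * √2) / √2) = ξ - η := by field_simp; ring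
    rw [this, hsub]; field_simp
  · intro x y
    have e1 : √2 * ((ξ - k * √2) / √2) = ξ - k * √2 := by field_simp
    have e2 : √2 * ((k * √2 - η) / √2) = k * √2 - η := by field_simp
    have e3 : ξ + η = -B / A := by rw [hξ, hη]; ring
    have e4 : A * (ξ * η) = a * n ^ 2 + b * (n * r) + c * r ^ 2 := by
      have : A * (ξ * η) * (4 * A) = B ^ 2 - D ^ 2 := by
        have habs : (D / |A|) ^ 2 = D ^ 2 / A ^ 2 := by rw [div_pow, sq_abs]
        have : ξ * η = (B ^ 2 / A ^ 2 - D ^ 2 / A ^ 2) / 4 := by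
          rw [← habs, hξ, hη]; ring
        rw [this]
        field_simp
      have h4 : (4 * A) ≠ 0 := by positivity
      apply mul_right_cancel₀ h4
      linarith
    have e5 : A * (ξ + η) = -B := by rw [e3]; field_simp
    rw [e1, e2, formAt, binForm_vec]
    simp only [mul_val_apply, heckeT_val]
    simp only [Matrix.of_apply, Matrix.cons_val', Matrix.cons_val_zero, Matrix.cons_val_one,
      Matrix.cons_val_fin_one, mul_one, mul_zero, add_zero]
    have : A * ((x - (ξ - k * √2) * y) * (x + (k * √2 - η) * y)) =
        A * (x + k * √2 * y) ^ 2 - (A * (ξ + η)) * ((x + k * √2 * y) * y) +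
          (A * (ξ * η)) * y ^ 2 := by ring
    rw [this, e4, e5, hAeq, hB]
    ring

lemma sqrt_two_mul_sqrt_119 : √2 * (√119 / 5) = √238 / 5 := by
  rw [← mul_div_assoc, ← Real.sqrt_mul (by norm_num)]; norm_num

lemma sqrt_two_mul_sqrt_five : √2 * √5 = √10 := by
  rw [← Real.sqrt_mul (by norm_num)]; norm_num

lemma sqrt_two_mul_upperBound : √2 * upperBound = (2124 * √2 + 48 * √238) / 1177 := by
  have : √238 = √2 * √119 := by rw [← Real.sqrt_mul (by norm_num)]; norm_num
  rw [this, upperBound]; ring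

lemma one_lt_sqrt_119_div : 1 < √119 / 5 := by linarith [lt_sqrt_119]

/-- Below the upper end of the gaps the Markoff spectrum lies in `(0, √238 / 5] ∪ {√10}`. -/
lemma markoffSpectrum_gap {m : ℝ} (hm : m ∈ markoffSpectrum (heckeGroup 4))
    (hlt : m < √2 * upperBound) : m ≤ √2 * (√119 / 5) ∨ m = √2 * √5 := by
  obtain ⟨a, b, c, hδ, hI, rfl⟩ := hm
  set I := ⨅ M : heckeGroup 4, |binForm a b c (firstColumn M)| with hIdef
  set D := √(b ^ 2 - 4 * a * c) with hD
  have hDpos : 0 < D := Real.sqrt_pos.2 hδ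
  have hs : 0 < √2 := by positivity
  have hIle : ∀ M ∈ heckeGroup 4, I ≤ |binForm a b c (firstColumn M)| := fun M hM =>
    ciInf_le (f := fun M : heckeGroup 4 => |binForm a b c (firstColumn M)|)
      ⟨0, by rintro _ ⟨M, rfl⟩; exact abs_nonneg _⟩ ⟨M, hM⟩
  -- The dichotomy already holds for each single quotient `D / |f(M)|`: above `√2 (√119 / 5)` it can
  -- only equal `√2 √5`.
  have key : ∀ M ∈ heckeGroup 4, √2 * (√119 / 5) * |binForm a b c (firstColumn M)| < D →
      D = √2 * √5 * |binForm a b c (firstColumn M)| := by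
    intro M hM hMlt
    have hA : 0 < |binForm a b c (firstColumn M)| := hI.trans_le (hIle M hM)
    obtain ⟨M', hM', -, P, Q, hP, hQ, hPQ, hf⟩ := exists_crossing hM (abs_pos.1 hA) hδ (by
      refine lt_of_le_of_lt ?_ hMlt
      gcongr
      nlinarith [one_lt_sqrt_119_div])
    change D = _ at hPQ
    have hgood : IsGood (D / I / √2) P Q := by
      intro x y hxy
      obtain ⟨N, hN, e, -⟩ := formAt_mem a b c hM' hxy
      have h1 := hIle N hN
      rw [← e, hf, abs_mul] at h1
      rw [div_div, div_mul_eq_mul_div, le_div_iff₀ (by positivity)]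
      have hDPQ : (P + Q) * √2 * |binForm a b c (firstColumn M)| = D := by rw [hPQ]; ring
      refine le_of_mul_le_mul_right ?_ hA
      calc (P + Q) * (I * √2) * |binForm a b c (firstColumn M)| = D * I := by rw [← hDPQ]; ring
        _ ≤ D * (|binForm a b c (firstColumn M)| * |(x - √2 * Q * y) * (x + √2 * P * y)|) := by
          gcongr
        _ = _ := by ring
    rcases hgood.gap hP hQ (by rw [div_lt_iff₀ hs]; linarith) with h | h
    · exfalso
      rw [hPQ] at hMlt
      have : |binForm a b c (firstColumn M)| * (√2 * (P + Q)) ≤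
        |binForm a b c (firstColumn M)| * (√2 * (√119 / 5)) := by gcongr
      linarith
    · rw [hPQ, h]; ring
  have hex : ∀ r : ℝ, 0 < r → r < D / I → ∃ M ∈ heckeGroup 4,
      r * |binForm a b c (firstColumn M)| < D := by
    intro r hr hrD
    rw [lt_div_iff₀ hI, mul_comm, ← lt_div_iff₀ hr] at hrD
    obtain ⟨M, hM⟩ := exists_lt_of_ciInf_lt hrD
    rw [lt_div_iff₀ hr] at hM
    exact ⟨M, M.2, by linarith⟩
  by_contra! hcon
  obtain ⟨h1, h2⟩ := hcon
  have h119 : √119 / 5 < √5 := by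
    have : (2.2 : ℝ) < √5 := Real.lt_sqrt_of_sq_lt (by norm_num)
    linarith [sqrt_119_lt]
  obtain ⟨M, hM, hMlt⟩ := hex _ (by positivity) h1
  have hDM := key M hM hMlt
  have hge : √2 * √5 ≤ D / I := by
    rw [le_div_iff₀ hI, hDM]
    have := hIle M hM
    gcongr
  -- A supremum strictly above `√2 √5` would require a quotient strictly above it, which `key`
  -- excludes.
  obtain ⟨N, hN, hNlt⟩ := hex _ (by positivity) (lt_of_le_of_ne hge (Ne.symm h2))
  have := key N hN (lt_of_le_of_lt (by gcongr) hNlt)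
  linarith

/-! ### The gap in the Lagrange spectrum -/

lemma ofReal_div_ofReal_lt_iff {D z r : ℝ} (hD : 0 < D) (hz : 0 ≤ z) :
    ENNReal.ofReal D / ENNReal.ofReal z < ENNReal.ofReal r ↔ D < r * z := by
  rcases hz.eq_or_lt with rfl | hz
  · simp [ENNReal.div_zero, hD, hD.le]
  · rw [← ENNReal.ofReal_div_of_pos hz, ENNReal.ofReal_lt_ofReal_iff_of_nonneg (by positivity),
      div_lt_iff₀ hz]

lemma lt_ofReal_div_ofReal_iff {D z r : ℝ} (hD : 0 < D) (hz : 0 ≤ z) (hr : 0 ≤ r) :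
    ENNReal.ofReal r < ENNReal.ofReal D / ENNReal.ofReal z ↔ r * z < D := by
  rcases hz.eq_or_lt with rfl | hz
  · simp [ENNReal.div_zero, hD]
  · rw [← ENNReal.ofReal_div_of_pos hz, ENNReal.ofReal_lt_ofReal_iff_of_nonneg hr, lt_div_iff₀ hz]

lemma heckeOrbit_bounded_finite (R : ℝ) :
    {v | v ∈ heckeOrbit ∧ |v 0| ≤ R ∧ |v 1| ≤ R}.Finite := by
  set N : ℤ := ⌈R⌉
  have hN : R ≤ N := Int.le_ceil R
  have hs : (1 : ℝ) ≤ √2 := Real.one_le_sqrt.2 (by norm_num)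
  let S : Set (ℤ × ℤ) := Set.Icc (-N) N ×ˢ Set.Icc (-N) N
  have hS : S.Finite := (Set.finite_Icc _ _).prod (Set.finite_Icc _ _)
  refine ((hS.image fun z => ![(z.1 : ℝ), √2 * z.2]).union
    (hS.image fun z => ![√2 * (z.1 : ℝ), (z.2 : ℝ)])).subset ?_
  have key : ∀ z : ℤ, |(z : ℝ)| ≤ R → z ∈ Set.Icc (-N) N := by
    intro z hz
    have := abs_le.1 (hz.trans hN)
    exact ⟨by exact_mod_cast this.1, by exact_mod_cast this.2⟩
  have key' : ∀ z : ℤ, |√2 * (z : ℝ)| ≤ R → z ∈ Set.Icc (-N) N := by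
    intro z hz
    refine key z (le_trans ?_ hz)
    rw [abs_mul, abs_of_pos (by linarith : 0 < √2)]
    exact le_mul_of_one_le_left (abs_nonneg _) hs
  rintro v ⟨⟨M, hM, rfl⟩, h0, h1⟩
  rw [firstColumn_eq] at h0 h1 ⊢
  simp only [Matrix.cons_val_zero, Matrix.cons_val_one, Matrix.cons_val_fin_one] at h0 h1
  rcases heckeGroup_four_entries hM with ⟨a, b, c, d, -, ha, -, hc, -⟩ | ⟨a, b, c, d, -, ha, -, hc, -⟩
  · rw [ha] at h0 ⊢
    rw [hc] at h1 ⊢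
    exact Or.inl ⟨(a, c), ⟨key a h0, key' c h1⟩, rfl⟩
  · rw [ha] at h0 ⊢
    rw [hc] at h1 ⊢
    exact Or.inr ⟨(a, c), ⟨key' a h0, key c h1⟩, rfl⟩

/-- A positive discriminant excludes `α = β = 0`, so the polynomial is not constant and is unbounded
at infinity. -/
lemma exists_bound_of_quadratic {α β γ : ℝ} (h : 0 < β ^ 2 - 4 * α * γ) (D : ℝ) :
    ∃ R, ∀ τ, |γ + β * τ + α * τ ^ 2| ≤ D → |τ| ≤ R := by
  by_cases hα : α = 0
  · subst hα
    have hβ : β ≠ 0 := by rintro rfl; simp at h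
    have hβ' := abs_pos.2 hβ
    refine ⟨(D + |γ|) / |β|, fun τ hτ => ?_⟩
    rw [le_div_iff₀ hβ', ← abs_mul]
    have := abs_sub_abs_le_abs_sub (β * τ) (-γ)
    rw [abs_neg, sub_neg_eq_add] at this
    rw [zero_mul, add_zero, add_comm] at hτ
    rw [mul_comm τ]; linarith
  · have hα' := abs_pos.2 hα
    refine ⟨1 + (D + |γ| + |β|) / |α|, fun τ hτ => ?_⟩
    by_contra! hcon
    have hD : 0 ≤ D := (abs_nonneg _).trans hτ
    have hq : 0 ≤ (D + |γ| + |β|) / |α| := by positivity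
    have h1 : 1 < |τ| := by linarith
    have h2 : (D + |γ| + |β|) < |τ| * |α| := by
      rw [← div_lt_iff₀ hα']; linarith
    have h3 : |α| * |τ| ^ 2 ≤ D + |γ| + |β| * |τ| := by
      have e : α * τ ^ 2 = (γ + β * τ + α * τ ^ 2) + (-γ) + (-(β * τ)) := by ring
      have := abs_add_three (γ + β * τ + α * τ ^ 2) (-γ) (-(β * τ))
      rw [← e, abs_neg, abs_neg, abs_mul, abs_mul, abs_pow] at this
      linarith
    nlinarith [abs_nonneg γ, abs_nonneg β]

/-- Only finitely many orbit points on an affine line not through the origin have bounded form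
values. -/
lemma heckeOrbit_line_finite {a b c : ℝ} (hδ : 0 < b ^ 2 - 4 * a * c) {u₀ u₁ w : ℝ} (hw : w ≠ 0)
    (D : ℝ) : {v | v ∈ heckeOrbit ∧ v 0 * u₁ - v 1 * u₀ = w ∧ |binForm a b c v| ≤ D}.Finite := by
  set S := {v | v ∈ heckeOrbit ∧ v 0 * u₁ - v 1 * u₀ = w ∧ |binForm a b c v| ≤ D} with hS
  rcases S.eq_empty_or_nonempty with he | ⟨v', hv'⟩
  · rw [he]; exact Set.finite_empty
  obtain ⟨-, hdet', -⟩ := hv'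
  have hu : 0 < u₀ ^ 2 + u₁ ^ 2 := by
    rcases eq_or_ne u₀ 0 with h0 | h0
    · rcases eq_or_ne u₁ 0 with h1 | h1
      · rw [h0, h1] at hdet'; simp at hdet'; exact absurd hdet'.symm hw
      · positivity
    · positivity
  obtain ⟨R, hR⟩ := exists_bound_of_quadratic (α := a * u₀ ^ 2 + b * (u₀ * u₁) + c * u₁ ^ 2)
    (β := 2 * a * v' 0 * u₀ + b * (v' 0 * u₁ + v' 1 * u₀) + 2 * c * v' 1 * u₁)
    (γ := binForm a b c v') (by
      -- On the line `v' + τ u` the form is a polynomial in `τ` of discriminant `δ w²`.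
      have : (2 * a * v' 0 * u₀ + b * (v' 0 * u₁ + v' 1 * u₀) + 2 * c * v' 1 * u₁) ^ 2 -
          4 * (a * u₀ ^ 2 + b * (u₀ * u₁) + c * u₁ ^ 2) * binForm a b c v' =
          (b ^ 2 - 4 * a * c) * (v' 0 * u₁ - v' 1 * u₀) ^ 2 := by unfold binForm; ring
      rw [this, hdet']; positivity) D
  refine (heckeOrbit_bounded_finite (|v' 0| + |v' 1| + R * (|u₀| + |u₁|))).subset ?_
  rintro v ⟨hv, hdet, hf⟩
  obtain ⟨τ, h0, h1⟩ : ∃ τ, v 0 = v' 0 + τ * u₀ ∧ v 1 = v' 1 + τ * u₁ := by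
    refine ⟨((v 0 - v' 0) * u₀ + (v 1 - v' 1) * u₁) / (u₀ ^ 2 + u₁ ^ 2), ?_, ?_⟩
    · rw [div_mul_eq_mul_div, ← sub_eq_iff_eq_add', eq_div_iff hu.ne']
      linear_combination u₁ * (hdet - hdet')
    · rw [div_mul_eq_mul_div, ← sub_eq_iff_eq_add', eq_div_iff hu.ne']
      linear_combination (-u₀) * (hdet - hdet')
  have hτ : |τ| ≤ R := hR τ (by
    refine le_trans (le_of_eq ?_) hf
    congr 1
    unfold binForm
    rw [h0, h1]; ring)
  have hbound : ∀ x u : ℝ, |u| ≤ |u₀| + |u₁| → |x| ≤ |v' 0| + |v' 1| →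
      |x + τ * u| ≤ |v' 0| + |v' 1| + R * (|u₀| + |u₁|) := by
    intro x u hu hx
    refine (abs_add_le _ _).trans (add_le_add hx ?_)
    rw [abs_mul]
    exact mul_le_mul hτ hu (abs_nonneg _) ((abs_nonneg _).trans hτ)
  refine ⟨hv, ?_, ?_⟩
  · rw [h0]; exact hbound _ _ (by linarith [abs_nonneg u₁]) (by linarith [abs_nonneg (v' 1)])
  · rw [h1]; exact hbound _ _ (by linarith [abs_nonneg u₀]) (by linarith [abs_nonneg (v' 0)])

lemma zero_notMem_heckeOrbit : ![0, 0] ∉ heckeOrbit := by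
  rintro ⟨M, hM, e⟩
  rw [firstColumn_eq] at e
  have h0 : 0 = M.1 0 0 := by simpa using congrFun e 0
  have h1 : 0 = M.1 1 0 := by simpa using congrFun e 1
  have := det_eq_one M
  rw [← h0, ← h1] at this
  simp at this

/-- Choose cusps whose quotients tend to `m`, move each crossing to the base edge, and pass to a
limit pair `(P', Q')`. The limit satisfies `√2 (P' + Q') = m` and is good for `m / √2`, because the
form values that bound it come from cusps leaving every finite set. The dichotomy for good pairs
then applies to it. -/
lemma lagrangeSpectrum_gap {m : ℝ} (hm : m ∈ lagrangeSpectrum (heckeGroup 4))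
    (hlt : m < √2 * upperBound) : m ≤ √2 * (√119 / 5) ∨ m = √2 * √5 := by
  obtain ⟨-, a, b, c, hδ, hlim⟩ := hm
  set D := √(b ^ 2 - 4 * a * c) with hD
  have hDpos : 0 < D := Real.sqrt_pos.2 hδ
  have hs : 0 < √2 := by positivity
  rw [or_iff_not_imp_left, not_le]
  intro hgt
  have hm2 : √2 < m := by nlinarith [one_lt_sqrt_119_div]
  have hmpos : 0 < m := hs.trans hm2
  let f : heckeOrbit → ℝ := fun v => binForm a b c v
  have hfin : ∀ m', m < m' → ∀ᶠ v in Filter.cofinite, D < m' * |f v| := by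
    intro m' hm'
    have := Filter.eventually_lt_of_limsup_lt (b := ENNReal.ofReal m')
      (hlim.trans_lt ((ENNReal.ofReal_lt_ofReal_iff (by linarith)).2 hm'))
    exact this.mono fun v hv => (ofReal_div_ofReal_lt_iff hDpos (abs_nonneg _)).1 hv
  have hfreq : ∀ m', 0 ≤ m' → m' < m → ∃ᶠ v in Filter.cofinite, m' * |f v| < D := by
    intro m' h0 hm'
    have := Filter.frequently_lt_of_lt_limsup (b := ENNReal.ofReal m') (by isBoundedDefault)
      (((ENNReal.ofReal_lt_ofReal_iff (by linarith)).2 hm').trans_eq hlim.symm)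
    exact this.mono fun v hv => (lt_ofReal_div_ofReal_iff hDpos (abs_nonneg _) h0).1 hv
  -- The number `m` is a cluster value of the quotients. An ultrafilter replaces the choice of a
  -- subsequence, so the later limits need no further extraction.
  have hne : (Filter.cofinite ⊓ Filter.comap (fun v => D / |f v|) (nhds m)).NeBot := by
    rw [Filter.inf_neBot_iff]
    rintro s hs' t ⟨t', ht', htt'⟩
    obtain ⟨ε, hε, hball⟩ := Metric.mem_nhds_iff.1 ht'
    have h1 := hfreq (max 0 (m - ε)) (le_max_left _ _) (max_lt hmpos (by linarith))
    obtain ⟨v, ⟨hv1, hv2⟩, hv3⟩ := ((h1.and_eventually (hfin (m + ε) (by linarith))).and_eventually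
      hs').exists
    refine ⟨v, hv3, htt' (hball ?_)⟩
    have hpos : 0 < |f v| := by
      rcases (abs_nonneg (f v)).eq_or_lt with h0 | h0
      · rw [← h0] at hv2; simp at hv2; linarith
      · exact h0
    rw [Metric.mem_ball, Real.dist_eq, abs_lt]
    have e1 : D / |f v| < m + ε := by rw [div_lt_iff₀ hpos]; exact hv2
    have e2 : max 0 (m - ε) < D / |f v| := by rw [lt_div_iff₀ hpos]; exact hv1
    have := le_max_right 0 (m - ε)
    constructor <;> linarith
  set U := Ultrafilter.of (Filter.cofinite ⊓ Filter.comap (fun v => D / |f v|) (nhds m)) with hU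
  have hUle : (U : Filter heckeOrbit) ≤ Filter.cofinite :=
    (Ultrafilter.of_le _).trans inf_le_left
  have hUlim : Filter.Tendsto (fun v => D / |f v|) U (nhds m) :=
    Filter.tendsto_iff_comap.2 ((Ultrafilter.of_le _).trans inf_le_right)
  -- The values `1, 0, 0` are placeholders at cusps with no crossing to offer; those are negligible
  -- for the ultrafilter.
  have hcross : ∀ v : heckeOrbit, ∃ M' : SL(2, ℝ), ∃ P Q : ℝ, f v ≠ 0 → √2 * |f v| < D →
      M' ∈ heckeGroup 4 ∧ firstColumn M' = v ∧ 0 < P ∧ 0 < Q ∧ D = |f v| * (√2 * (P + Q)) ∧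
      ∀ x y, formAt a b c M' x y = f v * ((x - √2 * Q * y) * (x + √2 * P * y)) := by
    rintro ⟨v, M, hM, rfl⟩
    by_cases h0 : binForm a b c (firstColumn M) = 0
    · exact ⟨1, 0, 0, fun h => absurd h0 h⟩
    by_cases h1 : √2 * |binForm a b c (firstColumn M)| < D
    · obtain ⟨M', hM', e, P, Q, hP, hQ, hPQ, hf⟩ := exists_crossing hM h0 hδ h1
      exact ⟨M', P, Q, fun _ _ => ⟨hM', e, hP, hQ, hPQ, hf⟩⟩
    · exact ⟨1, 0, 0, fun _ h => absurd h h1⟩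
  choose M' P Q hcross using hcross
  have hev : ∀ᶠ v in (U : Filter heckeOrbit), f v ≠ 0 ∧ √2 * |f v| < D ∧ √2 * (P v + Q v) < m + 1 := by
    have h1 := hUle (hfin (m + 1) (by linarith))
    have h2 := hUlim.eventually (lt_mem_nhds hm2)
    have h3 := hUlim.eventually (gt_mem_nhds (lt_add_one m))
    filter_upwards [h1, h2, h3] with v hv1 hv2 hv3
    have h0 : f v ≠ 0 := by
      intro h0
      simp only [h0, abs_zero, mul_zero] at hv1
      linarith
    have hpos := abs_pos.2 h0
    have h4 : √2 * |f v| < D := by rwa [lt_div_iff₀ hpos] at hv2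
    refine ⟨h0, h4, ?_⟩
    obtain ⟨-, -, -, -, hPQ, -⟩ := hcross v h0 h4
    rw [hPQ, mul_div_cancel_left₀ _ hpos.ne'] at hv3
    exact hv3
  have hbd : ∀ᶠ v in (U : Filter heckeOrbit), P v ∈ Set.Icc 0 (m + 1) ∧ Q v ∈ Set.Icc 0 (m + 1) := by
    filter_upwards [hev] with v ⟨h0, h1, h2⟩
    obtain ⟨-, -, hP, hQ, -, -⟩ := hcross v h0 h1
    have : 1 ≤ √2 := Real.one_le_sqrt.2 (by norm_num)
    refine ⟨⟨hP.le, ?_⟩, hQ.le, ?_⟩ <;> nlinarith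
  obtain ⟨P', hP'mem, hP'⟩ := (isCompact_Icc (a := (0 : ℝ)) (b := m + 1)).ultrafilter_le_nhds (U.map P)
    (Filter.le_principal_iff.2 (hbd.mono fun v hv => hv.1))
  obtain ⟨Q', hQ'mem, hQ'⟩ := (isCompact_Icc (a := (0 : ℝ)) (b := m + 1)).ultrafilter_le_nhds (U.map Q)
    (Filter.le_principal_iff.2 (hbd.mono fun v hv => hv.2))
  have hP'' : Filter.Tendsto P U (nhds P') := hP'
  have hQ'' : Filter.Tendsto Q U (nhds Q') := hQ'
  have hsum : √2 * (P' + Q') = m := by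
    refine tendsto_nhds_unique ((hP''.add hQ'').const_mul √2) (hUlim.congr' ?_)
    filter_upwards [hev] with v ⟨h0, h1, _⟩
    obtain ⟨-, -, -, -, hPQ, -⟩ := hcross v h0 h1
    rw [hPQ, mul_div_cancel_left₀ _ (abs_pos.2 h0).ne']
  have hgood : IsGood (m / √2) P' Q' := by
    intro x y hxy
    have key : ∀ m', m < m' → √2 * (P' + Q') ≤ m' * |(x - √2 * Q' * y) * (x + √2 * P' * y)| := by
      intro m' hm'
      have hlim1 : Filter.Tendsto (fun v => √2 * (P v + Q v)) U (nhds (√2 * (P' + Q'))) :=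
        (hP''.add hQ'').const_mul √2
      have hlim2 : Filter.Tendsto (fun v => m' * |(x - √2 * Q v * y) * (x + √2 * P v * y)|) U
          (nhds (m' * |(x - √2 * Q' * y) * (x + √2 * P' * y)|)) := by
        refine Filter.Tendsto.const_mul _ (Filter.Tendsto.abs (Filter.Tendsto.mul ?_ ?_))
        · exact tendsto_const_nhds.sub ((hQ''.const_mul _).mul_const _)
        · exact tendsto_const_nhds.add ((hP''.const_mul _).mul_const _)
      refine le_of_tendsto_of_tendsto hlim1 hlim2 ?_
      -- For fixed `(x, y)` the vector `M' v (x, y)` meets a given `w` for only finitely many `v`.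
      -- If `y = 0` then `v = w / x`; otherwise `v` lies on the line `det (v, w) = y` with form
      -- value bounded by `D`.
      have hbad : ∀ w : heckeOrbit, ∀ᶠ v in (U : Filter heckeOrbit),
          f v ≠ 0 → √2 * |f v| < D →
          (w : Fin 2 → ℝ) ≠ ![(M' v).1 0 0 * x + (M' v).1 0 1 * y,
            (M' v).1 1 0 * x + (M' v).1 1 1 * y] := by
        intro w
        refine hUle (Filter.eventually_cofinite.2 ?_)
        have hcol : ∀ v : heckeOrbit, firstColumn (M' v) = v →
            (v : Fin 2 → ℝ) 0 = (M' v).1 0 0 ∧ (v : Fin 2 → ℝ) 1 = (M' v).1 1 0 := by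
          intro v hv
          rw [← hv, firstColumn_eq]; simp
        by_cases hy : y = 0
        · have hx : x ≠ 0 := by
            rintro rfl; rw [hy] at hxy; exact zero_notMem_heckeOrbit hxy
          refine Set.Subsingleton.finite ?_
          have : ∀ v : heckeOrbit, ¬(f v ≠ 0 → √2 * |f v| < D →
              (w : Fin 2 → ℝ) ≠ ![(M' v).1 0 0 * x + (M' v).1 0 1 * y,
                (M' v).1 1 0 * x + (M' v).1 1 1 * y]) →
              (v : Fin 2 → ℝ) 0 = (w : Fin 2 → ℝ) 0 / x ∧ (v : Fin 2 → ℝ) 1 = (w : Fin 2 → ℝ) 1 / x := by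
            intro v hv
            push Not at hv
            obtain ⟨h0, h1, e⟩ := hv
            obtain ⟨-, hc, -⟩ := hcross v h0 h1
            obtain ⟨c0, c1⟩ := hcol v hc
            rw [e, c0, c1, hy]
            constructor <;> simp [hx]
          intro v hv v' hv'
          obtain ⟨a0, a1⟩ := this v hv
          obtain ⟨b0, b1⟩ := this v' hv'
          ext i; fin_cases i
          · exact a0.trans b0.symm
          · exact a1.trans b1.symm
        · refine Set.Finite.subset (Set.Finite.preimage Subtype.val_injective.injOn
            (heckeOrbit_line_finite hδ (u₀ := (w : Fin 2 → ℝ) 0) (u₁ := (w : Fin 2 → ℝ) 1) hy D)) ?_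
          intro v hv
          have hv : ¬(f v ≠ 0 → √2 * |f v| < D →
              (w : Fin 2 → ℝ) ≠ ![(M' v).1 0 0 * x + (M' v).1 0 1 * y,
                (M' v).1 1 0 * x + (M' v).1 1 1 * y]) := hv
          push Not at hv
          obtain ⟨h0, h1, e⟩ := hv
          obtain ⟨-, hc, -⟩ := hcross v h0 h1
          obtain ⟨c0, c1⟩ := hcol v hc
          refine ⟨v.2, ?_, ?_⟩
          · rw [e, c0, c1]
            simp only [Matrix.cons_val_zero, Matrix.cons_val_one, Matrix.cons_val_fin_one]
            linear_combination y * det_eq_one (M' v)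
          · have : 1 ≤ √2 := Real.one_le_sqrt.2 (by norm_num)
            change |f v| ≤ D
            nlinarith [abs_nonneg (f v)]
      have hB : {w : heckeOrbit | ¬ D < m' * |f w|}.Finite := Filter.eventually_cofinite.1 (hfin m' hm')
      have hall : ∀ᶠ v in (U : Filter heckeOrbit), ∀ w ∈ {w : heckeOrbit | ¬ D < m' * |f w|},
          f v ≠ 0 → √2 * |f v| < D →
          (w : Fin 2 → ℝ) ≠ ![(M' v).1 0 0 * x + (M' v).1 0 1 * y,
            (M' v).1 1 0 * x + (M' v).1 1 1 * y] :=
        (Filter.eventually_all_finite hB).2 fun w _ => hbad w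
      filter_upwards [hall, hev] with v hv ⟨h0, h1, _⟩
      obtain ⟨hM', -, -, -, hPQ, hform⟩ := hcross v h0 h1
      obtain ⟨N, hN, e, e'⟩ := formAt_mem a b c hM' hxy
      have hw : D < m' * |f ⟨firstColumn N, firstColumn_mem hN⟩| := by
        by_contra hcon
        exact hv _ hcon h0 h1 e'
      have hval : f ⟨firstColumn N, firstColumn_mem hN⟩ =
          f v * ((x - √2 * Q v * y) * (x + √2 * P v * y)) := by
        rw [← hform]; exact e.symm
      rw [hval, abs_mul] at hw
      refine le_of_mul_le_mul_left (a := |f v|) ?_ (abs_pos.2 h0)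
      rw [← hPQ]; linarith
    have hle : √2 * (P' + Q') ≤ m * |(x - √2 * Q' * y) * (x + √2 * P' * y)| := by
      set z := |(x - √2 * Q' * y) * (x + √2 * P' * y)|
      have hcont : Filter.Tendsto (fun r : ℝ => r * z) (nhdsWithin m (Set.Ioi m)) (nhds (m * z)) :=
        ((continuous_id.mul continuous_const).tendsto m).mono_left nhdsWithin_le_nhds
      exact ge_of_tendsto hcont (Filter.eventually_of_mem self_mem_nhdsWithin fun r hr => key r hr)
    rw [div_mul_eq_mul_div, le_div_iff₀ hs]
    linarith
  -- The limits could a priori be `0`, but then the limit form would vanish at the cusp `(0, 1)`,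
  -- against goodness.
  have hprod := hgood 0 1 zero_one_mem_heckeOrbit
  rw [show (0 - √2 * Q' * 1) * (0 + √2 * P' * 1) = -((√2 * √2) * (P' * Q')) by ring,
    sqrt_two_mul_self, abs_neg, abs_of_nonneg (mul_nonneg two_pos.le
      (mul_nonneg hP'mem.1 hQ'mem.1))] at hprod
  have hsumpos : 0 < P' + Q' := by
    by_contra! h
    nlinarith
  have hPpos : 0 < P' := by
    rcases hP'mem.1.eq_or_lt with h | h
    · rw [← h] at hprod hsumpos; simp at hprod hsumpos; linarith
    · exact h
  have hQpos : 0 < Q' := by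
    rcases hQ'mem.1.eq_or_lt with h | h
    · rw [← h] at hprod hsumpos; simp at hprod hsumpos; linarith
    · exact h
  rcases hgood.gap hPpos hQpos (by rw [div_lt_iff₀ hs]; linarith) with h | h
  · exfalso
    have : √2 * (P' + Q') ≤ √2 * (√119 / 5) := by gcongr
    linarith
  · rw [← hsum, h]

/-! ### Descent of edges along an expansion -/

/-- Edges of the tessellation do not cross: since the determinant is `±1`, an edge in the closed
quadrant other than the base edge lies within one of the three cones onto which the moves map the
quadrant. -/
lemma cone_cases {x y x' y' : ℤ} (hx : 0 ≤ x) (hy : 0 ≤ y) (hx' : 0 ≤ x') (hy' : 0 ≤ y')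
    (hdet : x * y' - 2 * (x' * y) = 1 ∨ x * y' - 2 * (x' * y) = -1) (hbase : ¬(y = 0 ∧ x' = 0)) :
    (2 * y ≤ x ∧ y' ≤ x') ∨ (x ≤ y ∧ 2 * x' ≤ y') ∨ (y ≤ x ∧ x ≤ 2 * y ∧ x' ≤ y' ∧ y' ≤ 2 * x') := by
  have hy1 : 1 ≤ y' := by
    rcases hy'.eq_or_lt with h | h
    · rw [← h] at hdet; omega
    · exact h
  have hd1 : x * y' ≤ 1 + 2 * (x' * y) := by omega
  have hd2 : 2 * (x' * y) ≤ 1 + x * y' := by omega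
  rcases lt_trichotomy x (2 * y) with h | h | h
  · have hypos : 1 ≤ y := by omega
    rcases lt_trichotomy x y with h1 | h1 | h1
    · right; left
      refine ⟨h1.le, ?_⟩
      by_contra! hc
      have a1 : x * y' ≤ (y - 1) * y' := by gcongr; omega
      have a2 : y * (2 * x' - y') ≥ y * 1 := by gcongr; omega
      nlinarith
    · subst h1
      by_cases hc : 2 * x' ≤ y'
      · exact Or.inr (Or.inl ⟨le_rfl, hc⟩)
      · right; right
        have a2 : x * (2 * x' - y') ≥ 1 * (2 * x' - y') := by gcongr; omega
        refine ⟨le_rfl, by omega, ?_, by omega⟩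
        have : 2 * x' - y' ≤ 1 := by nlinarith
        omega
    · right; right
      refine ⟨h1.le, h.le, ?_, ?_⟩
      · by_contra! hc
        have a1 : x * y' ≤ (2 * y - 1) * y' := by gcongr; omega
        have a2 : y * (x' - y') ≥ y * 1 := by gcongr; omega
        nlinarith
      · by_contra! hc
        have a1 : (y + 1) * y' ≤ x * y' := by gcongr; omega
        have a2 : y * (y' - 2 * x') ≥ y * 1 := by gcongr; omega
        nlinarith
  · exfalso
    have : x * y' = 2 * (y * y') := by rw [h]; ring
    omega
  · left
    refine ⟨h.le, ?_⟩
    by_contra! hc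
    have a1 : (2 * y + 1) * y' ≤ x * y' := by gcongr; omega
    have a2 : y * 1 ≤ y * (y' - x') := by gcongr; omega
    have : 2 * y + y' ≤ 1 := by nlinarith
    exact hbase ⟨by omega, by omega⟩

/-- The linear maps whose projective actions are the branches, in the coordinate `x / (√2 y)`. -/
noncomputable def RomikDigit.move : RomikDigit → ℝ × ℝ → ℝ × ℝ
  | one, v => (v.1, v.2 + √2 * v.1)
  | two, v => (v.1 + √2 * v.2, √2 * v.1 + v.2)
  | three, v => (v.1 + √2 * v.2, v.2)

/-- The composition of the moves of the first `n` digits. -/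
noncomputable def pathMove : (ℕ → RomikDigit) → ℕ → ℝ × ℝ → ℝ × ℝ
  | _, 0, v => v
  | d, n + 1, v => (d 0).move (pathMove (fun k => d (k + 1)) n v)

lemma mem_heckeOrbit_move (d : RomikDigit) {v : ℝ × ℝ} (h : ![v.1, v.2] ∈ heckeOrbit) :
    ![(d.move v).1, (d.move v).2] ∈ heckeOrbit := by
  cases d with
  | one => exact heckeOrbit_add' h
  | two => exact heckeOrbit_two h
  | three => exact heckeOrbit_add h

lemma mem_heckeOrbit_pathMove (n : ℕ) : ∀ (d : ℕ → RomikDigit) {v : ℝ × ℝ},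
    ![v.1, v.2] ∈ heckeOrbit → ![(pathMove d n v).1, (pathMove d n v).2] ∈ heckeOrbit := by
  induction n with
  | zero => exact fun d v h => h
  | succ n ih => exact fun d v h => mem_heckeOrbit_move _ (ih _ h)

/-- This is the Euclidean algorithm: removing a digit replaces `(x, y)` by a positive pair of
smaller sum satisfying the same relation for the next tail, which cannot continue forever. -/
lemma IsExpansion.irrational_aux (N : ℕ) : ∀ {d : ℕ → RomikDigit} {q : ℕ → ℝ}, IsExpansion d q →
    ∀ x y : ℤ, 0 < x → 0 < y → x + y ≤ N → (x : ℝ) ≠ 2 * q 0 * y := by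
  induction N with
  | zero => intro d q _ x y hx hy h; push_cast at h; omega
  | succ N ih =>
    intro d q h x y hx hy hN e
    have hxR : (0 : ℝ) < x := by exact_mod_cast hx
    have hyR : (0 : ℝ) < y := by exact_mod_cast hy
    have h1 := ih (h.shift 1)
    simp only [zero_add] at h1
    have hq1 := h.pos 1
    have hq0 := h.eq 0
    rw [zero_add] at hq0
    push_cast at hN
    cases hd : d 0 with
    | one =>
      rw [hd] at hq0; simp only [branch] at hq0
      rw [hq0] at e
      have e' : (x : ℝ) = 2 * q 1 * ((y - x : ℤ) : ℝ) := by
        push_cast; field_simp at e; linarith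
      have : (0 : ℝ) < ((y - x : ℤ) : ℝ) := by
        by_contra! hc
        have := mul_nonneg hq1.le (neg_nonneg.2 hc)
        linarith
      exact h1 x (y - x) hx (by exact_mod_cast this) (by omega) e'
    | two =>
      rw [hd] at hq0
      have hlt := branch_two_lt hq1
      have hgt := lt_branch_two hq1
      rw [← hq0] at hlt hgt
      have a1 : y < x := by
        have : (y : ℝ) < x := by rw [e]; nlinarith
        exact_mod_cast this
      have a2 : x < 2 * y := by
        have : (x : ℝ) < 2 * y := by rw [e]; nlinarith
        exact_mod_cast this
      simp only [branch] at hq0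
      rw [hq0] at e
      have e' : ((2 * y - x : ℤ) : ℝ) = 2 * q 1 * ((x - y : ℤ) : ℝ) := by
        push_cast; field_simp at e; linarith
      exact h1 _ _ (by omega) (by omega) (by omega) e'
    | three =>
      rw [hd] at hq0; simp only [branch] at hq0
      rw [hq0] at e
      have e' : ((x - 2 * y : ℤ) : ℝ) = 2 * q 1 * y := by
        push_cast; linarith
      have : (0 : ℝ) < ((x - 2 * y : ℤ) : ℝ) := by rw [e']; positivity
      exact h1 _ y (by exact_mod_cast this) hy (by omega) e'

/-- A point with an infinite expansion is not a cusp. -/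
lemma IsExpansion.ne_cusp {d : ℕ → RomikDigit} {q : ℕ → ℝ} (h : IsExpansion d q) {x y : ℤ}
    (e : (x : ℝ) = 2 * q 0 * y) : x = 0 ∧ y = 0 := by
  have hq := h.pos 0
  rcases lt_trichotomy y 0 with hy | hy | hy
  · exfalso
    have hyR : (y : ℝ) < 0 := by exact_mod_cast hy
    have hx : x < 0 := by
      have : (x : ℝ) < 0 := by rw [e]; nlinarith
      exact_mod_cast this
    refine IsExpansion.irrational_aux (-x + -y).toNat h (-x) (-y) (by omega) (by omega) (by omega) ?_
    push_cast; linarith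
  · subst hy
    simp at e
    exact ⟨e, rfl⟩
  · exfalso
    have hyR : (0 : ℝ) < y := by exact_mod_cast hy
    have hx : 0 < x := by
      have : (0 : ℝ) < x := by rw [e]; positivity
      exact_mod_cast this
    exact IsExpansion.irrational_aux (x + y).toNat h x y hx hy (by omega) e

/-- Every edge of the tessellation that separates the point from the negative axis is an image of
the edge `0, ∞` along the expansion. -/
lemma IsExpansion.edge_descent (N : ℕ) : ∀ {d : ℕ → RomikDigit} {q : ℕ → ℝ}, IsExpansion d q →
    ∀ x y x' y' : ℤ, 0 ≤ x → 0 ≤ y → 0 ≤ x' → 0 ≤ y' → x + y + x' + y' ≤ N →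
    (x * y' - 2 * (x' * y) = 1 ∨ x * y' - 2 * (x' * y) = -1) →
    ((x : ℝ) - 2 * q 0 * y) * (x' - q 0 * y') < 0 →
    ∃ n, (((x : ℝ), √2 * (y : ℝ)) = pathMove d n (1, 0) ∨
        ((x : ℝ), √2 * (y : ℝ)) = pathMove d n (0, 1)) ∧
      ((√2 * (x' : ℝ), (y' : ℝ)) = pathMove d n (1, 0) ∨
        (√2 * (x' : ℝ), (y' : ℝ)) = pathMove d n (0, 1)) := by
  induction N with
  | zero =>
    intro d q _ x y x' y' hx hy hx' hy' hN hdet _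
    obtain ⟨rfl, rfl, rfl, rfl⟩ : x = 0 ∧ y = 0 ∧ x' = 0 ∧ y' = 0 := by
      push_cast at hN; omega
    simp at hdet
  | succ N ih =>
    intro d q h x y x' y' hx hy hx' hy' hN hdet hlt
    have h2 := sqrt_two_mul_self
    by_cases hbase : y = 0 ∧ x' = 0
    · obtain ⟨rfl, rfl⟩ := hbase
      have hxy : x * y' = 1 := by
        have := mul_nonneg hx hy'
        omega
      have hx1 : x = 1 := Int.eq_one_of_mul_eq_one_right hx hxy
      have hy1 : y' = 1 := Int.eq_one_of_mul_eq_one_left hy' hxy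
      subst hx1 hy1
      exact ⟨0, Or.inl (by simp [pathMove]), Or.inr (by simp [pathMove])⟩
    have h1 := ih (h.shift 1)
    simp only [zero_add] at h1
    have hq1 := h.pos 1
    have hq0pos := h.pos 0
    have hq0 := h.eq 0
    rw [zero_add] at hq0
    push_cast at hN
    have hxR : (0 : ℝ) ≤ x := by exact_mod_cast hx
    have hyR : (0 : ℝ) ≤ y := by exact_mod_cast hy
    have hxR' : (0 : ℝ) ≤ x' := by exact_mod_cast hx'
    have hyR' : (0 : ℝ) ≤ y' := by exact_mod_cast hy'
    have hne1 : ¬(y = 0 ∧ y' = 0) := by rintro ⟨rfl, rfl⟩; simp at hdet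
    have hne2 : ¬(x = 0 ∧ x' = 0) := by rintro ⟨rfl, rfl⟩; simp at hdet
    have hne3 : ¬(x = 0 ∧ y' = 0) := by rintro ⟨rfl, rfl⟩; simp at hdet; omega
    have hnn : ∀ a b : ℝ, 0 ≤ a → 0 ≤ b → ¬a * b < 0 := fun a b ha hb => (mul_nonneg ha hb).not_gt
    have hpp : ∀ a b : ℝ, a ≤ 0 → b ≤ 0 → ¬a * b < 0 := fun a b ha hb =>
      (mul_nonneg_of_nonpos_of_nonpos ha hb).not_gt
    have hpush : ∀ v w : ℝ × ℝ, w = (d 0).move v →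
        ∀ n e, v = pathMove (fun k => d (k + 1)) n e → w = pathMove d (n + 1) e := by
      intro v w hw n e hv
      rw [hw, hv]; rfl
    -- The cone of the edge has to be that of the first digit; otherwise `q 0` lies to one side of
    -- both ends and the product in `hlt` is not negative. Undoing the move decreases the sum of the
    -- entries. The move of `2` reverses orientation, which is why both signs of the determinant are
    -- allowed.
    rcases cone_cases hx hy hx' hy' hdet hbase with ⟨c1, c2⟩ | ⟨c1, c2⟩ | ⟨c1, c2, c3, c4⟩
    · have c1R : (2 * y : ℝ) ≤ x := by exact_mod_cast c1
      have c2R : (y' : ℝ) ≤ x' := by exact_mod_cast c2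
      have hd : d 0 = three := by
        by_contra hd
        have := h.lt_one hd
        exact hnn _ _ (by nlinarith) (by nlinarith) hlt
      rw [hd] at hq0; simp only [branch] at hq0
      obtain ⟨n, hA, hB⟩ := h1 (x - 2 * y) y (x' - y') y' (by omega) hy (by omega) hy' (by omega)
        (by rw [show (x - 2 * y) * y' - 2 * ((x' - y') * y) = x * y' - 2 * (x' * y) by ring]
            exact hdet)
        (by push_cast
            rw [show (x : ℝ) - 2 * y - 2 * q 1 * y = x - 2 * q 0 * y by rw [hq0]; ring,
              show (x' : ℝ) - y' - q 1 * y' = x' - q 0 * y' by rw [hq0]; ring]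
            exact hlt)
      refine ⟨n + 1, hA.imp (hpush _ _ ?_ n _) (hpush _ _ ?_ n _),
        hB.imp (hpush _ _ ?_ n _) (hpush _ _ ?_ n _)⟩
      all_goals
        rw [hd]
        refine Prod.ext ?_ ?_ <;> simp only [move] <;> push_cast <;>
          first | ring1 | linear_combination (-y : ℝ) * h2
    · have c1R : (x : ℝ) ≤ y := by exact_mod_cast c1
      have c2R : (2 * x' : ℝ) ≤ y' := by exact_mod_cast c2
      have hd : d 0 = one := by
        by_contra hd
        have := h.half_lt hd
        exact hpp _ _ (by nlinarith) (by nlinarith) hlt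
      rw [hd] at hq0; simp only [branch] at hq0
      have hk : 0 < 2 * q 1 + 1 := by linarith
      have hk' : q 0 * (2 * q 1 + 1) = q 1 := by rw [hq0, div_mul_cancel₀ _ hk.ne']
      obtain ⟨n, hA, hB⟩ := h1 x (y - x) x' (y' - 2 * x') hx (by omega) hx' (by omega) (by omega)
        (by rw [show x * (y' - 2 * x') - 2 * (x' * (y - x)) = x * y' - 2 * (x' * y) by ring]
            exact hdet)
        (by push_cast
            rw [show (x : ℝ) - 2 * q 1 * (y - x) = (2 * q 1 + 1) * (x - 2 * q 0 * y) by
                linear_combination (2 * y : ℝ) * hk',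
              show (x' : ℝ) - q 1 * (y' - 2 * x') = (2 * q 1 + 1) * (x' - q 0 * y') by
                linear_combination (y' : ℝ) * hk', mul_mul_mul_comm]
            exact mul_neg_of_pos_of_neg (mul_pos hk hk) hlt)
      refine ⟨n + 1, hA.imp (hpush _ _ ?_ n _) (hpush _ _ ?_ n _),
        hB.imp (hpush _ _ ?_ n _) (hpush _ _ ?_ n _)⟩
      all_goals
        rw [hd]
        refine Prod.ext ?_ ?_ <;> simp only [move] <;> push_cast <;>
          first | ring1 | linear_combination (-x' : ℝ) * h2
    · have c1R : (y : ℝ) ≤ x := by exact_mod_cast c1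
      have c2R : (x : ℝ) ≤ 2 * y := by exact_mod_cast c2
      have c3R : (x' : ℝ) ≤ y' := by exact_mod_cast c3
      have c4R : (y' : ℝ) ≤ 2 * x' := by exact_mod_cast c4
      have hd : d 0 = two := by
        cases hd : d 0 with
        | one =>
          have := h.lt_half hd
          exact absurd hlt (hnn _ _ (by nlinarith) (by nlinarith))
        | two => rfl
        | three =>
          have := h.one_lt hd
          exact absurd hlt (hpp _ _ (by nlinarith) (by nlinarith))
      rw [hd] at hq0; simp only [branch] at hq0
      have hk : 0 < 2 * q 1 + 1 := by linarith
      have hk' : q 0 * (2 * q 1 + 1) = q 1 + 1 := by rw [hq0, div_mul_cancel₀ _ hk.ne']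
      obtain ⟨n, hA, hB⟩ := h1 (2 * y - x) (x - y) (y' - x') (2 * x' - y') (by omega) (by omega)
        (by omega) (by omega) (by omega)
        (by rw [show (2 * y - x) * (2 * x' - y') - 2 * ((y' - x') * (x - y)) =
              -(x * y' - 2 * (x' * y)) by ring]
            omega)
        (by push_cast
            rw [show 2 * (y : ℝ) - x - 2 * q 1 * (x - y) = -((2 * q 1 + 1) * (x - 2 * q 0 * y)) by
                linear_combination (-2 * y : ℝ) * hk',
              show (y' : ℝ) - x' - q 1 * (2 * x' - y') = -((2 * q 1 + 1) * (x' - q 0 * y')) by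
                linear_combination (-y' : ℝ) * hk', neg_mul_neg, mul_mul_mul_comm]
            exact mul_neg_of_pos_of_neg (mul_pos hk hk) hlt)
      refine ⟨n + 1, hA.imp (hpush _ _ ?_ n _) (hpush _ _ ?_ n _),
        hB.imp (hpush _ _ ?_ n _) (hpush _ _ ?_ n _)⟩
      all_goals
        rw [hd]
        refine Prod.ext ?_ ?_ <;> simp only [move] <;> push_cast <;>
          first
          | ring1
          | linear_combination (-(x - y) : ℝ) * h2
          | linear_combination (-(y' - x') : ℝ) * h2

/-! ### Values of a form at the ends of the crossed edges -/

/-- The form with roots `√2 Q` and `-√2 P`. -/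
noncomputable def crossForm (P Q : ℝ) (v : ℝ × ℝ) : ℝ :=
  (v.1 - √2 * Q * v.2) * (v.1 + √2 * P * v.2)

lemma crossForm_one_zero (P Q : ℝ) : crossForm P Q (1, 0) = 1 := by simp [crossForm]

lemma crossForm_zero_one (P Q : ℝ) : crossForm P Q (0, 1) = -(2 * P * Q) := by
  simp only [crossForm]
  linear_combination (-P * Q) * sqrt_two_mul_self

/-- The quotient of `crossForm` by the sum of the two coordinates is, up to sign, invariant under
the change of basis: the form and the square root of its discriminant scale by the same factor. -/
lemma crossForm_move (d : RomikDigit) {P Q : ℝ} (hP : 0 < P) (hQ : 0 < Q) (v : ℝ × ℝ) :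
    |crossForm P (d.branch Q) (d.move v)| * (d.branch P + Q) =
      |crossForm (d.branch P) Q v| * (P + d.branch Q) := by
  have h2 := sqrt_two_mul_self
  have hP' : 0 < 2 * P + 1 := by linarith
  have hQ' : 0 < 2 * Q + 1 := by linarith
  have scaled : ∀ {a b s s' k : ℝ}, 0 < k → |a| = k * |b| → k * s = s' → |a| * s = |b| * s' := by
    intro a b s s' k hk ha hs
    rw [ha, ← hs]; ring
  cases d with
  | one =>
    have eP : (2 * P + 1) * one.branch P = P := by simp only [branch]; field_simp
    have eQ : (2 * Q + 1) * one.branch Q = Q := by simp only [branch]; field_simp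
    refine scaled (k := (2 * P + 1) / (2 * Q + 1)) (by positivity) ?_ ?_
    · rw [← abs_of_pos (show 0 < (2 * P + 1) / (2 * Q + 1) by positivity), ← abs_mul]
      congr 1
      rw [div_mul_eq_mul_div, eq_div_iff hQ'.ne']
      have e1 : (2 * Q + 1) * (v.1 - √2 * one.branch Q * (v.2 + √2 * v.1)) = v.1 - √2 * Q * v.2 := by
        linear_combination (-(√2 * (v.2 + √2 * v.1))) * eQ - Q * v.1 * h2
      have e2 : v.1 + √2 * P * (v.2 + √2 * v.1) =
          (2 * P + 1) * (v.1 + √2 * one.branch P * v.2) := by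
        linear_combination (P * v.1) * h2 - √2 * v.2 * eP
      simp only [crossForm, move]
      rw [e2]
      linear_combination ((2 * P + 1) * (v.1 + √2 * one.branch P * v.2)) * e1
    · rw [div_mul_eq_mul_div, div_eq_iff hQ'.ne']
      linear_combination eP - eQ
  | two =>
    have eP : (2 * P + 1) * two.branch P = P + 1 := by simp only [branch]; field_simp
    have eQ : (2 * Q + 1) * two.branch Q = Q + 1 := by simp only [branch]; field_simp
    refine scaled (k := (2 * P + 1) / (2 * Q + 1)) (by positivity) ?_ ?_
    · rw [← abs_of_pos (show 0 < (2 * P + 1) / (2 * Q + 1) by positivity), ← abs_mul,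
        ← abs_neg]
      congr 1
      rw [div_mul_eq_mul_div, eq_div_iff hQ'.ne']
      have e1 : (2 * Q + 1) * (v.1 + √2 * v.2 - √2 * two.branch Q * (√2 * v.1 + v.2)) =
          -(v.1 - √2 * Q * v.2) := by
        linear_combination (-(√2 * (√2 * v.1 + v.2))) * eQ - (Q + 1) * v.1 * h2
      have e2 : v.1 + √2 * v.2 + √2 * P * (√2 * v.1 + v.2) =
          (2 * P + 1) * (v.1 + √2 * two.branch P * v.2) := by
        linear_combination (P * v.1) * h2 - √2 * v.2 * eP
      simp only [crossForm, move]
      rw [e2]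
      linear_combination (-(2 * P + 1) * (v.1 + √2 * two.branch P * v.2)) * e1
    · rw [div_mul_eq_mul_div, div_eq_iff hQ'.ne']
      linear_combination eP - eQ
  | three =>
    refine scaled (k := 1) one_pos ?_ (by simp only [branch]; ring)
    rw [one_mul]
    congr 1
    simp only [crossForm, move, branch]; ring

namespace IsGeodesic

variable {t : ℤ → RomikDigit} {p q : ℤ → ℝ}

lemma crossForm_pathMove (n : ℕ) : ∀ {t : ℤ → RomikDigit} {p q : ℤ → ℝ}, IsGeodesic t p q →
    ∀ v, |crossForm (p 0) (q 0) (pathMove (fun k => t (1 + k)) n v)| * (p n + q n) =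
      |crossForm (p n) (q n) v| * (p 0 + q 0) := by
  induction n with
  | zero => intro t p q _ v; simp [pathMove]
  | succ n ih =>
    intro t p q h v
    have h1 := ih (h.shift 1) v
    have hp := h.p_eq 1
    have hq := h.q_eq 0
    simp only [sub_self, zero_add] at hp hq h1
    rw [show (fun k : ℕ => t (1 + k + 1)) = fun k : ℕ => t (1 + (k + 1 : ℕ)) by
      funext k; congr 1] at h1
    have h0 := crossForm_move (t 1) (h.p_pos 0) (h.q_pos 1)
      (pathMove (fun k => t (1 + (k + 1 : ℕ))) n v)
    rw [← hp, ← hq] at h0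
    have hpos : 0 < p 1 + q 1 := add_pos (h.p_pos 1) (h.q_pos 1)
    have hstep : pathMove (fun k => t (1 + k)) (n + 1) v =
        (t 1).move (pathMove (fun k => t (1 + (k + 1 : ℕ))) n v) := by
      simp [pathMove]
    rw [hstep]
    push_cast at h0 h1 ⊢
    refine mul_right_cancel₀ hpos.ne' ?_
    linear_combination (p (n + 1) + q (n + 1)) * h0 + (p 0 + q 0) * h1

lemma crossForm_pathMove_one_zero (h : IsGeodesic t p q) (n : ℕ) :
    |crossForm (p 0) (q 0) (pathMove (fun k => t (1 + k)) n (1, 0))| * (p n + q n) = p 0 + q 0 := by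
  rw [h.crossForm_pathMove, crossForm_one_zero, abs_one, one_mul]

lemma crossForm_pathMove_zero_one (h : IsGeodesic t p q) (n : ℕ) :
    |crossForm (p 0) (q 0) (pathMove (fun k => t (1 + k)) n (0, 1))| *
      (1 / (2 * p n) + 1 / (2 * q n)) = p 0 + q 0 := by
  have hp := h.p_pos n
  have hq := h.q_pos n
  have := h.crossForm_pathMove n (0, 1)
  rw [crossForm_zero_one, abs_neg, abs_of_pos (show 0 < 2 * p n * q n by positivity)] at this
  rw [div_add_div _ _ (by positivity) (by positivity), mul_div_assoc', div_eq_iff (by positivity)]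
  linear_combination 2 * this

end IsGeodesic

/-- The larger of the two values attached to a cut. -/
noncomputable def cutValue (p q : ℤ → ℝ) (n : ℤ) : ℝ :=
  max (p n + q n) (1 / (2 * p n) + 1 / (2 * q n))

/-- The four sign variants of the two ends of the `n`-th edge along a path. -/
def edgeEnds (d : ℕ → RomikDigit) (n : ℕ) : Set (Fin 2 → ℝ) :=
  {v | (|v 0|, |v 1|) = pathMove d n (1, 0) ∨ (|v 0|, |v 1|) = pathMove d n (0, 1)}

lemma finite_abs_eq (r : ℝ × ℝ) : {v : Fin 2 → ℝ | (|v 0|, |v 1|) = r}.Finite := by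
  have hf : (({r.1, -r.1} : Set ℝ) ×ˢ ({r.2, -r.2} : Set ℝ)).Finite :=
    (Set.toFinite _).prod (Set.toFinite _)
  refine (hf.image fun s => ![s.1, s.2]).subset ?_
  rintro v rfl
  refine ⟨(v 0, v 1), ⟨?_, ?_⟩, by ext i; fin_cases i <;> rfl⟩
  · rcases abs_choice (v 0) with h | h <;> simp [h]
  · rcases abs_choice (v 1) with h | h <;> simp [h]

lemma edgeEnds_finite (d : ℕ → RomikDigit) (n : ℕ) : (edgeEnds d n).Finite :=
  (finite_abs_eq _).union (finite_abs_eq _)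

lemma abs_crossForm_eq {P Q : ℝ} (x y : ℝ) (h : 0 ≤ x * y) :
    crossForm P Q (x, y) = crossForm P Q (|x|, |y|) := by
  have h1 : |x| * |y| = x * y := by rw [← abs_mul, abs_of_nonneg h]
  simp only [crossForm]
  linear_combination -sq_abs x + (√2 * √2) * (P * Q) * sq_abs y + (√2 * Q - √2 * P) * h1

/-- Reflecting a vector with coordinates of opposite signs into the first quadrant exchanges `P` and
`Q`. The left half of the sequence thus governs the cusps of the other two quadrants. -/
lemma abs_crossForm_eq' {P Q : ℝ} (x y : ℝ) (h : x * y ≤ 0) :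
    crossForm P Q (x, y) = crossForm Q P (|x|, |y|) := by
  have h1 : |x| * |y| = -(x * y) := by rw [← abs_mul, abs_of_nonpos h]
  simp only [crossForm]
  linear_combination -sq_abs x + (√2 * √2) * (P * Q) * sq_abs y + (√2 * P - √2 * Q) * h1

namespace IsGeodesic

variable {t : ℤ → RomikDigit} {p q : ℤ → ℝ}

/-- The geodesic traversed in the other direction, with the same base cut. -/
lemma reverse (h : IsGeodesic t p q) :
    IsGeodesic (fun n => t (-n + 1)) (fun n => q (-n)) (fun n => p (-n)) := by
  simpa using (h.shift 1).neg

lemma exists_edge_of_nonneg (h : IsGeodesic t p q) {x y x' y' : ℤ} (hx : 0 ≤ x) (hy : 0 ≤ y)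
    (hx' : 0 ≤ x') (hy' : 0 ≤ y')
    (hdet : x * y' - 2 * (x' * y) = 1 ∨ x * y' - 2 * (x' * y) = -1)
    (hlt : crossForm (p 0) (q 0) (x, √2 * y) * crossForm (p 0) (q 0) (√2 * x', y') < 0) :
    ∃ n, (((x : ℝ), √2 * (y : ℝ)) = pathMove (fun k => t (1 + k)) n (1, 0) ∨
        ((x : ℝ), √2 * (y : ℝ)) = pathMove (fun k => t (1 + k)) n (0, 1)) ∧
      ((√2 * (x' : ℝ), (y' : ℝ)) = pathMove (fun k => t (1 + k)) n (1, 0) ∨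
        (√2 * (x' : ℝ), (y' : ℝ)) = pathMove (fun k => t (1 + k)) n (0, 1)) := by
  have h2 := sqrt_two_mul_self
  have hxR : (0 : ℝ) ≤ x := by exact_mod_cast hx
  have hyR : (0 : ℝ) ≤ y := by exact_mod_cast hy
  have hxR' : (0 : ℝ) ≤ x' := by exact_mod_cast hx'
  have hyR' : (0 : ℝ) ≤ y' := by exact_mod_cast hy'
  have hp := h.p_pos 0
  have := (h.right 0).edge_descent (x + y + x' + y').toNat x y x' y' hx hy hx' hy' (by omega) hdet
  simp only [zero_add, Nat.cast_zero] at this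
  refine this ?_
  by_contra! hc
  have e : crossForm (p 0) (q 0) (x, √2 * y) * crossForm (p 0) (q 0) (√2 * x', y') =
      2 * (((x : ℝ) - 2 * q 0 * y) * (x' - q 0 * y')) *
        ((x + 2 * p 0 * y) * (x' + p 0 * y')) := by
    have e1 : (x : ℝ) - √2 * q 0 * (√2 * y) = x - 2 * q 0 * y := by
      linear_combination (-q 0 * y) * h2
    have e2 : (x : ℝ) + √2 * p 0 * (√2 * y) = x + 2 * p 0 * y := by
      linear_combination (p 0 * y) * h2
    simp only [crossForm]
    rw [e1, e2]
    linear_combination ((x : ℝ) - 2 * q 0 * y) * (x' - q 0 * y') *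
        ((x + 2 * p 0 * y) * (x' + p 0 * y')) * h2
  rw [e] at hlt
  have : 0 ≤ 2 * (((x : ℝ) - 2 * q 0 * y) * (x' - q 0 * y')) *
        ((x + 2 * p 0 * y) * (x' + p 0 * y')) := by positivity
  linarith

end IsGeodesic

lemma Int.mul_two_mul_nonneg {k l : ℤ} (h : k - 2 * l = 1 ∨ k - 2 * l = -1) : 0 ≤ k * l := by
  rcases lt_trichotomy l 0 with hl | hl | hl
  · exact mul_nonneg_of_nonpos_of_nonpos (by omega) hl.le
  · rw [hl, mul_zero]
  · exact mul_nonneg (by omega) hl.le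

lemma Int.abs_sub_two_mul_abs {k l : ℤ} (h : k - 2 * l = 1 ∨ k - 2 * l = -1) :
    |k| - 2 * |l| = 1 ∨ |k| - 2 * |l| = -1 := by
  rcases lt_trichotomy l 0 with hl | hl | hl
  · rw [abs_of_neg hl, abs_of_nonpos (show k ≤ 0 by omega)]; omega
  · rw [hl, mul_zero, sub_zero] at h
    rw [hl]
    rcases h with rfl | rfl <;> simp
  · rw [abs_of_pos hl, abs_of_nonneg (show 0 ≤ k by omega)]; omega

namespace IsGeodesic

variable {t : ℤ → RomikDigit} {p q : ℤ → ℝ}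

/-- An edge of the tessellation whose ends are separated by the geodesic is met along one of the
two halves of the digit sequence. -/
lemma exists_edge (h : IsGeodesic t p q) {x y x' y' : ℤ}
    (hdet : x * y' - 2 * (x' * y) = 1 ∨ x * y' - 2 * (x' * y) = -1)
    (hlt : crossForm (p 0) (q 0) (x, √2 * y) * crossForm (p 0) (q 0) (√2 * x', y') < 0) :
    (∃ n, ![(x : ℝ), √2 * y] ∈ edgeEnds (fun k => t (1 + k)) n ∧
      ![√2 * (x' : ℝ), y'] ∈ edgeEnds (fun k => t (1 + k)) n ∧
      0 ≤ (x : ℝ) * (√2 * y) ∧ 0 ≤ √2 * (x' : ℝ) * y') ∨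
    ∃ n, ![(x : ℝ), √2 * y] ∈ edgeEnds (fun k => t (-k)) n ∧
      ![√2 * (x' : ℝ), y'] ∈ edgeEnds (fun k => t (-k)) n ∧
      (x : ℝ) * (√2 * y) ≤ 0 ∧ √2 * (x' : ℝ) * y' ≤ 0 := by
  have hs : 0 < √2 := by positivity
  have hp := h.p_pos 0
  have hq := h.q_pos 0
  have hdet' : |x| * |y'| - 2 * (|x'| * |y|) = 1 ∨ |x| * |y'| - 2 * (|x'| * |y|) = -1 := by
    rw [← abs_mul, ← abs_mul]; exact Int.abs_sub_two_mul_abs hdet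
  have hA : (|(x : ℝ)|, |√2 * (y : ℝ)|) = (((|x| : ℤ) : ℝ), √2 * ((|y| : ℤ) : ℝ)) := by
    rw [abs_mul, abs_of_pos hs]; push_cast; rfl
  have hB : (|√2 * (x' : ℝ)|, |(y' : ℝ)|) = (√2 * ((|x'| : ℤ) : ℝ), ((|y'| : ℤ) : ℝ)) := by
    rw [abs_mul, abs_of_pos hs]; push_cast; rfl
  -- An edge has determinant `±1`, so its two ends, taken up to sign, lie in the same closed
  -- quadrant.
  have hsign : (0 ≤ (x : ℝ) * (√2 * y) ∧ 0 ≤ √2 * (x' : ℝ) * y') ∨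
      ((x : ℝ) * (√2 * y) ≤ 0 ∧ √2 * (x' : ℝ) * y' ≤ 0) := by
    have hk : (0 : ℝ) ≤ (x * y) * (x' * y') := by
      have := Int.mul_two_mul_nonneg hdet
      have e : x * y' * (x' * y) = (x * y) * (x' * y') := by ring
      rw [e] at this
      exact_mod_cast this
    have e1 : (x : ℝ) * (√2 * y) = √2 * (x * y) := by ring
    rw [e1, mul_assoc]
    by_cases hz : (x : ℝ) * y = 0
    · rw [hz, mul_zero]
      rcases le_total 0 ((x' : ℝ) * y') with h | h
      · exact Or.inl ⟨le_rfl, by positivity⟩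
      · exact Or.inr ⟨le_rfl, mul_nonpos_of_nonneg_of_nonpos hs.le h⟩
    · rcases lt_or_gt_of_ne hz with h | h
      · have : (x' : ℝ) * y' ≤ 0 := by
          by_contra! hc
          exact absurd hk (not_le.2 (mul_neg_of_neg_of_pos h hc))
        exact Or.inr ⟨mul_nonpos_of_nonneg_of_nonpos hs.le h.le,
          mul_nonpos_of_nonneg_of_nonpos hs.le this⟩
      · have : 0 ≤ (x' : ℝ) * y' := by
          by_contra! hc
          exact absurd hk (not_le.2 (mul_neg_of_pos_of_neg h hc))
        exact Or.inl ⟨by positivity, by positivity⟩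
  rcases hsign with ⟨s1, s2⟩ | ⟨s1, s2⟩
  · left
    rw [abs_crossForm_eq _ _ s1, abs_crossForm_eq _ _ s2, hA, hB] at hlt
    obtain ⟨n, a, b⟩ := h.exists_edge_of_nonneg (abs_nonneg x) (abs_nonneg y) (abs_nonneg x')
      (abs_nonneg y') hdet' hlt
    rw [← hA] at a
    rw [← hB] at b
    exact ⟨n, by simpa [edgeEnds] using a, by simpa [edgeEnds] using b, s1, s2⟩
  · right
    rw [abs_crossForm_eq' _ _ s1, abs_crossForm_eq' _ _ s2, hA, hB] at hlt
    obtain ⟨n, a, b⟩ := h.reverse.exists_edge_of_nonneg (abs_nonneg x) (abs_nonneg y)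
      (abs_nonneg x') (abs_nonneg y') hdet' (by simpa using hlt)
    have e : (fun k : ℕ => t (-(1 + (k : ℤ)) + 1)) = fun k : ℕ => t (-k) := by
      funext k; congr 1; ring
    rw [e, ← hA] at a
    rw [e, ← hB] at b
    exact ⟨n, by simpa [edgeEnds] using a, by simpa [edgeEnds] using b, s1, s2⟩

lemma le_of_mem_edgeEnds (h : IsGeodesic t p q) {n : ℕ} {v : Fin 2 → ℝ}
    (hv : v ∈ edgeEnds (fun k => t (1 + k)) n) :
    p 0 + q 0 ≤ |crossForm (p 0) (q 0) (|v 0|, |v 1|)| * cutValue p q n := by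
  rcases hv with e | e <;> rw [e]
  · rw [← h.crossForm_pathMove_one_zero n]
    gcongr
    exact le_max_left _ _
  · rw [← h.crossForm_pathMove_zero_one n]
    gcongr
    exact le_max_right _ _

lemma le_of_mem_edgeEnds_right (h : IsGeodesic t p q) {n : ℕ} {v : Fin 2 → ℝ}
    (hv : v ∈ edgeEnds (fun k => t (1 + k)) n) (hv0 : 0 ≤ v 0 * v 1) :
    p 0 + q 0 ≤ |crossForm (p 0) (q 0) (v 0, v 1)| * cutValue p q n := by
  rw [abs_crossForm_eq _ _ hv0]
  exact h.le_of_mem_edgeEnds hv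

lemma le_of_mem_edgeEnds_left (h : IsGeodesic t p q) {n : ℕ} {v : Fin 2 → ℝ}
    (hv : v ∈ edgeEnds (fun k => t (-k)) n) (hv0 : v 0 * v 1 ≤ 0) :
    p 0 + q 0 ≤ |crossForm (p 0) (q 0) (v 0, v 1)| * cutValue p q (-n) := by
  rw [abs_crossForm_eq' _ _ hv0]
  have e : (fun k : ℕ => t (-k)) = fun k : ℕ => t (-(1 + (k : ℤ)) + 1) := by
    funext k; congr 1; ring
  rw [e] at hv
  have := h.reverse.le_of_mem_edgeEnds hv
  simp only [cutValue, neg_zero] at this ⊢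
  rwa [add_comm (p 0), add_comm (p (-n)), add_comm (1 / (2 * p (-n)))]

lemma binForm_eq_crossForm (P Q : ℝ) (v : Fin 2 → ℝ) :
    binForm 1 (√2 * (P - Q)) (-2 * P * Q) v = crossForm P Q (v 0, v 1) := by
  simp only [binForm, crossForm]
  linear_combination (P * Q * v 1 ^ 2) * sqrt_two_mul_self

lemma discr_eq (P Q : ℝ) :
    (√2 * (P - Q)) ^ 2 - 4 * 1 * (-2 * P * Q) = (√2 * (P + Q)) ^ 2 := by
  linear_combination (-4 * P * Q) * sqrt_two_mul_self

lemma crossForm_ne_zero (h : IsGeodesic t p q) {v : Fin 2 → ℝ} (hv : v ∈ heckeOrbit) :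
    crossForm (p 0) (q 0) (v 0, v 1) ≠ 0 := by
  have h2 := sqrt_two_mul_self
  have hs : √2 ≠ 0 := by positivity
  obtain ⟨M, hM, rfl⟩ := hv
  simp only [firstColumn_apply]
  intro hc
  have hq : ∀ x y : ℤ, (x : ℝ) = 2 * q 0 * y → x = 0 ∧ y = 0 := fun x y e =>
    (h.right 0).ne_cusp (by simpa using e)
  have hp : ∀ x y : ℤ, (x : ℝ) = -(2 * p 0 * y) → x = 0 ∧ y = 0 := fun x y e => by
    have := (h.left 0).ne_cusp (x := -x) (y := y) (by push_cast; rw [e]; simp)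
    omega
  rcases heckeGroup_four_entries hM with ⟨a, b, c, d, hd, h00, h01, h10, h11⟩ |
    ⟨a, b, c, d, hd, h00, h01, h10, h11⟩ <;> simp only [crossForm, h00, h10] at hc <;>
    rcases mul_eq_zero.1 hc with e | e
  · obtain ⟨rfl, rfl⟩ := hq a c (by linear_combination e + (q 0 * c) * h2)
    simp at hd
  · obtain ⟨rfl, rfl⟩ := hp a c (by linear_combination e - (p 0 * c) * h2)
    simp at hd
  · obtain ⟨h1, rfl⟩ := hq (2 * a) c (by
      push_cast
      refine mul_left_cancel₀ hs ?_
      linear_combination 2 * e)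
    obtain rfl : a = 0 := by omega
    simp at hd
  · obtain ⟨h1, rfl⟩ := hp (2 * a) c (by
      push_cast
      refine mul_left_cancel₀ hs ?_
      linear_combination 2 * e)
    obtain rfl : a = 0 := by omega
    simp at hd

/-- Each value of the form of a geodesic on the orbit is either large or attached to a cut. -/
lemma le_or_mem_edgeEnds (h : IsGeodesic t p q) {v : Fin 2 → ℝ} (hv : v ∈ heckeOrbit) :
    p 0 + q 0 ≤ |crossForm (p 0) (q 0) (v 0, v 1)| ∨
    (∃ n : ℕ, v ∈ edgeEnds (fun k => t (1 + k)) n ∧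
      p 0 + q 0 ≤ |crossForm (p 0) (q 0) (v 0, v 1)| * cutValue p q n) ∨
    ∃ n : ℕ, v ∈ edgeEnds (fun k => t (-k)) n ∧
      p 0 + q 0 ≤ |crossForm (p 0) (q 0) (v 0, v 1)| * cutValue p q (-n) := by
  rw [or_iff_not_imp_left]
  intro hlt
  push Not at hlt
  have h2 := sqrt_two_mul_self
  have hp := h.p_pos 0
  have hq := h.q_pos 0
  have hne := h.crossForm_ne_zero hv
  obtain ⟨M, hM, rfl⟩ := hv
  rw [← binForm_eq_crossForm] at hlt hne
  have hδ := discr_eq (p 0) (q 0)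
  have hsum : 0 < √2 * (p 0 + q 0) := by positivity
  have hsqrt : √((√2 * (p 0 - q 0)) ^ 2 - 4 * 1 * (-2 * p 0 * q 0)) = √2 * (p 0 + q 0) := by
    rw [hδ, Real.sqrt_sq hsum.le]
  obtain ⟨M', hM', hcol, P, Q, hP, hQ, -, hform⟩ := exists_crossing hM hne (by rw [hδ]; positivity)
    (by rw [hsqrt]; gcongr)
  have h01 := hform 0 1
  rw [formAt] at h01
  simp only [mul_zero, mul_one, zero_add, zero_sub] at h01
  rw [binForm_eq_crossForm] at h01
  rw [binForm_eq_crossForm] at hne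
  rw [← hcol] at hne h01 ⊢
  rw [binForm_eq_crossForm] at h01
  simp only [firstColumn_apply, Matrix.cons_val_zero, Matrix.cons_val_one,
    Matrix.cons_val_fin_one] at h01 hne ⊢
  -- The columns of `M'` are the ends of an edge crossed by the geodesic, so the form has opposite
  -- signs on them.
  have hneg : crossForm (p 0) (q 0) (M'.1 0 0, M'.1 1 0) *
      crossForm (p 0) (q 0) (M'.1 0 1, M'.1 1 1) < 0 := by
    rw [h01]
    have : crossForm (p 0) (q 0) (M'.1 0 0, M'.1 1 0) *
        (crossForm (p 0) (q 0) (M'.1 0 0, M'.1 1 0) * (-(√2 * Q) * (√2 * P))) =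
        -(2 * P * Q * crossForm (p 0) (q 0) (M'.1 0 0, M'.1 1 0) ^ 2) := by
      linear_combination
        (-(P * Q) * crossForm (p 0) (q 0) (M'.1 0 0, M'.1 1 0) ^ 2) * h2
    rw [this]
    have := sq_pos_of_ne_zero hne
    simp only [Left.neg_neg_iff]
    positivity
  have hcolv : firstColumn M' = ![M'.1 0 0, M'.1 1 0] := firstColumn_eq M'
  rw [hcolv]
  rcases heckeGroup_four_entries hM' with ⟨a, b, c, d, hd, e00, e01, e10, e11⟩ |
    ⟨a, b, c, d, hd, e00, e01, e10, e11⟩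
  · rw [e00, e01, e10, e11] at hneg
    rw [e00, e10]
    rcases h.exists_edge (Or.inl hd) hneg with ⟨n, m, -, s, -⟩ | ⟨n, m, -, s, -⟩
    · exact Or.inl ⟨n, m, h.le_of_mem_edgeEnds_right m s⟩
    · exact Or.inr ⟨n, m, h.le_of_mem_edgeEnds_left m s⟩
  -- For matrices of the second type the first column has the shape `(√2 a, c)`, so the two ends
  -- change roles.
  · rw [e00, e01, e10, e11, mul_comm] at hneg
    rw [e00, e10]
    rcases h.exists_edge (x := b) (y := d) (x' := a) (y' := c) (Or.inr (by linarith)) hneg with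
      ⟨n, -, m, -, s⟩ | ⟨n, -, m, -, s⟩
    · exact Or.inl ⟨n, m, h.le_of_mem_edgeEnds_right m s⟩
    · exact Or.inr ⟨n, m, h.le_of_mem_edgeEnds_left m s⟩

end IsGeodesic

/-! ### Spectral values realised by sequences -/

namespace IsGeodesic

variable {t : ℤ → RomikDigit} {p q : ℤ → ℝ}

/-- The lower bound for the value `m` comes from the vector `(1, 0)`, the upper one from the
classification of form values by cuts. When some cut has sum `K`, basing the form there makes the
bounds coincide. -/
lemma exists_mem_markoffSpectrum (h : IsGeodesic t p q) {K : ℝ} (hK : 1 ≤ K)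
    (hle : ∀ n, cutValue p q n ≤ K) :
    ∃ m ∈ markoffSpectrum (heckeGroup 4), √2 * (p 0 + q 0) ≤ m ∧ m ≤ √2 * K := by
  have hp := h.p_pos 0
  have hq := h.q_pos 0
  have hsum : 0 < √2 * (p 0 + q 0) := by positivity
  have hδ := discr_eq (p 0) (q 0)
  have hsqrt : √((√2 * (p 0 - q 0)) ^ 2 - 4 * 1 * (-2 * p 0 * q 0)) = √2 * (p 0 + q 0) := by
    rw [hδ, Real.sqrt_sq hsum.le]
  have hlow : ∀ v ∈ heckeOrbit, (p 0 + q 0) / K ≤ |crossForm (p 0) (q 0) (v 0, v 1)| := by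
    intro v hv
    have key : ∀ c, c ≤ K → p 0 + q 0 ≤ |crossForm (p 0) (q 0) (v 0, v 1)| * c →
        (p 0 + q 0) / K ≤ |crossForm (p 0) (q 0) (v 0, v 1)| := by
      intro c hc hv
      rw [div_le_iff₀ (by linarith)]
      exact hv.trans (by gcongr)
    rcases h.le_or_mem_edgeEnds hv with h1 | ⟨n, -, h1⟩ | ⟨n, -, h1⟩
    · exact key 1 hK (by rwa [mul_one])
    · exact key _ (hle _) h1
    · exact key _ (hle _) h1
  set I := ⨅ M : heckeGroup 4,
    |binForm 1 (√2 * (p 0 - q 0)) (-2 * p 0 * q 0) (firstColumn M)| with hI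
  have hI1 : (p 0 + q 0) / K ≤ I := by
    refine le_ciInf fun M => ?_
    rw [binForm_eq_crossForm]
    exact hlow _ (firstColumn_mem M.2)
  have hI2 : I ≤ 1 := by
    have := ciInf_le (f := fun M : heckeGroup 4 =>
      |binForm 1 (√2 * (p 0 - q 0)) (-2 * p 0 * q 0) (firstColumn M)|)
      ⟨0, by rintro _ ⟨M, rfl⟩; exact abs_nonneg _⟩ 1
    refine this.trans (le_of_eq ?_)
    rw [binForm_eq_crossForm]
    simp [firstColumn_apply, crossForm_one_zero]
  have hIpos : 0 < I := lt_of_lt_of_le (by positivity) hI1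
  refine ⟨√2 * (p 0 + q 0) / I, ⟨_, _, _, by rw [hδ]; positivity, hIpos, by rw [hsqrt]⟩, ?_, ?_⟩
  · rw [le_div_iff₀ hIpos]
    nlinarith
  · rw [div_le_iff₀ hIpos, mul_assoc]
    rw [div_le_iff₀ (by linarith)] at hI1
    gcongr
    linarith

end IsGeodesic

lemma nonneg_move (d : RomikDigit) {w : ℝ × ℝ} (h1 : 1 ≤ w.1) (h2 : 0 ≤ w.2) :
    1 ≤ (d.move w).1 ∧ 0 ≤ (d.move w).2 ∧ w.1 + w.2 ≤ (d.move w).1 + (d.move w).2 := by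
  have := Real.sqrt_nonneg 2
  have h3 : 0 ≤ √2 * w.1 := by positivity
  have h4 : 0 ≤ √2 * w.2 := by positivity
  cases d <;> simp only [move] <;> refine ⟨?_, ?_, ?_⟩ <;> linarith

lemma add_one_le_move {d : RomikDigit} (hd : d ≠ three) {w : ℝ × ℝ} (h1 : 1 ≤ w.1)
    (h2 : 0 ≤ w.2) : w.1 + w.2 + 1 ≤ (d.move w).1 + (d.move w).2 := by
  have hs : 1 ≤ √2 := Real.one_le_sqrt.2 (by norm_num)
  have h3 : 1 * 1 ≤ √2 * w.1 := by gcongr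
  have h4 : 0 ≤ √2 * w.2 := by positivity
  cases d with
  | one => simp only [move]; linarith
  | two => simp only [move]; linarith
  | three => exact absurd rfl hd

/-- Every move other than that of `3` adds at least `1` to the coordinate sum, and one occurs among
any two consecutive digits. The images of `(1, 0)` along the path therefore tend to infinity. -/
lemma NoRepeat.le_pathMove (n : ℕ) : ∀ {d : ℕ → RomikDigit}, NoRepeat d →
    1 ≤ (pathMove d n (1, 0)).1 ∧ 0 ≤ (pathMove d n (1, 0)).2 ∧
      (n : ℝ) / 2 ≤ (pathMove d n (1, 0)).1 + (pathMove d n (1, 0)).2 := by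
  induction n using Nat.twoStepInduction with
  | zero => intro d _; simp [pathMove]
  | one =>
    intro d _
    obtain ⟨a, b, c⟩ := nonneg_move (d 0) (w := (1, 0)) le_rfl le_rfl
    refine ⟨a, b, ?_⟩
    simp only [pathMove]
    norm_num at c ⊢
    linarith
  | more n ih _ =>
    intro d hd
    have h2 := hd.shift 2
    obtain ⟨a, b, c⟩ := ih h2
    have e : pathMove d (n + 2) (1, 0) =
        (d 0).move ((d 1).move (pathMove (fun k => d (k + 2)) n (1, 0))) := rfl
    obtain ⟨a', b', c'⟩ := nonneg_move (d 1) a b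
    obtain ⟨a'', b'', c''⟩ := nonneg_move (d 0) a' b'
    rw [e]
    refine ⟨a'', b'', ?_⟩
    push_cast
    by_cases h1 : d 1 = three
    · have h0 : d 0 ≠ three := fun h0 => (hd 0).2 ⟨h0, h1⟩
      have := add_one_le_move h0 a' b'
      linarith
    · have := add_one_le_move h1 a b
      linarith

namespace IsGeodesic

variable {t : ℤ → RomikDigit} {p q : ℤ → ℝ}

/-- Quotients above `√2 (K + ε)` occur only at ends of finitely many edges, each with finitely many
sign variants. Conversely, the images of `(1, 0)` at infinitely many cuts give quotients above `√2
(K - ε)`, and by their growth no finite set contains all these vectors. -/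
lemma mem_lagrangeSpectrum (h : IsGeodesic t p q) (hd : NoRepeat fun n : ℕ => t (1 + n)) {K : ℝ}
    (hK : 1 ≤ K) (hfin : ∀ ε > 0, {n : ℤ | K + ε < cutValue p q n}.Finite)
    (hinf : ∀ ε > 0, {n : ℕ | K - ε < p n + q n}.Infinite) :
    √2 * K ∈ lagrangeSpectrum (heckeGroup 4) := by
  have hp := h.p_pos 0
  have hq := h.q_pos 0
  have hs : 0 < √2 := by positivity
  have hsum : 0 < √2 * (p 0 + q 0) := by positivity
  have hδ := discr_eq (p 0) (q 0)
  have hsqrt : √((√2 * (p 0 - q 0)) ^ 2 - 4 * 1 * (-2 * p 0 * q 0)) = √2 * (p 0 + q 0) := by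
    rw [hδ, Real.sqrt_sq hsum.le]
  refine ⟨by positivity, 1, √2 * (p 0 - q 0), -2 * p 0 * q 0, by rw [hδ]; positivity, ?_⟩
  simp only [hsqrt, binForm_eq_crossForm]
  refine le_antisymm ?_ ?_
  · refine le_of_forall_gt_imp_ge_of_dense fun r hr => ?_
    by_cases hrt : r = ⊤
    · rw [hrt]; exact le_top
    obtain ⟨r', hr', rfl⟩ : ∃ r' : ℝ, 0 ≤ r' ∧ r = ENNReal.ofReal r' :=
      ⟨r.toReal, ENNReal.toReal_nonneg, (ENNReal.ofReal_toReal hrt).symm⟩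
    have hlt : √2 * K < r' := (ENNReal.ofReal_lt_ofReal_iff_of_nonneg (by positivity)).1 hr
    refine Filter.limsup_le_of_le (by isBoundedDefault) ?_
    rw [Filter.eventually_cofinite]
    set ε := r' / √2 - K with hε
    have hKε : √2 * (K + ε) = r' := by rw [hε]; field_simp; ring
    have hεpos : 0 < ε := by
      rw [hε, sub_pos, lt_div_iff₀ hs]; linarith
    have hfinA := (hfin ε hεpos).biUnion (t := fun n => edgeEnds (fun k => t (1 + k)) n.natAbs ∪
      edgeEnds (fun k => t (-k)) n.natAbs)
      fun n _ => (edgeEnds_finite _ _).union (edgeEnds_finite _ _)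
    refine (hfinA.preimage Subtype.val_injective.injOn).subset ?_
    rintro v hv
    simp only [Set.mem_ofPred_eq, not_le] at hv
    rw [lt_ofReal_div_ofReal_iff hsum (abs_nonneg _) hr'] at hv
    have key : ∀ c, p 0 + q 0 ≤ |crossForm (p 0) (q 0) (v.1 0, v.1 1)| * c → K + ε < c := by
      intro c hc
      by_contra! hcon
      have : p 0 + q 0 ≤ |crossForm (p 0) (q 0) (v.1 0, v.1 1)| * (K + ε) :=
        hc.trans (by gcongr)
      rw [← hKε, mul_assoc] at hv
      have := lt_of_mul_lt_mul_left hv hs.le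
      linarith
    simp only [Set.mem_preimage, Set.mem_iUnion, Set.mem_ofPred_eq]
    rcases h.le_or_mem_edgeEnds v.2 with h1 | ⟨n, hn, h1⟩ | ⟨n, hn, h1⟩
    · exfalso
      have := key 1 (by rwa [mul_one])
      linarith
    · exact ⟨n, key _ h1, Or.inl (by simpa using hn)⟩
    · exact ⟨-n, key _ h1, Or.inr (by simpa using hn)⟩
  · refine le_of_forall_lt_imp_le_of_dense fun r hr => ?_
    obtain ⟨r', hr', rfl⟩ : ∃ r' : ℝ, 0 ≤ r' ∧ r = ENNReal.ofReal r' :=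
      ⟨r.toReal, ENNReal.toReal_nonneg, (ENNReal.ofReal_toReal hr.ne_top).symm⟩
    have hlt : r' < √2 * K := (ENNReal.ofReal_lt_ofReal_iff_of_nonneg hr').1 hr
    refine Filter.le_limsup_of_frequently_le ?_ (by isBoundedDefault)
    set ε := K - r' / √2 with hε
    have hεpos : 0 < ε := by
      rw [hε, sub_pos, div_lt_iff₀ hs]; linarith
    have hKε : √2 * (K - ε) = r' := by rw [hε]; field_simp; ring
    rw [Filter.frequently_cofinite_iff_infinite]
    intro hfinite
    have horb : ∀ n : ℕ, ![(pathMove (fun k => t (1 + k)) n (1, 0)).1,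
        (pathMove (fun k => t (1 + k)) n (1, 0)).2] ∈ heckeOrbit := fun n =>
      mem_heckeOrbit_pathMove n _ (v := (1, 0)) one_zero_mem_heckeOrbit
    obtain ⟨B, hB⟩ := (hfinite.image fun v : heckeOrbit => v.1 0 + v.1 1).bddAbove
    obtain ⟨n, hn, hnB⟩ := (hinf ε hεpos).exists_gt ⌈2 * B⌉₊
    have hnB' : 2 * B < n := Nat.lt_of_ceil_lt hnB
    have hmem := hB ⟨⟨_, horb n⟩, ?_, rfl⟩
    · have hgrow := (NoRepeat.le_pathMove n hd).2.2
      simp only [Matrix.cons_val_zero, Matrix.cons_val_one, Matrix.cons_val_fin_one] at hmem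
      linarith
    · refine le_of_lt ((lt_ofReal_div_ofReal_iff hsum (abs_nonneg _) hr').2 ?_)
      simp only [Matrix.cons_val_zero, Matrix.cons_val_one, Matrix.cons_val_fin_one, Prod.mk.eta]
      have hval := h.crossForm_pathMove_one_zero n
      have hpos : 0 < |crossForm (p 0) (q 0) (pathMove (fun k => t (1 + k)) n (1, 0))| := by
        refine abs_pos.2 ?_
        simpa using h.crossForm_ne_zero (horb n)
      have hn : K - ε < p n + q n := hn
      rw [← hKε, ← hval, mul_assoc, mul_comm (K - ε)]
      gcongr

end IsGeodesic

/-! ### The Romik map in the stereographic coordinate -/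

/-- The point of the unit circle whose stereographic coordinate from `(0, 1)` is `u`. -/
noncomputable def circlePoint (u : ℝ) : ℝ × ℝ := (2 * u / (u ^ 2 + 1), (u ^ 2 - 1) / (u ^ 2 + 1))

lemma circlePoint_mem {u : ℝ} (hu : 1 ≤ u) : circlePoint u ∈ quarterCircle := by
  have h : 0 < u ^ 2 + 1 := by positivity
  refine ⟨?_, by simp only [circlePoint]; positivity, div_nonneg (by nlinarith) h.le⟩
  simp only [circlePoint]
  field_simp; ring

lemma one_sub_circlePoint_snd (u : ℝ) : 1 - (circlePoint u).2 = 2 / (u ^ 2 + 1) := by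
  simp only [circlePoint]; field_simp; ring

lemma circlePoint_fst_div (u : ℝ) : (circlePoint u).1 / (1 - (circlePoint u).2) = u := by
  rw [one_sub_circlePoint_snd]
  simp only [circlePoint]; field_simp

lemma circlePoint_injective : Function.Injective circlePoint := fun u v h => by
  rw [← circlePoint_fst_div u, h, circlePoint_fst_div]

lemma exists_eq_circlePoint {p : ℝ × ℝ} (hp : p ∈ quarterCircle) (h : p ≠ (0, 1)) :
    ∃ u, 1 ≤ u ∧ p = circlePoint u := by
  obtain ⟨x, y⟩ := p
  obtain ⟨h1, h2, h3⟩ := hp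
  simp only at h1 h2 h3
  have hy : y < 1 := by
    refine lt_of_le_of_ne (by nlinarith) ?_
    rintro rfl
    exact h (by rw [show x = 0 by nlinarith])
  have hy' : 0 < 1 - y := by linarith
  refine ⟨x / (1 - y), ?_, ?_⟩
  · rw [le_div_iff₀ hy']; nlinarith
  · have e : (x / (1 - y)) ^ 2 + 1 = 2 / (1 - y) := by
      field_simp; linear_combination h1
    have e' : (x / (1 - y)) ^ 2 - 1 = 2 * y / (1 - y) := by
      field_simp; linear_combination h1
    simp only [circlePoint, e, e']
    refine Prod.ext ?_ ?_ <;> field_simp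

/-- In the stereographic coordinate the Romik map sends `u` to `|u - 2|` or its reciprocal,
whichever is at least `1`; `u = 2` goes to the point `(0, 1)`. -/
lemma romikMap_circlePoint (u : ℝ) : romikMap (circlePoint u) =
    (2 * |u - 2| / ((u - 2) ^ 2 + 1), |(u - 2) ^ 2 - 1| / ((u - 2) ^ 2 + 1)) := by
  have h : 0 < u ^ 2 + 1 := by positivity
  have e : 3 - 2 * (circlePoint u).1 - 2 * (circlePoint u).2 = ((u - 2) ^ 2 + 1) / (u ^ 2 + 1) := by
    simp only [circlePoint]; field_simp; ring
  have e1 : 2 - (circlePoint u).1 - 2 * (circlePoint u).2 = -(2 * (u - 2)) / (u ^ 2 + 1) := by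
    simp only [circlePoint]; field_simp; ring
  have e2 : 2 - 2 * (circlePoint u).1 - (circlePoint u).2 = ((u - 2) ^ 2 - 1) / (u ^ 2 + 1) := by
    simp only [circlePoint]; field_simp; ring
  simp only [romikMap, e, e1, e2, abs_div, abs_of_pos h, abs_neg, abs_mul, abs_two]
  refine Prod.ext ?_ ?_ <;> simp only <;> field_simp

lemma romikMap_circlePoint_branch (d : RomikDigit) {w : ℝ} (hw : 0 ≤ w) :
    romikMap (circlePoint (1 + 2 * d.branch w)) = circlePoint (1 + 2 * w) := by
  have hs : 0 < 1 + 2 * w := by linarith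
  have hs' : 0 ≤ (1 + 2 * w) ^ 2 - 1 := by nlinarith
  have key : ∀ u, |u| = 1 / (1 + 2 * w) → (2 * |u| / (u ^ 2 + 1), |u ^ 2 - 1| / (u ^ 2 + 1)) =
      circlePoint (1 + 2 * w) := by
    intro u hu
    have e : u ^ 2 = 1 / (1 + 2 * w) ^ 2 := by rw [← sq_abs, hu, one_div_pow]
    have e' : |u ^ 2 - 1| = ((1 + 2 * w) ^ 2 - 1) / (1 + 2 * w) ^ 2 := by
      rw [e, abs_of_nonpos]
      · field_simp; ring
      · rw [sub_nonpos, div_le_one (by positivity)]; linarith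
    rw [e', e, hu]
    simp only [circlePoint]
    refine Prod.ext ?_ ?_ <;> simp only <;> field_simp <;> ring
  rw [romikMap_circlePoint]
  cases d with
  | one =>
    refine key _ ?_
    have : 1 + 2 * one.branch w - 2 = -(1 / (1 + 2 * w)) := by
      simp only [branch]
      rw [add_comm (2 * w) 1]; field_simp; ring
    rw [this, abs_neg, abs_of_pos (by positivity)]
  | two =>
    refine key _ ?_
    have : 1 + 2 * two.branch w - 2 = 1 / (1 + 2 * w) := by
      simp only [branch]
      rw [add_comm (2 * w) 1]; field_simp; ring
    rw [this, abs_of_pos (by positivity)]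
  | three =>
    have : 1 + 2 * three.branch w - 2 = 1 + 2 * w := by simp only [branch]; ring
    rw [this, abs_of_pos hs, abs_of_nonneg hs']
    rfl

lemma romikMap_mem {p : ℝ × ℝ} (hp : p ∈ quarterCircle) : romikMap p ∈ quarterCircle := by
  by_cases h : p = (0, 1)
  · rw [h]
    norm_num [romikMap, quarterCircle]
  · obtain ⟨u, hu, rfl⟩ := exists_eq_circlePoint hp h
    rw [romikMap_circlePoint]
    refine ⟨?_, by positivity, by positivity⟩
    simp only [div_pow, mul_pow, sq_abs]
    field_simp; ring

lemma circlePoint_fst_le_iff {u : ℝ} : (circlePoint u).1 ≤ 3 / 5 ↔ 0 ≤ (u - 3) * (3 * u - 1) := by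
  simp only [circlePoint]
  rw [div_le_div_iff₀ (by positivity) (by norm_num)]
  constructor <;> intro h <;> nlinarith

lemma circlePoint_fst_le_iff' {u : ℝ} : (circlePoint u).1 ≤ 4 / 5 ↔ 0 ≤ (u - 2) * (2 * u - 1) := by
  simp only [circlePoint]
  rw [div_le_div_iff₀ (by positivity) (by norm_num)]
  constructor <;> intro h <;> nlinarith

lemma le_circlePoint_fst_iff {u : ℝ} : 3 / 5 ≤ (circlePoint u).1 ↔ (u - 3) * (3 * u - 1) ≤ 0 := by
  simp only [circlePoint]
  rw [div_le_div_iff₀ (by norm_num) (by positivity)]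
  constructor <;> intro h <;> nlinarith

lemma le_circlePoint_fst_iff' {u : ℝ} : 4 / 5 ≤ (circlePoint u).1 ↔ (u - 2) * (2 * u - 1) ≤ 0 := by
  simp only [circlePoint]
  rw [div_le_div_iff₀ (by norm_num) (by positivity)]
  constructor <;> intro h <;> nlinarith

lemma IsExpansion.hasRomikExpansion {d : ℕ → RomikDigit} {x : ℕ → ℝ} (h : IsExpansion d x) :
    HasRomikExpansion (circlePoint (1 + 2 * x 0)) d := by
  have hx := h.pos 0
  have hiter : ∀ j, romikMap^[j] (circlePoint (1 + 2 * x 0)) = circlePoint (1 + 2 * x j) := by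
    intro j
    induction j with
    | zero => rfl
    | succ j ih =>
      rw [Function.iterate_succ_apply', ih, h.eq j, romikMap_circlePoint_branch _ (h.pos _).le]
  refine ⟨circlePoint_mem (by linarith), fun j => ?_⟩
  rw [hiter]
  have hj := h.pos j
  have hm := circlePoint_mem (u := 1 + 2 * x j) (by linarith)
  cases hd : d j with
  | one =>
    have := h.lt_half hd
    refine ⟨le_circlePoint_fst_iff'.2 (by nlinarith), ?_⟩
    nlinarith [hm.1, hm.2.1, sq_nonneg (circlePoint (1 + 2 * x j)).2]
  | two =>
    have h1 := h.half_lt (n := j) (by rw [hd]; simp)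
    have h2 := h.lt_one (n := j) (by rw [hd]; simp)
    exact ⟨le_circlePoint_fst_iff.2 (by nlinarith), circlePoint_fst_le_iff'.2 (by nlinarith)⟩
  | three =>
    have h1 := h.one_lt hd
    exact ⟨hm.2.1, circlePoint_fst_le_iff.2 (by nlinarith)⟩

lemma exists_branch_eq_of_mem_cell {d : RomikDigit} {u : ℝ} (hu : 1 ≤ u)
    (h : (circlePoint u).1 ∈ d.cell) (hne : u ≠ 2) : ∃ w, 0 ≤ w ∧ u = 1 + 2 * d.branch w := by
  cases d with
  | one =>
    have h1 := le_circlePoint_fst_iff'.1 h.1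
    have h2 : u < 2 := lt_of_le_of_ne (by nlinarith) hne
    have h3 : 0 < 2 - u := by linarith
    refine ⟨(u - 1) / (2 * (2 - u)), div_nonneg (by linarith) (by linarith), ?_⟩
    simp only [branch]
    have : 2 * ((u - 1) / (2 * (2 - u))) + 1 = 1 / (2 - u) := by field_simp; ring
    rw [this]; field_simp; ring
  | two =>
    have h1 := le_circlePoint_fst_iff.1 h.1
    have h1' := circlePoint_fst_le_iff'.1 h.2
    have h2 : 2 < u := lt_of_le_of_ne (by nlinarith) hne.symm
    have h3 : 0 < u - 2 := by linarith
    refine ⟨(3 - u) / (2 * (u - 2)), div_nonneg (by nlinarith) (by linarith), ?_⟩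
    simp only [branch]
    have : 2 * ((3 - u) / (2 * (u - 2))) + 1 = 1 / (u - 2) := by field_simp; ring
    rw [this]; field_simp; ring
  | three =>
    have h1 := circlePoint_fst_le_iff.1 h.2
    exact ⟨(u - 3) / 2, by nlinarith, by simp only [branch]; ring⟩

/-- Conversely, a point with a Romik expansion without repetitions comes from an expansion. -/
lemma HasRomikExpansion.exists_isExpansion {d : ℕ → RomikDigit} {p : ℝ × ℝ}
    (h : HasRomikExpansion p d) (hd : NoRepeat d) :
    ∃ x, IsExpansion d x ∧ p = circlePoint (1 + 2 * x 0) := by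
  obtain ⟨hp, hcell⟩ := h
  have hmem : ∀ j, romikMap^[j] p ∈ quarterCircle := by
    intro j
    induction j with
    | zero => exact hp
    | succ j ih => rw [Function.iterate_succ_apply']; exact romikMap_mem ih
  -- The points `(0, 1)` and `(1, 0)` are fixed by the Romik map and lie only in the cells of `3`
  -- and `1` respectively. An orbit reaching one of them would repeat that digit.
  have hne0 : ∀ j, romikMap^[j] p ≠ (0, 1) := by
    intro j hj
    have key : ∀ i, romikMap^[i] p = (0, 1) → d i = three := by
      intro i hi
      have := hcell i
      rw [hi] at this
      cases hdi : d i <;> rw [hdi] at this <;> norm_num [cell] at this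
    refine (hd j).2 ⟨key _ hj, key _ ?_⟩
    rw [Function.iterate_succ_apply', hj]
    norm_num [romikMap]
  have hne1 : ∀ j, romikMap^[j] p ≠ (1, 0) := by
    intro j hj
    have key : ∀ i, romikMap^[i] p = (1, 0) → d i = one := by
      intro i hi
      have := hcell i
      rw [hi] at this
      cases hdi : d i <;> rw [hdi] at this <;> norm_num [cell] at this
    refine (hd j).1 ⟨key _ hj, key _ ?_⟩
    rw [Function.iterate_succ_apply', hj]
    norm_num [romikMap]
  choose u hu hpu using fun j => exists_eq_circlePoint (hmem j) (hne0 j)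
  refine ⟨fun j => (u j - 1) / 2, ⟨fun j => ?_, fun j => ?_⟩, ?_⟩
  · have : u j ≠ 1 := by
      intro e
      refine hne1 j ?_
      rw [hpu, e]; norm_num [circlePoint]
    have : 1 < u j := lt_of_le_of_ne (hu j) this.symm
    linarith
  · have hstep : circlePoint (u (j + 1)) = romikMap (circlePoint (u j)) := by
      rw [← hpu, ← hpu, Function.iterate_succ_apply']
    have hc := hcell j
    rw [hpu j] at hc
    obtain ⟨w, hw, e⟩ := exists_branch_eq_of_mem_cell (hu j) hc (by
      intro e
      refine hne0 (j + 1) ?_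
      rw [hpu, hstep, e, romikMap_circlePoint]
      norm_num)
    rw [e, romikMap_circlePoint_branch _ hw] at hstep
    have := circlePoint_injective hstep
    simp only [e, this]
    ring_nf
  · have := hpu 0
    rw [Function.iterate_zero, id] at this
    rw [this]; congr 1; ring

lemma stereo_circlePoint {z : ℝ} : stereo (circlePoint (1 + 2 * z)) = ENNReal.ofReal (√2 * z) := by
  have hne : (circlePoint (1 + 2 * z)).2 ≠ 1 := by
    intro h
    have := one_sub_circlePoint_snd (1 + 2 * z)
    rw [h, sub_self] at this
    exact absurd this.symm (by positivity)
  rw [stereo, if_neg hne, circlePoint_fst_div]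
  congr 1
  have : √2 ≠ 0 := by positivity
  field_simp
  linear_combination (-z) * sqrt_two_mul_self

/-- The expansion supplies a point for `romikPoint` to choose, and uniqueness of coordinates without
repetitions identifies the chosen point. -/
lemma IsExpansion.romikValue_eq {d : ℕ → RomikDigit} {x : ℕ → ℝ} (h : IsExpansion d x)
    (hd : NoRepeat d) : romikValue d = ENNReal.ofReal (√2 * x 0) := by
  have hspec : HasRomikExpansion (romikPoint d) d :=
    Classical.epsilon_spec (p := fun p => HasRomikExpansion p d) ⟨_, h.hasRomikExpansion⟩
  obtain ⟨y, hy, e⟩ := hspec.exists_isExpansion hd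
  rw [romikValue, e, stereo_circlePoint, h.unique_zero hy hd]

lemma IsAdmissible.noRepeat_right {t : ℤ → RomikDigit} (h : IsAdmissible t) (k : ℤ) :
    NoRepeat fun n : ℕ => t (k + n) := (h.isTame k).noRepeat

lemma IsAdmissible.noRepeat_left {t : ℤ → RomikDigit} (h : IsAdmissible t) (k : ℤ) :
    NoRepeat fun n : ℕ => t (k - n) := by
  have := h.neg.noRepeat_right (-k)
  have e : (fun n : ℕ => t (-(-k + n))) = fun n : ℕ => t (k - n) := by
    funext n; congr 1; ring
  rwa [e] at this

namespace IsGeodesic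

variable {t : ℤ → RomikDigit} {p q : ℤ → ℝ}

lemma sectionValue_eq (h : IsGeodesic t p q) (ht : IsAdmissible t) (n : ℤ) :
    sectionValue t n = ENNReal.ofReal (√2 * (p n + q n)) := by
  have hp := h.p_pos n
  have hq := h.q_pos n
  rw [sectionValue, (h.left n).romikValue_eq (ht.noRepeat_left n),
    (h.right n).romikValue_eq (ht.noRepeat_right (n + 1)),
    ← ENNReal.ofReal_add (by simp; positivity) (by simp; positivity)]
  congr 1
  simp; ring

lemma markoffNumber_eq (h : IsGeodesic t p q) (ht : IsAdmissible t) {K : ℝ}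
    (hle : ∀ n, cutValue p q n ≤ K) (hK : ∃ n, p n + q n = K) :
    markoffNumber t = ENNReal.ofReal (√2 * K) := by
  have hmax : ∀ n, max (sectionValue t n) (sectionValue (fun i => (t i).vee) n) =
      ENNReal.ofReal (√2 * cutValue p q n) := by
    intro n
    rw [h.sectionValue_eq ht, h.vee.sectionValue_eq ht.vee, cutValue,
      mul_max_of_nonneg _ _ (Real.sqrt_nonneg 2), ENNReal.ofReal_max]
  rw [markoffNumber]
  simp only [hmax]
  refine le_antisymm (iSup_le fun n => ENNReal.ofReal_le_ofReal ?_) ?_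
  · have := hle n
    gcongr
  · obtain ⟨n, rfl⟩ := hK
    refine le_iSup_of_le n (ENNReal.ofReal_le_ofReal ?_)
    gcongr
    exact le_max_left _ _

end IsGeodesic

/-- Expansions chosen independently at each cut fit together because coordinates are unique. -/
lemma exists_right_coordinates {t : ℤ → RomikDigit} (ht : ∀ k, NoRepeat fun n : ℕ => t (k + n)) :
    ∃ q : ℤ → ℝ, (∀ n, 0 < q n) ∧ ∀ n, q n = (t (n + 1)).branch (q (n + 1)) := by
  choose x hx using fun k => exists_expansion (ht (k + 1))
  refine ⟨fun n => x n 0, fun n => (hx n).pos 0, fun n => ?_⟩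
  have h1 := (hx n).shift 1
  have e : (fun k : ℕ => t (n + 1 + (k + 1 : ℕ))) = fun k : ℕ => t (n + 1 + 1 + k) := by
    funext k; congr 1; push_cast; ring
  rw [e] at h1
  have := h1.unique_zero (hx (n + 1)) (ht _)
  simp only [zero_add] at this
  simpa [this] using (hx n).eq 0

lemma IsAdmissible.exists_geodesic {t : ℤ → RomikDigit} (ht : IsAdmissible t) :
    ∃ p q, IsGeodesic t p q := by
  obtain ⟨q, hq, hq'⟩ := exists_right_coordinates ht.noRepeat_right
  obtain ⟨p, hp, hp'⟩ := exists_right_coordinates (t := fun n => t (-n)) ht.neg.noRepeat_right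
  refine ⟨fun n => p (-n - 1), q, fun n => hp _, hq, fun n => ?_, hq'⟩
  have := hp' (-n - 1)
  rw [show -(-n - 1 + 1) = n by ring] at this
  rw [this]
  congr 2; ring

/-! ### Block sequences -/

/-- The concatenation of the blocks `31323232` at the places of `χ` and `31321312` elsewhere. -/
noncomputable def blockSeq (χ : Set ℤ) (n : ℤ) : RomikDigit :=
  open Classical in
  if n % 8 = 1 then one
  else if n % 8 = 3 ∨ n % 8 = 7 then two
  else if n / 8 ∈ χ ∧ n % 8 = 5 then two
  else if n / 8 ∉ χ ∧ (n % 8 = 4 ∨ n % 8 = 6) then one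
  else three

lemma blockSeq_eq_one {χ : Set ℤ} {n : ℤ} :
    blockSeq χ n = one ↔ n % 8 = 1 ∨ n / 8 ∉ χ ∧ (n % 8 = 4 ∨ n % 8 = 6) := by
  unfold blockSeq
  split_ifs <;> simp <;> grind

lemma blockSeq_eq_two {χ : Set ℤ} {n : ℤ} :
    blockSeq χ n = two ↔ n % 8 = 3 ∨ n % 8 = 7 ∨ n / 8 ∈ χ ∧ n % 8 = 5 := by
  unfold blockSeq
  split_ifs <;> simp <;> grind

lemma blockSeq_eq_three {χ : Set ℤ} {n : ℤ} :
    blockSeq χ n = three ↔ n % 8 = 0 ∨ n % 8 = 2 ∨ (n / 8 ∈ χ ∧ (n % 8 = 4 ∨ n % 8 = 6)) ∨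
      n / 8 ∉ χ ∧ n % 8 = 5 := by
  unfold blockSeq
  split_ifs <;> simp <;> grind

lemma isAdmissible_blockSeq (χ : Set ℤ) : IsAdmissible (blockSeq χ) := by
  constructor <;> intro n <;> simp only [ne_eq, blockSeq_eq_one, blockSeq_eq_two, blockSeq_eq_three]
  all_goals
    have h1 : n % 8 ≠ 7 → (n + 1) / 8 = n / 8 := by omega
    have h2 : n % 8 ≠ 0 → (n - 1) / 8 = n / 8 := by omega
    have h3 : n % 8 < 6 → (n + 2) / 8 = n / 8 := by omega
    have h4 : 2 ≤ n % 8 → (n - 2) / 8 = n / 8 := by omega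
    by_cases hc : n / 8 ∈ χ
    all_goals grind

lemma isCenter_blockSeq {χ : Set ℤ} {n : ℤ} :
    IsCenter (blockSeq χ) n ↔ n / 8 ∈ χ ∧ (n % 8 = 4 ∨ n % 8 = 6) := by
  simp only [IsCenter, blockSeq_eq_two, blockSeq_eq_three]
  have h1 : n % 8 ≠ 7 → (n + 1) / 8 = n / 8 := by omega
  have h2 : n % 8 ≠ 0 → (n - 1) / 8 = n / 8 := by omega
  by_cases hc : n / 8 ∈ χ
  all_goals grind

/-- Neither block, nor a junction of blocks, produces the factor `212`. The dual sections of a block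
sequence hence never exceed `√119 / 5`. -/
lemma not_isCenter_vee_blockSeq (χ : Set ℤ) (n : ℤ) :
    ¬IsCenter (fun n => (blockSeq χ n).vee) n := by
  simp only [IsCenter, vee_eq_two, vee_eq_three, blockSeq_eq_one, blockSeq_eq_two]
  have h1 : n % 8 ≠ 7 → (n + 1) / 8 = n / 8 := by omega
  have h2 : n % 8 ≠ 0 → (n - 1) / 8 = n / 8 := by omega
  by_cases hc : n / 8 ∈ χ
  all_goals grind

lemma RomikDigit.eq_of_iff {d d' : RomikDigit} (h1 : d = one ↔ d' = one) (h2 : d = two ↔ d' = two) :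
    d = d' := by
  cases d <;> cases d' <;> simp_all

lemma blockSeq_right {χ : Set ℤ} {i : ℤ} {k : ℕ} (h : i + 1 + (k + 2) / 8 ∉ χ) :
    blockSeq χ (8 * i + 10 + k) = blockSeq ∅ (2 + k) := by
  have e : (8 * i + 10 + k) / 8 = i + 1 + (k + 2) / 8 := by omega
  have e' : (8 * i + 10 + k) % 8 = (2 + k : ℤ) % 8 := by omega
  apply RomikDigit.eq_of_iff <;>
  simp only [blockSeq_eq_one, blockSeq_eq_two, e, e', h, Set.mem_empty_iff_false]

/-- Place `8 i` carries `3` in both kinds of block, so `k = 0` imposes no condition on `i`. -/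
lemma blockSeq_left {χ : Set ℤ} {i : ℤ} {k : ℕ} (h : k = 0 ∨ (8 * i - k) / 8 ∉ χ) :
    blockSeq χ (8 * i - k) = blockSeq ∅ (2 + k) := by
  have e' : (8 * i - k) % 8 = (-k : ℤ) % 8 := by omega
  apply RomikDigit.eq_of_iff <;>
  simp only [blockSeq_eq_one, blockSeq_eq_two, e', Set.mem_empty_iff_false] <;>
  rcases h with h | h <;> simp only [h] <;> simp <;> omega

lemma blockSeq_empty_add_four (n : ℤ) : blockSeq ∅ (n + 4) = (blockSeq ∅ n).vee := by
  apply RomikDigit.eq_of_iff <;> simp [blockSeq_eq_one, blockSeq_eq_two, blockSeq_eq_three] <;> omega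

/-- The value of `(32131231)^∞`. -/
lemma IsExpansion.eq_periodicBound {x : ℕ → ℝ}
    (h : IsExpansion (fun k : ℕ => blockSeq ∅ (2 + k)) x) : x 0 = periodicBound := by
  have hx := h.pos 0
  have h4 := h.shift 4
  -- Half a period exchanges `1` and `3`, so the tail four places on is `1 / (2 x 0)` and `x 0`
  -- solves a quadratic equation.
  have e : (fun k : ℕ => blockSeq ∅ (2 + (k + 4 : ℕ))) = fun k : ℕ => (blockSeq ∅ (2 + k)).vee := by
    funext k
    rw [← blockSeq_empty_add_four]; congr 1
  rw [e] at h4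
  have hw := h4.unique_zero h.vee ((isAdmissible_blockSeq ∅).noRepeat_right 2).vee
  rw [zero_add] at hw
  have d0 : blockSeq ∅ 2 = three := by simp [blockSeq_eq_three]
  have d1 : blockSeq ∅ 3 = two := by simp [blockSeq_eq_two]
  have d2 : blockSeq ∅ 4 = one := by simp [blockSeq_eq_one]
  have d3 : blockSeq ∅ 5 = three := by simp [blockSeq_eq_three]
  have e0 := h.eq 0
  have e1 := h.eq 1
  have e2 := h.eq 2
  have e3 := h.eq 3
  norm_num [d0, d1, d2, d3, branch] at e0 e1 e2 e3
  have hw' : 0 < x 4 := h.pos 4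
  have key : x 0 = (7 * x 4 + 9) / (4 * x 4 + 5) := by
    rw [e0, e1, e2, e3]; field_simp; ring
  rw [hw] at key
  have key2 : 10 * x 0 ^ 2 = 14 * x 0 + 7 := by
    field_simp at key; linarith
  have hκ := periodicBound_sq
  have hpos := lt_periodicBound
  have hmul : (x 0 - periodicBound) * (10 * (x 0 + periodicBound) - 14) = 0 := by
    linear_combination key2 - hκ
  rcases mul_eq_zero.1 hmul with h | h
  · linarith
  · nlinarith

lemma abs_branch231_sub_le {x : ℝ} (hx : 0 < x) :
    |branch231 x - branch231 periodicBound| ≤ |x - periodicBound| := by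
  have h := periodicBound_pos
  rw [branch231_sub hx h, abs_div, abs_sub_comm periodicBound x]
  refine div_le_self (abs_nonneg _) ?_
  rw [abs_of_pos (by positivity)]
  nlinarith [mul_pos hx h]

lemma abs_branch23231_sub_le {x : ℝ} (hx : 0 < x) :
    |branch23231 x - branch23231 periodicBound| ≤ |x - periodicBound| := by
  have h := periodicBound_pos
  rw [branch23231_sub hx h, abs_div]
  refine div_le_self (abs_nonneg _) ?_
  rw [abs_of_pos (by positivity)]
  nlinarith [mul_pos hx h]

/-- The value at a centre with tails `x` and `y`. -/
noncomputable def centerValue (x y : ℝ) : ℝ := 1 + branch231 x + branch23231 y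

lemma abs_centerValue_sub_le {x y : ℝ} (hx : 0 < x) (hy : 0 < y) :
    |centerValue x y - upperBound| ≤ |x - periodicBound| + |y - periodicBound| := by
  have e : centerValue x y - upperBound = (branch231 x - branch231 periodicBound) +
      (branch23231 y - branch23231 periodicBound) := by
    rw [← upperBound_eq, centerValue]; ring
  rw [e]
  exact (abs_add_le _ _).trans (add_le_add (abs_branch231_sub_le hx) (abs_branch23231_sub_le hy))

lemma periodicBound_add_one_branch : periodicBound + one.branch periodicBound = √119 / 5 := by
  have h : √119 ^ 2 = 119 := Real.sq_sqrt (by norm_num)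
  simp only [branch, periodicBound]
  field_simp
  ring_nf
  rw [h]; ring

lemma sqrt_119_div_lt_upperBound : √119 / 5 < upperBound := by
  linarith [sqrt_119_lt, lt_upperBound]

namespace IsGeodesic

variable {χ : Set ℤ} {p q : ℤ → ℝ}

lemma cutValue_vee_le (h : IsGeodesic (blockSeq χ) p q) (n : ℤ) :
    1 / (2 * p n) + 1 / (2 * q n) ≤ √119 / 5 :=
  h.vee.p_add_q_le (isAdmissible_blockSeq χ).vee (not_isCenter_vee_blockSeq χ _)
    (not_isCenter_vee_blockSeq χ _)

/-- An exceptional block with its right neighbour contains `132323231` at the places `8 i + 1` to `8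
i + 9`. Its centres are `8 i + 4` and `8 i + 6`, and the same two outer tails enter both sections
with their roles exchanged. -/
lemma center_four (h : IsGeodesic (blockSeq χ) p q) {i : ℤ} (hi : i ∈ χ) :
    p (8 * i + 3) + 1 + q (8 * i + 4) = centerValue (p (8 * i)) (q (8 * i + 9)) := by
  have d1 : blockSeq χ (8 * i + 1) = one := blockSeq_eq_one.2 (by omega)
  have d2 : blockSeq χ (8 * i + 2) = three := blockSeq_eq_three.2 (by omega)
  have d3 : blockSeq χ (8 * i + 3) = two := blockSeq_eq_two.2 (by omega)
  have d5 : blockSeq χ (8 * i + 5) = two := blockSeq_eq_two.2 (by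
    rw [show (8 * i + 5) / 8 = i by omega]; simp [hi])
  have d6 : blockSeq χ (8 * i + 6) = three := blockSeq_eq_three.2 (by
    rw [show (8 * i + 6) / 8 = i by omega]; simp [hi])
  have d7 : blockSeq χ (8 * i + 7) = two := blockSeq_eq_two.2 (by omega)
  have d8 : blockSeq χ (8 * i + 8) = three := blockSeq_eq_three.2 (by omega)
  have d9 : blockSeq χ (8 * i + 9) = one := blockSeq_eq_one.2 (by omega)
  rw [h.p_eq' (n := 8 * i + 3) (m := 8 * i + 2) (by ring), d3,
    h.p_eq' (n := 8 * i + 2) (m := 8 * i + 1) (by ring), d2,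
    h.p_eq' (n := 8 * i + 1) (m := 8 * i) (by ring), d1, branch231_eq (h.p_pos _),
    h.q_eq' (n := 8 * i + 4) (m := 8 * i + 5) (by ring), d5,
    h.q_eq' (n := 8 * i + 5) (m := 8 * i + 6) (by ring), d6,
    h.q_eq' (n := 8 * i + 6) (m := 8 * i + 7) (by ring), d7,
    h.q_eq' (n := 8 * i + 7) (m := 8 * i + 8) (by ring), d8,
    h.q_eq' (n := 8 * i + 8) (m := 8 * i + 9) (by ring), d9, branch23231_eq (h.q_pos _),
    centerValue]
  ring

lemma center_six (h : IsGeodesic (blockSeq χ) p q) {i : ℤ} (hi : i ∈ χ) :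
    p (8 * i + 5) + 1 + q (8 * i + 6) = centerValue (q (8 * i + 9)) (p (8 * i)) := by
  have d1 : blockSeq χ (8 * i + 1) = one := blockSeq_eq_one.2 (by omega)
  have d2 : blockSeq χ (8 * i + 2) = three := blockSeq_eq_three.2 (by omega)
  have d3 : blockSeq χ (8 * i + 3) = two := blockSeq_eq_two.2 (by omega)
  have d4 : blockSeq χ (8 * i + 4) = three := blockSeq_eq_three.2 (by
    rw [show (8 * i + 4) / 8 = i by omega]; simp [hi])
  have d5 : blockSeq χ (8 * i + 5) = two := blockSeq_eq_two.2 (by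
    rw [show (8 * i + 5) / 8 = i by omega]; simp [hi])
  have d7 : blockSeq χ (8 * i + 7) = two := blockSeq_eq_two.2 (by omega)
  have d8 : blockSeq χ (8 * i + 8) = three := blockSeq_eq_three.2 (by omega)
  have d9 : blockSeq χ (8 * i + 9) = one := blockSeq_eq_one.2 (by omega)
  rw [h.p_eq' (n := 8 * i + 5) (m := 8 * i + 4) (by ring), d5,
    h.p_eq' (n := 8 * i + 4) (m := 8 * i + 3) (by ring), d4,
    h.p_eq' (n := 8 * i + 3) (m := 8 * i + 2) (by ring), d3,
    h.p_eq' (n := 8 * i + 2) (m := 8 * i + 1) (by ring), d2,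
    h.p_eq' (n := 8 * i + 1) (m := 8 * i) (by ring), d1, branch23231_eq (h.p_pos _),
    h.q_eq' (n := 8 * i + 6) (m := 8 * i + 7) (by ring), d7,
    h.q_eq' (n := 8 * i + 7) (m := 8 * i + 8) (by ring), d8,
    h.q_eq' (n := 8 * i + 8) (m := 8 * i + 9) (by ring), d9, branch231_eq (h.q_pos _),
    centerValue]
  ring

lemma p_add_q_four (h : IsGeodesic (blockSeq χ) p q) {i : ℤ} (hi : i ∈ χ) :
    p (8 * i + 4) + q (8 * i + 4) = centerValue (p (8 * i)) (q (8 * i + 9)) := by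
  have d4 : blockSeq χ (8 * i + 4) = three := blockSeq_eq_three.2 (by
    rw [show (8 * i + 4) / 8 = i by omega]; simp [hi])
  rw [← h.center_four hi, h.p_eq' (n := 8 * i + 4) (m := 8 * i + 3) (by ring), d4]
  simp only [branch]

lemma p_add_q_six (h : IsGeodesic (blockSeq χ) p q) {i : ℤ} (hi : i ∈ χ) :
    p (8 * i + 6) + q (8 * i + 6) = centerValue (q (8 * i + 9)) (p (8 * i)) := by
  have d6 : blockSeq χ (8 * i + 6) = three := blockSeq_eq_three.2 (by
    rw [show (8 * i + 6) / 8 = i by omega]; simp [hi])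
  rw [← h.center_six hi, h.p_eq' (n := 8 * i + 6) (m := 8 * i + 5) (by ring), d6]
  simp only [branch]

/-- The sections of a block sequence. -/
lemma p_add_q_le_or (h : IsGeodesic (blockSeq χ) p q) (n : ℤ) :
    p n + q n ≤ √119 / 5 ∨ n / 8 ∈ χ ∧
      (p n + q n = centerValue (p (8 * (n / 8))) (q (8 * (n / 8) + 9)) ∨
        p n + q n = centerValue (q (8 * (n / 8) + 9)) (p (8 * (n / 8)))) := by
  have ht := isAdmissible_blockSeq χ
  by_cases h0 : IsCenter (blockSeq χ) n
  · right
    have hn := isCenter_blockSeq.1 h0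
    refine ⟨hn.1, hn.2.imp (fun e => ?_) fun e => ?_⟩
    · rw [← h.p_add_q_four hn.1, show 8 * (n / 8) + 4 = n by omega]
    · rw [← h.p_add_q_six hn.1, show 8 * (n / 8) + 6 = n by omega]
  · by_cases h1 : IsCenter (blockSeq χ) (n + 1)
    · right
      have hn := isCenter_blockSeq.1 h1
      have hdiv : (n + 1) / 8 = n / 8 := by omega
      rw [hdiv] at hn
      have e : p n + q n = p n + 1 + q (n + 1) := by
        rw [h.q_eq n, h1.1]; simp only [branch]; ring
      rw [e]
      refine ⟨hn.1, hn.2.imp (fun e => ?_) fun e => ?_⟩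
      · rw [← h.center_four hn.1, show 8 * (n / 8) + 3 = n by omega,
          show 8 * (n / 8) + 4 = n + 1 by omega]
      · rw [← h.center_six hn.1, show 8 * (n / 8) + 5 = n by omega,
          show 8 * (n / 8) + 6 = n + 1 by omega]
    · exact Or.inl (h.p_add_q_le ht h0 h1)

lemma cutValue_le_or (h : IsGeodesic (blockSeq χ) p q) (n : ℤ) :
    cutValue p q n ≤ √119 / 5 ∨ n / 8 ∈ χ ∧ cutValue p q n ≤ upperBound +
      (|p (8 * (n / 8)) - periodicBound| + |q (8 * (n / 8) + 9) - periodicBound|) := by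
  have hv := h.cutValue_vee_le n
  rcases h.p_add_q_le_or n with h1 | ⟨hn, h1⟩
  · exact Or.inl (max_le h1 hv)
  · right
    refine ⟨hn, max_le ?_ ?_⟩
    · rcases h1 with h1 | h1 <;> rw [h1]
      · have := (le_abs_self _).trans
          (abs_centerValue_sub_le (h.p_pos (8 * (n / 8))) (h.q_pos (8 * (n / 8) + 9)))
        linarith
      · have := (le_abs_self _).trans
          (abs_centerValue_sub_le (h.q_pos (8 * (n / 8) + 9)) (h.p_pos (8 * (n / 8))))
        linarith
    · have := sqrt_119_div_lt_upperBound
      have := abs_nonneg (p (8 * (n / 8)) - periodicBound)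
      have := abs_nonneg (q (8 * (n / 8) + 9) - periodicBound)
      linarith

lemma exists_periodic : ∃ x, IsExpansion (fun k : ℕ => blockSeq ∅ (2 + k)) x :=
  exists_expansion ((isAdmissible_blockSeq ∅).noRepeat_right 2)

lemma abs_q_sub_le (h : IsGeodesic (blockSeq χ) p q) {i : ℤ} {m : ℕ}
    (hχ : ∀ j, i < j → j ≤ i + m → j ∉ χ) : |q (8 * i + 9) - periodicBound| ≤ 2 / 2 ^ m := by
  obtain ⟨x, hx⟩ := exists_periodic
  have := (h.right (8 * i + 9)).abs_sub_le_of_agree hx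
    ((isAdmissible_blockSeq χ).noRepeat_right _) ((isAdmissible_blockSeq ∅).noRepeat_right 2) m
    fun k hk => by
      rw [show 8 * i + 9 + 1 + (k : ℤ) = 8 * i + 10 + k by ring]
      exact blockSeq_right (hχ _ (by omega) (by omega))
  rw [hx.eq_periodicBound] at this
  simpa using this

lemma abs_p_sub_le (h : IsGeodesic (blockSeq χ) p q) {i : ℤ} {m : ℕ}
    (hχ : ∀ j, i - m ≤ j → j < i → j ∉ χ) : |p (8 * i) - periodicBound| ≤ 2 / 2 ^ m := by
  obtain ⟨x, hx⟩ := exists_periodic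
  have := (h.left (8 * i)).abs_sub_le_of_agree hx
    ((isAdmissible_blockSeq χ).noRepeat_left _) ((isAdmissible_blockSeq ∅).noRepeat_right 2) m
    fun k hk => blockSeq_left (by
      rcases Nat.eq_zero_or_pos k with h0 | h0
      · exact Or.inl h0
      · exact Or.inr (hχ _ (by omega) (by omega)))
  rw [hx.eq_periodicBound] at this
  simpa using this

lemma q_eq_periodicBound (h : IsGeodesic (blockSeq χ) p q) {i : ℤ} (hχ : ∀ j, i < j → j ∉ χ) :
    q (8 * i + 9) = periodicBound := by
  obtain ⟨x, hx⟩ := exists_periodic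
  have h' := h.right (8 * i + 9)
  have e : (fun k : ℕ => blockSeq χ (8 * i + 9 + 1 + k)) = fun k : ℕ => blockSeq ∅ (2 + k) := by
    funext k
    rw [show 8 * i + 9 + 1 + (k : ℤ) = 8 * i + 10 + k by ring]
    exact blockSeq_right (hχ _ (by omega))
  rw [e] at h'
  simpa using h'.eq_periodicBound

lemma p_eq_periodicBound (h : IsGeodesic (blockSeq χ) p q) {i : ℤ} (hχ : ∀ j, j < i → j ∉ χ) :
    p (8 * i) = periodicBound := by
  have h' := h.left (8 * i)
  have e : (fun k : ℕ => blockSeq χ (8 * i - k)) = fun k : ℕ => blockSeq ∅ (2 + k) := by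
    funext k
    refine blockSeq_left ?_
    rcases Nat.eq_zero_or_pos k with h0 | h0
    · exact Or.inl h0
    · exact Or.inr (hχ _ (by omega))
  rw [e] at h'
  simpa using h'.eq_periodicBound

/-- The coordinate determines the digits, and place `8 j + 4` of an exceptional block carries `3`
where the periodic sequence has `1`. -/
lemma q_ne_periodicBound (h : IsGeodesic (blockSeq χ) p q) {i j : ℤ} (hij : i < j) (hj : j ∈ χ) :
    q (8 * i + 9) ≠ periodicBound := by
  intro hq
  obtain ⟨x, hx⟩ := exists_periodic
  have := (h.right (8 * i + 9)).digits_eq hx (by simpa [hx.eq_periodicBound] using hq)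
    (8 * j + 4 - (8 * i + 10)).toNat
  rw [show 8 * i + 9 + 1 + ((8 * j + 4 - (8 * i + 10)).toNat : ℤ) = 8 * j + 4 by omega,
    blockSeq_eq_three.2 (by rw [show (8 * j + 4) / 8 = j by omega]; simp [hj]), eq_comm,
    blockSeq_eq_three] at this
  simp only [Set.mem_empty_iff_false, false_and, false_or] at this
  omega

end IsGeodesic

/-! ### The end points of the gaps as spectral values -/

lemma mem_markoffSpectrum_of_cutValue_le {t : ℤ → RomikDigit} {p q : ℤ → ℝ} (h : IsGeodesic t p q)
    {K : ℝ} (hK : 1 ≤ K) (hle : ∀ n, cutValue p q n ≤ K) {n : ℤ} (hn : p n + q n = K) :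
    √2 * K ∈ markoffSpectrum (heckeGroup 4) := by
  obtain ⟨m, hm, h1, h2⟩ := (h.shift n).exists_mem_markoffSpectrum hK fun k => hle (k + n)
  rw [zero_add, hn] at h1
  rwa [le_antisymm h2 h1] at hm

lemma exists_blockGeodesic (χ : Set ℤ) : ∃ p q, IsGeodesic (blockSeq χ) p q :=
  (isAdmissible_blockSeq χ).exists_geodesic

namespace IsGeodesic

variable {p q : ℤ → ℝ}

lemma cutValue_le_of_empty (h : IsGeodesic (blockSeq ∅) p q) (n : ℤ) :
    cutValue p q n ≤ √119 / 5 := by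
  rcases h.cutValue_le_or n with h1 | ⟨hn, -⟩
  · exact h1
  · exact absurd hn (Set.notMem_empty _)

lemma p_add_q_of_empty (h : IsGeodesic (blockSeq ∅) p q) (i : ℤ) :
    p (8 * i + 1) + q (8 * i + 1) = √119 / 5 := by
  have hq := h.q_eq_periodicBound (i := i - 1) fun j _ => Set.notMem_empty j
  have hp := h.p_eq_periodicBound (i := i) fun j _ => Set.notMem_empty j
  rw [show 8 * (i - 1) + 9 = 8 * i + 1 by ring] at hq
  rw [hq, h.p_eq' (n := 8 * i + 1) (m := 8 * i) (by ring), blockSeq_eq_one.2 (by omega), hp,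
    ← periodicBound_add_one_branch, add_comm]

lemma cutValue_le_of_zero (h : IsGeodesic (blockSeq {0}) p q) (n : ℤ) :
    cutValue p q n ≤ upperBound := by
  rcases h.cutValue_le_or n with h1 | ⟨hn, h1⟩
  · exact h1.trans sqrt_119_div_lt_upperBound.le
  · rw [Set.mem_singleton_iff] at hn
    rw [hn, h.q_eq_periodicBound fun j hj => by simp; omega,
      h.p_eq_periodicBound fun j hj => by simp; omega] at h1
    simpa using h1

lemma p_add_q_of_zero (h : IsGeodesic (blockSeq {0}) p q) : p 4 + q 4 = upperBound := by
  have := h.p_add_q_four (i := 0) rfl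
  rw [h.q_eq_periodicBound fun j hj => by simp; omega,
    h.p_eq_periodicBound fun j hj => by simp; omega, centerValue, upperBound_eq] at this
  simpa using this

end IsGeodesic

lemma one_lt_upperBound : 1 < upperBound := by linarith [lt_upperBound]

lemma sqrt_119_div_mem_markoffSpectrum : √2 * (√119 / 5) ∈ markoffSpectrum (heckeGroup 4) := by
  obtain ⟨p, q, h⟩ := exists_blockGeodesic ∅
  exact mem_markoffSpectrum_of_cutValue_le h one_lt_sqrt_119_div.le h.cutValue_le_of_empty
    (h.p_add_q_of_empty 0)

lemma sqrt_119_div_mem_lagrangeSpectrum : √2 * (√119 / 5) ∈ lagrangeSpectrum (heckeGroup 4) := by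
  obtain ⟨p, q, h⟩ := exists_blockGeodesic ∅
  refine h.mem_lagrangeSpectrum ((isAdmissible_blockSeq ∅).noRepeat_right 1) one_lt_sqrt_119_div.le
    (fun ε hε => ?_) fun ε hε => ?_
  · convert Set.finite_empty
    ext n
    have := h.cutValue_le_of_empty n
    simp only [Set.mem_ofPred_eq, Set.mem_empty_iff_false, iff_false, not_lt]
    linarith
  · refine Set.infinite_of_forall_exists_gt fun a => ⟨8 * a + 1, ?_, by omega⟩
    have := h.p_add_q_of_empty a
    simp only [Set.mem_ofPred_eq]
    push_cast
    rw [this]; linarith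

lemma upperBound_mem_markoffSpectrum : √2 * upperBound ∈ markoffSpectrum (heckeGroup 4) := by
  obtain ⟨p, q, h⟩ := exists_blockGeodesic {0}
  exact mem_markoffSpectrum_of_cutValue_le h one_lt_upperBound.le h.cutValue_le_of_zero
    h.p_add_q_of_zero

lemma exists_four_div_two_pow_lt {ε : ℝ} (hε : 0 < ε) : ∃ m : ℕ, (2 : ℝ) / 2 ^ m + 2 / 2 ^ m < ε := by
  obtain ⟨m, hm⟩ := exists_pow_lt_of_lt_one (show 0 < ε / 4 by positivity)
    (show (1 / 2 : ℝ) < 1 by norm_num)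
  refine ⟨m, ?_⟩
  rw [one_div_pow] at hm
  have : (2 : ℝ) / 2 ^ m + 2 / 2 ^ m = 4 * (1 / 2 ^ m) := by ring
  linarith

/-- With two exceptional blocks far apart the outer tails are close to `periodicBound`, so no
section exceeds `upperBound` by more than `ε`. The right tail of block `0` differs from
`periodicBound`, and this pushes one section strictly above `upperBound`. -/
lemma exists_mem_markoffSpectrum_near {ε : ℝ} (hε : 0 < ε) :
    ∃ m ∈ markoffSpectrum (heckeGroup 4), √2 * upperBound < m ∧ m ≤ √2 * (upperBound + ε) := by
  obtain ⟨k, hk⟩ := exists_four_div_two_pow_lt hε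
  set N : ℤ := k + 1 with hN
  obtain ⟨p, q, h⟩ := exists_blockGeodesic {0, N}
  have hs : 0 < √2 := by positivity
  have h2k : (0 : ℝ) ≤ 2 / 2 ^ k := by positivity
  have hle : ∀ n, cutValue p q n ≤ upperBound + ε := by
    intro n
    rcases h.cutValue_le_or n with h1 | ⟨hn, h1⟩
    · linarith [sqrt_119_div_lt_upperBound]
    · have a : |p (8 * (n / 8)) - periodicBound| ≤ 2 / 2 ^ k := h.abs_p_sub_le fun j h1 h2 => by
        simp only [Set.mem_insert_iff, Set.mem_singleton_iff] at hn ⊢; omega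
      have b : |q (8 * (n / 8) + 9) - periodicBound| ≤ 2 / 2 ^ k := h.abs_q_sub_le fun j h1 h2 => by
        simp only [Set.mem_insert_iff, Set.mem_singleton_iff] at hn ⊢; omega
      linarith
  have h0 : (0 : ℤ) ∈ ({0, N} : Set ℤ) := by simp
  have hne := h.q_ne_periodicBound (i := 0) (j := N) (by omega) (by simp)
  have ht := isAdmissible_blockSeq {0, N}
  obtain ⟨n, hn⟩ : ∃ n, upperBound < p n + q n := by
    rcases upperBound_lt_or (h.q_pos (8 * 0 + 9)) (h.p_pos (8 * 0)) (h.q_le ht _) (h.p_le ht _) hne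
      with h' | h'
    · exact ⟨8 * 0 + 6, by rw [h.p_add_q_six h0]; exact h'⟩
    · exact ⟨8 * 0 + 4, by rw [h.p_add_q_four h0]; exact h'⟩
  obtain ⟨m, hm, h1, h2⟩ := (h.shift n).exists_mem_markoffSpectrum (K := upperBound + ε)
    (by linarith [one_lt_upperBound]) fun k => hle (k + n)
  rw [zero_add] at h1
  exact ⟨m, hm, lt_of_lt_of_le (by gcongr) h1, h2⟩

/-- Exceptional blocks at the squares recur forever with growing gaps, so the sections at their
centres tend to `upperBound`. -/
lemma upperBound_mem_lagrangeSpectrum : √2 * upperBound ∈ lagrangeSpectrum (heckeGroup 4) := by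
  set χ : Set ℤ := {i | ∃ k : ℕ, i = (k : ℤ) ^ 2} with hχ
  obtain ⟨p, q, h⟩ := exists_blockGeodesic χ
  have hgap : ∀ (m k : ℕ) (j : ℤ), m < k → (k : ℤ) ^ 2 - m ≤ j → j ≤ (k : ℤ) ^ 2 + m →
      j ≠ (k : ℤ) ^ 2 → j ∉ χ := by
    rintro m k _ hmk h1 h2 h3 ⟨l, rfl⟩
    rcases lt_trichotomy l k with hl | rfl | hl
    · have : (l : ℤ) ≤ k - 1 := by omega
      nlinarith
    · exact h3 rfl
    · have : (k : ℤ) + 1 ≤ l := by omega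
      nlinarith
  have ha : ∀ m k : ℕ, m < k → |p (8 * (k : ℤ) ^ 2) - periodicBound| ≤ 2 / 2 ^ m := fun m k hmk =>
    h.abs_p_sub_le fun j h1 h2 => hgap m k j hmk (by omega) (by omega) (by omega)
  have hb : ∀ m k : ℕ, m < k → |q (8 * (k : ℤ) ^ 2 + 9) - periodicBound| ≤ 2 / 2 ^ m :=
    fun m k hmk => h.abs_q_sub_le fun j h1 h2 => hgap m k j hmk (by omega) (by omega) (by omega)
  refine h.mem_lagrangeSpectrum ((isAdmissible_blockSeq χ).noRepeat_right 1) one_lt_upperBound.le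
    (fun ε hε => ?_) fun ε hε => ?_
  · obtain ⟨m, hm⟩ := exists_four_div_two_pow_lt hε
    refine (Set.finite_Icc (0 : ℤ) (8 * (m : ℤ) ^ 2 + 8)).subset fun n hn => ?_
    simp only [Set.mem_ofPred_eq] at hn
    rcases h.cutValue_le_or n with h1 | ⟨⟨k, hk⟩, h1⟩
    · linarith [sqrt_119_div_lt_upperBound]
    · have hkm : k ≤ m := by
        by_contra! hc
        have a := ha m k hc
        have b := hb m k hc
        rw [hk] at h1
        linarith
      have : (k : ℤ) ^ 2 ≤ (m : ℤ) ^ 2 := by gcongr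
      have : 0 ≤ (k : ℤ) ^ 2 := by positivity
      constructor <;> omega
  · obtain ⟨m, hm⟩ := exists_four_div_two_pow_lt hε
    refine Set.infinite_of_forall_exists_gt fun a => ⟨8 * (a + m + 1) ^ 2 + 4, ?_, by
      have := Nat.le_self_pow two_ne_zero (a + m + 1)
      linarith⟩
    have hmem : ((a + m + 1 : ℕ) : ℤ) ^ 2 ∈ χ := ⟨_, rfl⟩
    have hc := h.p_add_q_four hmem
    have hlow := (abs_le.1 (abs_centerValue_sub_le (h.p_pos (8 * ((a + m + 1 : ℕ) : ℤ) ^ 2))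
      (h.q_pos (8 * ((a + m + 1 : ℕ) : ℤ) ^ 2 + 9)))).1
    have ha' := ha m (a + m + 1) (by omega)
    have hb' := hb m (a + m + 1) (by omega)
    simp only [Set.mem_ofPred_eq]
    push_cast at hc hlow ha' hb' ⊢
    rw [hc]
    linarith

/-! ### The alternating sequence and the value `√10` -/

/-- The sequence `^∞(32)^∞`. -/
def altSeq (n : ℤ) : RomikDigit := if Even n then three else two

lemma altSeq_of_even {n : ℤ} (h : Even n) : altSeq n = three := if_pos h

lemma altSeq_of_not_even {n : ℤ} (h : ¬Even n) : altSeq n = two := if_neg h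

lemma altSeq_ne_one (n : ℤ) : altSeq n ≠ one := by unfold altSeq; split_ifs <;> simp

lemma isCenter_altSeq {n : ℤ} (h : Even n) : IsCenter altSeq n :=
  ⟨altSeq_of_even h, altSeq_of_not_even (by rw [Int.even_sub_one]; simpa using h),
    altSeq_of_not_even (by rw [Int.even_add_one]; simpa using h)⟩

lemma isAdmissible_altSeq : IsAdmissible altSeq where
  no_one_one n h := absurd h (altSeq_ne_one n)
  no_three_three n h h' := by
    have hn : Even n := by
      by_contra hn
      rw [altSeq_of_not_even hn] at h; cases h
    rw [altSeq_of_not_even (by rw [Int.even_add_one]; simpa using hn)] at h'; cases h'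
  extend_three n h _ _ := by
    have hn : Even n := by
      by_contra hn
      rw [altSeq_of_not_even hn] at h; cases h
    exact ⟨altSeq_of_even (hn.sub even_two), altSeq_of_even (hn.add even_two)⟩
  extend_one n h := absurd h (altSeq_ne_one n)

namespace IsGeodesic

variable {p q : ℤ → ℝ}

lemma p_add_q_altSeq (h : IsGeodesic altSeq p q) (n : ℤ) : p n + q n = √5 := by
  have key : ∀ n, Even n → p (n - 1) + 1 + q n = √5 := fun n hn =>
    h.center_add_eq fun k => isCenter_altSeq (hn.add (even_two_mul k))
  by_cases hn : Even n
  · rw [← key n hn, h.p_eq n, altSeq_of_even hn]; rfl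
  · have hn' : Even (n + 1) := by rwa [Int.even_add_one]
    rw [← key _ hn', h.q_eq n, altSeq_of_even hn', add_sub_cancel_right]
    simp only [branch]; ring

lemma cutValue_altSeq (h : IsGeodesic altSeq p q) (n : ℤ) : cutValue p q n = √5 := by
  rw [cutValue, h.p_add_q_altSeq]
  have hc : ∀ n, ¬IsCenter (fun n => (altSeq n).vee) n := fun n hc =>
    altSeq_ne_one n (vee_eq_three.1 hc.1)
  refine max_eq_left ((h.vee.p_add_q_le isAdmissible_altSeq.vee (hc _) (hc _)).trans ?_)
  have : (2.2 : ℝ) < √5 := Real.lt_sqrt_of_sq_lt (by norm_num)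
  linarith [sqrt_119_lt]

end IsGeodesic

lemma sqrt_119_div_lt_sqrt_five : √119 / 5 < √5 := by
  have : (2.2 : ℝ) < √5 := Real.lt_sqrt_of_sq_lt (by norm_num)
  linarith [sqrt_119_lt]

lemma sqrt_five_lt_upperBound : √5 < upperBound := by
  have : √5 < 2.24 := by rw [Real.sqrt_lt' (by norm_num)]; norm_num
  linarith [lt_upperBound]

lemma sqrt_five_mem_markoffSpectrum : √2 * √5 ∈ markoffSpectrum (heckeGroup 4) := by
  obtain ⟨p, q, h⟩ := isAdmissible_altSeq.exists_geodesic
  exact mem_markoffSpectrum_of_cutValue_le h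
    (one_lt_sqrt_119_div.trans sqrt_119_div_lt_sqrt_five).le (fun n => (h.cutValue_altSeq n).le)
    (h.p_add_q_altSeq 0)

lemma sqrt_five_mem_lagrangeSpectrum : √2 * √5 ∈ lagrangeSpectrum (heckeGroup 4) := by
  obtain ⟨p, q, h⟩ := isAdmissible_altSeq.exists_geodesic
  refine h.mem_lagrangeSpectrum (isAdmissible_altSeq.noRepeat_right 1)
    (one_lt_sqrt_119_div.trans sqrt_119_div_lt_sqrt_five).le (fun ε hε => ?_) fun ε hε => ?_
  · convert Set.finite_empty
    ext n
    simp only [h.cutValue_altSeq, Set.mem_ofPred_eq, Set.mem_empty_iff_false, iff_false, not_lt]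
    linarith
  · refine Set.infinite_of_forall_exists_gt fun a => ⟨a + 1, ?_, by omega⟩
    simp only [h.p_add_q_altSeq, Set.mem_ofPred_eq]
    linarith

/-! ### The words of the theorem as block sequences -/

lemma biPeriodicSeq_word32 : biPeriodicSeq word32 = altSeq := by
  funext n
  unfold biPeriodicSeq
  rcases Int.even_or_odd n with hn | hn
  · rw [altSeq_of_even hn, show n % (2 : ℕ) = 0 from Int.even_iff.1 hn]; rfl
  · rw [altSeq_of_not_even (Int.not_even_iff_odd.2 hn), show n % (2 : ℕ) = 1 from Int.odd_iff.1 hn]; rfl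

lemma blockSeq_empty_natCast (n : ℕ) : periodicSeq word31321312 n = blockSeq ∅ n := by
  unfold periodicSeq
  rw [show Fin.ofNat 8 n = Fin.ofNat 8 (n % 8) by ext; simp]
  have h8 : n % 8 < 8 := Nat.mod_lt _ (by norm_num)
  have e : (n : ℤ) % 8 = ((n % 8 : ℕ) : ℤ) := by push_cast; rfl
  unfold blockSeq
  rw [e]
  generalize n % 8 = r at h8
  interval_cases r <;> simp [word31321312, Fin.ofNat]

lemma biPeriodicSeq_word31321312 : biPeriodicSeq word31321312 = blockSeq ∅ := by
  funext n
  have h := blockSeq_empty_natCast (n % 8).toNat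
  have e : blockSeq ∅ ((n % 8).toNat : ℤ) = blockSeq ∅ n := by
    apply RomikDigit.eq_of_iff <;>
      simp only [blockSeq_eq_one, blockSeq_eq_two, Set.mem_empty_iff_false, not_false_eq_true,
        true_and, false_and, or_false] <;> omega
  rw [← e, ← h]
  rfl

/-- The word `23232` fills the places `3` to `7` of the exceptional block, hence the shift by `3`;
the initial `313` of that block is supplied by the reversed `S`. -/
lemma joinSeq_eq_blockSeq :
    joinSeq (periodicSeq word31321312) word23232 (periodicSeq word31321312) =
      fun n => blockSeq {0} (n + 3) := by
  funext n
  unfold joinSeq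
  split_ifs with h1 h2
  · rw [blockSeq_empty_natCast]
    apply RomikDigit.eq_of_iff <;>
      simp only [blockSeq_eq_one, blockSeq_eq_two, Set.mem_empty_iff_false,
        Set.mem_singleton_iff, not_false_eq_true, true_and, false_and, or_false] <;> omega
  · obtain ⟨k, rfl⟩ := Int.eq_ofNat_of_zero_le (not_lt.1 h1)
    simp only [Int.toNat_natCast] at h2
    unfold blockSeq
    interval_cases k <;> simp [word23232]
  · rw [blockSeq_empty_natCast]
    apply RomikDigit.eq_of_iff <;>
      simp only [blockSeq_eq_one, blockSeq_eq_two, Set.mem_empty_iff_false,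
        Set.mem_singleton_iff, not_false_eq_true, true_and, false_and, or_false] <;> omega

/-! ### Maximal gaps, the isolated point and the accumulation point -/

lemma Real.two_sqrt_mul_lt {x y : ℝ} (h : x < y) : √2 * x < √2 * y := by gcongr

/-- The two gaps and the isolated point between them, for a set with the given properties. -/
lemma isMaximalGap_of_gap {X : Set ℝ} {α β γ : ℝ} (hαβ : α < β) (hβγ : β < γ)
    (hX : ∀ m ∈ X, m < γ → m ≤ α ∨ m = β) (hα : α ∈ X) (hβ : β ∈ X) (hγ : γ ∈ X) :
    IsMaximalGap X α β ∧ IsMaximalGap X β γ ∧ IsIsolatedPoint X β := by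
  refine ⟨⟨hαβ, ?_, hα, hβ⟩, ⟨hβγ, ?_, hβ, hγ⟩, hβ, min (β - α) (γ - β),
    lt_min (by linarith) (by linarith), ?_⟩
  · ext m
    simp only [Set.mem_inter_iff, Set.mem_Ioo, Set.mem_empty_iff_false, iff_false]
    rintro ⟨⟨h1, h2⟩, hm⟩
    rcases hX m hm (by linarith) with h | h <;> linarith
  · ext m
    simp only [Set.mem_inter_iff, Set.mem_Ioo, Set.mem_empty_iff_false, iff_false]
    rintro ⟨⟨h1, h2⟩, hm⟩
    rcases hX m hm h2 with h | h <;> linarith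
  · ext m
    simp only [Set.mem_inter_iff, Set.mem_Ioo, Set.mem_singleton_iff]
    have h3 := min_le_left (β - α) (γ - β)
    have h4 := min_le_right (β - α) (γ - β)
    constructor
    · rintro ⟨⟨h1, h2⟩, hm⟩
      rcases hX m hm (by linarith) with h | h <;> linarith
    · rintro rfl
      have : 0 < min (m - α) (γ - m) := lt_min (by linarith) (by linarith)
      exact ⟨⟨by linarith, by linarith⟩, hβ⟩

lemma accPt_upperBound : AccPt (√2 * upperBound) (Filter.principal (markoffSpectrum (heckeGroup 4))) := by
  rw [accPt_iff_nhds]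
  intro U hU
  obtain ⟨ε, hε, hball⟩ := Metric.mem_nhds_iff.1 hU
  have hs : 0 < √2 := by positivity
  obtain ⟨m, hm, h1, h2⟩ := exists_mem_markoffSpectrum_near (ε := ε / (2 * √2)) (by positivity)
  refine ⟨m, ⟨hball ?_, hm⟩, h1.ne'⟩
  rw [Metric.mem_ball, Real.dist_eq, abs_of_pos (by linarith)]
  have : √2 * (upperBound + ε / (2 * √2)) = √2 * upperBound + ε / 2 := by field_simp
  linarith

theorem mainTheorem1 :
    (IsMaximalGap (markoffSpectrum (heckeGroup 4)) (√238 / 5) √10 ∧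
      IsMaximalGap (lagrangeSpectrum (heckeGroup 4)) (√238 / 5) √10) ∧
    (IsMaximalGap (markoffSpectrum (heckeGroup 4)) √10 ((2124 * √2 + 48 * √238) / 1177) ∧
      IsMaximalGap (lagrangeSpectrum (heckeGroup 4)) √10 ((2124 * √2 + 48 * √238) / 1177)) ∧
    (IsIsolatedPoint (markoffSpectrum (heckeGroup 4)) √10 ∧
      IsIsolatedPoint (lagrangeSpectrum (heckeGroup 4)) √10) ∧
    markoffNumber (biPeriodicSeq word31321312) = ENNReal.ofReal (√238 / 5) ∧
    markoffNumber (biPeriodicSeq word32) = ENNReal.ofReal √10 ∧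
    markoffNumber (joinSeq (periodicSeq word31321312) word23232 (periodicSeq word31321312)) =
      ENNReal.ofReal ((2124 * √2 + 48 * √238) / 1177) ∧
    AccPt ((2124 * √2 + 48 * √238) / 1177) (Filter.principal (markoffSpectrum (heckeGroup 4))) := by

  rw [← sqrt_two_mul_sqrt_119, ← sqrt_two_mul_sqrt_five, ← sqrt_two_mul_upperBound]
  have h1 := Real.two_sqrt_mul_lt sqrt_119_div_lt_sqrt_five
  have h2 := Real.two_sqrt_mul_lt sqrt_five_lt_upperBound
  obtain ⟨m1, m2, m3⟩ := isMaximalGap_of_gap h1 h2 (fun m => markoffSpectrum_gap)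
    sqrt_119_div_mem_markoffSpectrum sqrt_five_mem_markoffSpectrum upperBound_mem_markoffSpectrum
  obtain ⟨l1, l2, l3⟩ := isMaximalGap_of_gap h1 h2 (fun m => lagrangeSpectrum_gap)
    sqrt_119_div_mem_lagrangeSpectrum sqrt_five_mem_lagrangeSpectrum upperBound_mem_lagrangeSpectrum
  refine ⟨⟨m1, l1⟩, ⟨m2, l2⟩, ⟨m3, l3⟩, ?_, ?_, ?_, accPt_upperBound⟩
  · rw [biPeriodicSeq_word31321312]
    obtain ⟨p, q, h⟩ := exists_blockGeodesic ∅
    exact h.markoffNumber_eq (isAdmissible_blockSeq ∅) h.cutValue_le_of_empty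
      ⟨_, h.p_add_q_of_empty 0⟩
  · rw [biPeriodicSeq_word32]
    obtain ⟨p, q, h⟩ := isAdmissible_altSeq.exists_geodesic
    exact h.markoffNumber_eq isAdmissible_altSeq (fun n => (h.cutValue_altSeq n).le)
      ⟨0, h.p_add_q_altSeq 0⟩
  · rw [joinSeq_eq_blockSeq]
    obtain ⟨p, q, h⟩ := exists_blockGeodesic {0}
    exact (h.shift 3).markoffNumber_eq ((isAdmissible_blockSeq {0}).shift 3)
      (fun n => h.cutValue_le_of_zero (n + 3)) ⟨1, h.p_add_q_of_zero⟩
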